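/- Let $p$ be a prime, $K/\mathbb{Q}_p$ a field extension of finite degree $d$, $A$ its ring of integers, $\pi$ a uniformizer of $A$, $k$ the residue field of $A$, $q=\#k$, $e$ the ramification index (so that $\pi^e/p\in A^\times$), $\overline{k}$ an algebraic closure of $k$, and let $n\ge 1$. For a $p$-adic integer ring $B$ with uniformizer $\pi_B$ and residue field of cardinality $q_B$, let $V^B=B[v_1,v_2,\dots]$ carry the universal $B$-typical (one-dimensional) formal $B$-module on Hazewinkel's generators, i.e. the formal $B$-module with logarithm $\sum_{m\ge 0}\ell_m X^{q_B^m}$, $\ell_0=1$, $\pi_B\ell_m=\sum_{0\le j<m}\ell_j v_{m-j}^{q_B^j}$. For a $B$-algebra $R$ and $\alpha\in R$ let ${}_\alpha\mathbb{G}^B_{1/m}$ be the formal $B$-module over $R$ classified by $V^B\to R$, $v_m\mapsto\alpha$, $v_i\mapsto 0$ for $i\ne m$. The automorphism group of a formal module over $\overline{k}$ consists of the invertible power series commuting with the group law and with the action, under composition; it is topologised by coefficientwise convergence ($\overline{k}$ discrete), i.e. as a subgroup of the inverse limit of the discrete automorphism groups of the truncations (buds). Let $\omega\in\overline{k}$ satisfy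 $\omega^{(q^{en}-1)/(q^n-1)}=\overline{\pi^e/p}$, the residue class of $\pi^e/p$. Put $G={}_\omega\mathbb{G}^A_{1/n}$ over $\overline{k}$ and $H={}_1\mathbb{G}^{\mathbb{Z}_p}_{1/dn}$ over $\overline{k}$ (with uniformizer $p$ of $\mathbb{Z}_p$), so that $\mathrm{Aut}(H)$ is the height $dn$ Morava stabilizer group. Theorem. (i) The underlying formal $\mathbb{Z}_p$-module of $G$ is strictly isomorphic to $H$. (ii) For every isomorphism $\varphi$ from the underlying formal $\mathbb{Z}_p$-module of $G$ to $H$, the group homomorphism $\mathrm{Aut}(G)\to\mathrm{Aut}(H)$, $\theta\mapsto\varphi\theta\varphi^{-1}$, is a closed embedding of topological spaces; thus $\mathrm{Aut}(G)$ is identified with a closed subgroup of the height $dn$ Morava stabilizer group $\mathrm{Aut}(H)$. (iii) If $(\pi^e/p)^{q-1}=1$ (for instance if $\pi^e=p$), then the underlying formal $\mathbb{Z}_p$-module of $G$ is equal to $H$, so that $\mathrm{Aut}(G)$ is literally a closed subgroup of $\mathrm{Aut}(H)$. -/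

import Mathlib

/-- A one-dimensional commutative formal `A`-module over an `A`-algebra `R`: a commutative formal
group law `F` over `R` together with a ring homomorphism `a ↦ [a]` from `A` to the endomorphisms
of `F` such that `[a](X) ≡ aX` modulo degree `2`. -/
structure FormalModule (A R : Type*) [CommRing A] [CommRing R] [Algebra A R]
    extends FormalGroup R where
  comm : toPowerSeries = toPowerSeries.subst ![MvPowerSeries.X 1, MvPowerSeries.X 0]
  /-- The power series `[a](X)`. -/
  act : A → PowerSeries R
  act_constantCoeff (a : A) : (act a).constantCoeff = 0
  act_coeff_one (a : A) : (act a).coeff 1 = algebraMap A R a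
  act_one : act 1 = PowerSeries.X
  act_mul (a b : A) : act (a * b) = (act a).subst (act b)
  act_add (a b : A) : act (a + b) = toPowerSeries.subst ![act a, act b]
  act_hom (a : A) : (act a).subst toPowerSeries = toPowerSeries.subst
    ![(act a).subst (MvPowerSeries.X 0 : MvPowerSeries (Fin 2) R),
      (act a).subst (MvPowerSeries.X 1 : MvPowerSeries (Fin 2) R)]

namespace FormalModule

section Subst

variable {R : Type*} [CommRing R]

theorem hasSubst_pair {σ : Type*} {a b : MvPowerSeries σ R}
    (ha : MvPowerSeries.constantCoeff a = 0) (hb : MvPowerSeries.constantCoeff b = 0) :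
    MvPowerSeries.HasSubst ![a, b] :=
  MvPowerSeries.hasSubst_of_constantCoeff_zero fun s => by fin_cases s <;> simp [ha, hb]

theorem constantCoeff_subst_pair {σ : Type*} {a b : MvPowerSeries σ R}
    (ha : MvPowerSeries.constantCoeff a = 0) (hb : MvPowerSeries.constantCoeff b = 0)
    {F : MvPowerSeries (Fin 2) R} (hF : MvPowerSeries.constantCoeff F = 0) :
    MvPowerSeries.constantCoeff (F.subst ![a, b]) = 0 :=
  MvPowerSeries.constantCoeff_subst_eq_zero (hasSubst_pair ha hb)
    (fun s => by fin_cases s <;> simp [ha, hb]) hF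

theorem constantCoeff_comp {σ : Type*} {a : MvPowerSeries σ R}
    (ha : MvPowerSeries.constantCoeff a = 0) {f : PowerSeries R} (hf : f.constantCoeff = 0) :
    MvPowerSeries.constantCoeff (f.subst a) = 0 :=
  PowerSeries.constantCoeff_subst_eq_zero ha f hf

theorem hasSubst_zero {σ : Type*} {a : MvPowerSeries σ R}
    (ha : MvPowerSeries.constantCoeff a = 0) : PowerSeries.HasSubst a :=
  PowerSeries.HasSubst.of_constantCoeff_zero ha

theorem subst_pair_subst {σ τ : Type*} {a b : MvPowerSeries σ R}
    (ha : MvPowerSeries.constantCoeff a = 0) (hb : MvPowerSeries.constantCoeff b = 0)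
    {c : σ → MvPowerSeries τ R} (hc : MvPowerSeries.HasSubst c) (F : MvPowerSeries (Fin 2) R) :
    (F.subst ![a, b]).subst c = F.subst ![a.subst c, b.subst c] := by
  rw [MvPowerSeries.subst_comp_subst_apply (hasSubst_pair ha hb) hc]
  congr 1
  funext s
  fin_cases s <;> rfl

theorem comp_subst {σ τ : Type*} {a : MvPowerSeries σ R}
    (ha : MvPowerSeries.constantCoeff a = 0)
    {c : σ → MvPowerSeries τ R} (hc : MvPowerSeries.HasSubst c) (f : PowerSeries R) :
    (f.subst a).subst c = f.subst (a.subst c) := by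
  rw [PowerSeries.subst_def, PowerSeries.subst_def,
    MvPowerSeries.subst_comp_subst_apply (hasSubst_zero ha).const hc]

theorem comp_X_subst {σ τ : Type*} (i : σ)
    {c : σ → MvPowerSeries τ R} (hc : MvPowerSeries.HasSubst c) (f : PowerSeries R) :
    (f.subst (MvPowerSeries.X i : MvPowerSeries σ R)).subst c = f.subst (c i) := by
  rw [comp_subst (MvPowerSeries.constantCoeff_X i) hc, MvPowerSeries.subst_X hc]

/-- A version of associativity of composition. -/
theorem comp_comp {σ : Type*} {a : MvPowerSeries σ R} {g : PowerSeries R}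
    (hg : g.constantCoeff = 0) (ha : MvPowerSeries.constantCoeff a = 0) (f : PowerSeries R) :
    PowerSeries.subst a (PowerSeries.subst g f) = f.subst (g.subst a) :=
  PowerSeries.subst_comp_subst_apply (hasSubst_zero hg) (hasSubst_zero ha) f

/-- If `φ(F) = H(φ, φ)` then `φ(F(a, b)) = H(φ(a), φ(b))`. -/
theorem hom_pair {σ : Type*} {a b : MvPowerSeries σ R}
    (ha : MvPowerSeries.constantCoeff a = 0) (hb : MvPowerSeries.constantCoeff b = 0)
    {F H : MvPowerSeries (Fin 2) R} (hF : MvPowerSeries.constantCoeff F = 0)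
    {f : PowerSeries R} (hf : f.constantCoeff = 0)
    (h : f.subst F = H.subst ![f.subst (MvPowerSeries.X 0 : MvPowerSeries (Fin 2) R),
      f.subst (MvPowerSeries.X 1 : MvPowerSeries (Fin 2) R)]) :
    f.subst (F.subst ![a, b]) = H.subst ![f.subst a, f.subst b] := by
  have hc := hasSubst_pair ha hb
  rw [← comp_subst hF hc, h, subst_pair_subst
    (constantCoeff_comp (MvPowerSeries.constantCoeff_X 0) hf)
    (constantCoeff_comp (MvPowerSeries.constantCoeff_X 1) hf) hc,
    comp_X_subst 0 hc, comp_X_subst 1 hc]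
  rfl

end Subst

variable {A B R S : Type*} [CommRing A] [CommRing B] [CommRing R] [CommRing S]
  [Algebra A R] [Algebra A S]

theorem ext' {G H : FormalModule A R} (h : G.toPowerSeries = H.toPowerSeries)
    (h' : G.act = H.act) : G = H := by
  obtain ⟨⟨F, _, _, _, _⟩, _, f, _, _, _, _, _, _⟩ := G
  obtain ⟨⟨F', _, _, _, _⟩, _, f', _, _, _, _, _, _⟩ := H
  obtain rfl : F = F' := h
  obtain rfl : f = f' := h'
  rfl

/-- Base change of a formal `A`-module along a homomorphism of `A`-algebras. -/
noncomputable def baseChange (G : FormalModule A R) (f : R →ₐ[A] S) : FormalModule A S where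
  toFormalGroup := G.toFormalGroup.map (f : R →+* S)
  comm := by
    have h := congrArg (MvPowerSeries.map (f : R →+* S)) G.comm
    rw [MvPowerSeries.map_subst MvPowerSeries.HasSubst.X_X] at h
    refine h.trans ?_
    rw [FormalGroup.map_toPowerSeries]
    congr 1
    funext s
    fin_cases s <;> simp
  act a := (G.act a).map (f : R →+* S)
  act_constantCoeff a := by
    rw [← PowerSeries.coeff_zero_eq_constantCoeff_apply, PowerSeries.coeff_map,
      PowerSeries.coeff_zero_eq_constantCoeff_apply, G.act_constantCoeff, map_zero]
  act_coeff_one a := by simp [G.act_coeff_one]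
  act_one := by simp [G.act_one]
  act_mul a b := by
    rw [G.act_mul]
    exact PowerSeries.map_subst (hasSubst_zero (G.act_constantCoeff b)) _
  act_add a b := by
    rw [G.act_add]
    refine (MvPowerSeries.map_subst
      (hasSubst_pair (G.act_constantCoeff a) (G.act_constantCoeff b)) _).trans ?_
    rw [FormalGroup.map_toPowerSeries]
    congr 1
    funext s
    fin_cases s <;> rfl
  act_hom a := by
    have h := congrArg (MvPowerSeries.map (f : R →+* S)) (G.act_hom a)
    have h0 := constantCoeff_comp (MvPowerSeries.constantCoeff_X (R := R) (0 : Fin 2))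
      (G.act_constantCoeff a)
    have h1 := constantCoeff_comp (MvPowerSeries.constantCoeff_X (R := R) (1 : Fin 2))
      (G.act_constantCoeff a)
    rw [PowerSeries.map_subst (hasSubst_zero G.zero_constantCoeff),
      MvPowerSeries.map_subst (hasSubst_pair h0 h1)] at h
    refine h.trans ?_
    rw [FormalGroup.map_toPowerSeries]
    congr 1
    funext s
    fin_cases s
    · exact (PowerSeries.map_subst (hasSubst_zero (MvPowerSeries.constantCoeff_X 0)) _).trans
        (by rw [MvPowerSeries.map_X]; rfl)
    · exact (PowerSeries.map_subst (hasSubst_zero (MvPowerSeries.constantCoeff_X 1)) _).trans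
        (by rw [MvPowerSeries.map_X]; rfl)

/-- The underlying formal `B`-module of a formal `A`-module, for an algebra `A` over `B`. -/
def restrictScalars (B : Type*) [CommRing B] [Algebra B A] [Algebra B R] [IsScalarTower B A R]
    (G : FormalModule A R) : FormalModule B R where
  toFormalGroup := G.toFormalGroup
  comm := G.comm
  act b := G.act (algebraMap B A b)
  act_constantCoeff b := G.act_constantCoeff _
  act_coeff_one b := by rw [G.act_coeff_one, ← IsScalarTower.algebraMap_apply]
  act_one := by rw [map_one, G.act_one]
  act_mul a b := by rw [map_mul, G.act_mul]
  act_add a b := by rw [map_add, G.act_add]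
  act_hom b := G.act_hom _

/-- An isomorphism `G → H` of formal `A`-modules over `R`: an invertible power series `φ`
(without constant term) with `φ(G(X, Y)) = H(φ(X), φ(Y))` which commutes with the action of `A`. -/
@[ext]
structure Iso (G H : FormalModule A R) where
  toSeries : PowerSeries R
  constantCoeff_eq : toSeries.constantCoeff = 0
  isUnit_coeff_one : IsUnit (toSeries.coeff 1)
  map_group : toSeries.subst G.toPowerSeries = H.toPowerSeries.subst
    ![toSeries.subst (MvPowerSeries.X 0 : MvPowerSeries (Fin 2) R),
      toSeries.subst (MvPowerSeries.X 1 : MvPowerSeries (Fin 2) R)]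
  map_act (a : A) : toSeries.subst (G.act a) = (H.act a).subst toSeries

namespace Iso

variable {G H K L : FormalModule A R}

/-- An isomorphism is strict if `φ(X) ≡ X` modulo degree `2`. -/
def IsStrict (φ : Iso G H) : Prop := φ.toSeries.coeff 1 = 1

/-- The identity. -/
noncomputable def refl (G : FormalModule A R) : Iso G G where
  toSeries := PowerSeries.X
  constantCoeff_eq := by simp
  isUnit_coeff_one := by simp
  map_group := by
    rw [PowerSeries.subst_X (hasSubst_zero G.zero_constantCoeff),
      PowerSeries.subst_X (hasSubst_zero (MvPowerSeries.constantCoeff_X 0)),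
      PowerSeries.subst_X (hasSubst_zero (MvPowerSeries.constantCoeff_X 1))]
    conv_lhs => rw [← id_eq G.toPowerSeries, ← MvPowerSeries.subst_self]
    congr 1
    funext s
    fin_cases s <;> rfl
  map_act a := by
    rw [PowerSeries.subst_X (hasSubst_zero (G.act_constantCoeff a)), PowerSeries.X_subst]

theorem coeff_one_comp (f g : PowerSeries R) (hg : g.constantCoeff = 0) :
    PowerSeries.coeff 1 (PowerSeries.subst g f) = f.coeff 1 * g.coeff 1 := by
  rw [PowerSeries.coeff_subst' (hasSubst_zero hg), finsum_eq_single _ 1]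
  · simp
  · intro d hd
    rcases d with _ | _ | d
    · simp [PowerSeries.coeff_one]
    · exact absurd rfl hd
    · obtain ⟨h, rfl⟩ := PowerSeries.X_dvd_iff.mpr hg
      rw [mul_pow, PowerSeries.coeff_X_pow_mul', if_neg (by omega), smul_zero]

/-- Composition: `φ.trans ψ` is the power series `ψ(φ(X))`. -/
noncomputable def trans (φ : Iso G H) (ψ : Iso H K) : Iso G K where
  toSeries := ψ.toSeries.subst φ.toSeries
  constantCoeff_eq := constantCoeff_comp φ.constantCoeff_eq ψ.constantCoeff_eq
  isUnit_coeff_one := by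
    rw [coeff_one_comp _ _ φ.constantCoeff_eq]
    exact ψ.isUnit_coeff_one.mul φ.isUnit_coeff_one
  map_group := by
    have h0 := MvPowerSeries.constantCoeff_X (R := R) (0 : Fin 2)
    have h1 := MvPowerSeries.constantCoeff_X (R := R) (1 : Fin 2)
    rw [comp_comp φ.constantCoeff_eq G.zero_constantCoeff, comp_comp φ.constantCoeff_eq h0,
      comp_comp φ.constantCoeff_eq h1, φ.map_group]
    exact hom_pair (constantCoeff_comp h0 φ.constantCoeff_eq)
      (constantCoeff_comp h1 φ.constantCoeff_eq) H.zero_constantCoeff ψ.constantCoeff_eq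
      ψ.map_group
  map_act a := by
    rw [comp_comp φ.constantCoeff_eq (G.act_constantCoeff a), φ.map_act,
      ← comp_comp (H.act_constantCoeff a) φ.constantCoeff_eq, ψ.map_act,
      comp_comp ψ.constantCoeff_eq φ.constantCoeff_eq]

/-- The inverse isomorphism, given by the compositional inverse of `φ`. -/
noncomputable def symm (φ : Iso G H) : Iso H G where
  toSeries := φ.toSeries.substInvOfIsUnit φ.isUnit_coeff_one
  constantCoeff_eq := PowerSeries.constantCoeff_substInvOfIsUnit _ _
  isUnit_coeff_one := by
    rw [PowerSeries.coeff_one_substInvOfIsUnit]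
    exact Units.isUnit _
  map_group := by
    set χ := φ.toSeries.substInvOfIsUnit φ.isUnit_coeff_one
    have hχ : χ.constantCoeff = 0 := PowerSeries.constantCoeff_substInvOfIsUnit _ _
    have hr : φ.toSeries.subst χ = PowerSeries.X :=
      PowerSeries.subst_substInvOfIsUnit_right _ φ.constantCoeff_eq _
    have hl : χ.subst φ.toSeries = PowerSeries.X :=
      PowerSeries.subst_substInvOfIsUnit_left _ φ.constantCoeff_eq _
    have h0 := MvPowerSeries.constantCoeff_X (R := R) (0 : Fin 2)
    have h1 := MvPowerSeries.constantCoeff_X (R := R) (1 : Fin 2)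
    have k0 := constantCoeff_comp h0 hχ
    have k1 := constantCoeff_comp h1 hχ
    have key := hom_pair k0 k1 G.zero_constantCoeff φ.constantCoeff_eq φ.map_group
    rw [← comp_comp hχ h0, ← comp_comp hχ h1, hr, PowerSeries.subst_X (hasSubst_zero h0),
      PowerSeries.subst_X (hasSubst_zero h1)] at key
    have e : H.toPowerSeries.subst ![MvPowerSeries.X 0, MvPowerSeries.X 1] = H.toPowerSeries := by
      conv_rhs => rw [← id_eq H.toPowerSeries, ← MvPowerSeries.subst_self]
      congr 1
      funext s
      fin_cases s <;> rfl
    rw [e] at key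
    rw [← key, ← comp_comp φ.constantCoeff_eq (constantCoeff_subst_pair k0 k1 G.zero_constantCoeff),
      hl, PowerSeries.subst_X
        (hasSubst_zero (constantCoeff_subst_pair k0 k1 G.zero_constantCoeff))]
  map_act a := by
    set χ := φ.toSeries.substInvOfIsUnit φ.isUnit_coeff_one
    have hχ : χ.constantCoeff = 0 := PowerSeries.constantCoeff_substInvOfIsUnit _ _
    have hr : φ.toSeries.subst χ = PowerSeries.X :=
      PowerSeries.subst_substInvOfIsUnit_right _ φ.constantCoeff_eq _
    have hl : χ.subst φ.toSeries = PowerSeries.X :=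
      PowerSeries.subst_substInvOfIsUnit_left _ φ.constantCoeff_eq _
    have hc := constantCoeff_comp hχ (G.act_constantCoeff a)
    have key : φ.toSeries.subst ((G.act a).subst χ) = H.act a := by
      rw [← comp_comp (G.act_constantCoeff a) hχ, φ.map_act, comp_comp φ.constantCoeff_eq hχ, hr]
      exact PowerSeries.X_subst _
    rw [← key, ← comp_comp φ.constantCoeff_eq hc, hl, PowerSeries.subst_X (hasSubst_zero hc)]

theorem trans_assoc (φ : Iso G H) (ψ : Iso H K) (θ : Iso K L) :
    (φ.trans ψ).trans θ = φ.trans (ψ.trans θ) :=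
  Iso.ext (comp_comp ψ.constantCoeff_eq φ.constantCoeff_eq _).symm

theorem refl_trans (φ : Iso G H) : (refl G).trans φ = φ :=
  Iso.ext (PowerSeries.X_subst _)

theorem trans_refl (φ : Iso G H) : φ.trans (refl H) = φ :=
  Iso.ext (PowerSeries.subst_X (hasSubst_zero φ.constantCoeff_eq))

theorem trans_symm (φ : Iso G H) : φ.trans φ.symm = refl G :=
  Iso.ext (PowerSeries.subst_substInvOfIsUnit_left _ φ.constantCoeff_eq _)

theorem symm_trans (φ : Iso G H) : φ.symm.trans φ = refl H :=
  Iso.ext (PowerSeries.subst_substInvOfIsUnit_right _ φ.constantCoeff_eq _)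

end Iso

/-- The automorphism group of a formal `A`-module. -/
abbrev Aut (G : FormalModule A R) : Type _ := Iso G G

namespace Aut

variable {G H : FormalModule A R}

/-- The product of `φ` and `ψ` is the composite `φ(ψ(X))`. -/
noncomputable instance : Group (Aut G) where
  mul φ ψ := Iso.trans ψ φ
  one := Iso.refl G
  inv φ := Iso.symm φ
  mul_assoc φ ψ θ := (Iso.trans_assoc θ ψ φ).symm
  one_mul φ := Iso.trans_refl φ
  mul_one φ := Iso.refl_trans φ
  inv_mul_cancel φ := Iso.trans_symm φ

/-- The topology of coefficientwise convergence, i.e. the coarsest topology for which every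
coefficient is a continuous function to the discrete set `R`. The automorphisms which are congruent
to `X` modulo degree `m`, for `m = 1, 2, …`, form a basis of neighbourhoods of the identity. -/
noncomputable instance : TopologicalSpace (Aut G) :=
  ⨅ m : ℕ, TopologicalSpace.induced (fun φ : Aut G => PowerSeries.coeff m (Iso.toSeries φ)) ⊥

/-- An isomorphism `φ : G → H` induces an isomorphism of automorphism groups, `θ ↦ φ θ φ⁻¹`. -/
noncomputable def conj (φ : Iso G H) : Aut G ≃* Aut H where
  toFun θ := (φ.symm.trans θ).trans φ
  invFun θ := (φ.trans θ).trans φ.symm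
  left_inv θ := by
    simp only [Iso.trans_assoc, Iso.trans_symm, Iso.trans_refl]
    rw [← Iso.trans_assoc, Iso.trans_symm, Iso.refl_trans]
  right_inv θ := by
    simp only [Iso.trans_assoc, Iso.symm_trans, Iso.trans_refl]
    rw [← Iso.trans_assoc, Iso.symm_trans, Iso.refl_trans]
  map_mul' θ η := by
    change (φ.symm.trans (Iso.trans η θ)).trans φ =
      Iso.trans ((φ.symm.trans η).trans φ) ((φ.symm.trans θ).trans φ)
    simp only [Iso.trans_assoc]
    rw [← Iso.trans_assoc φ φ.symm (Iso.trans θ φ), Iso.trans_symm, Iso.refl_trans]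

/-- An automorphism of a formal `A`-module is an automorphism of the underlying formal
`B`-module. -/
noncomputable def restrictScalars (B : Type*) [CommRing B] [Algebra B A] [Algebra B R]
    [IsScalarTower B A R] (G : FormalModule A R) : Aut G →* Aut (G.restrictScalars B) where
  toFun φ :=
    { toSeries := Iso.toSeries φ
      constantCoeff_eq := Iso.constantCoeff_eq φ
      isUnit_coeff_one := Iso.isUnit_coeff_one φ
      map_group := Iso.map_group φ
      map_act := fun b => Iso.map_act φ (algebraMap B A b) }
  map_one' := rfl
  map_mul' _ _ := rfl

end Aut

end FormalModule

namespace FunctionalEquation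

section Congruences

/-- If `g ≡ h` modulo `ϖ ^ r`, with `r ≥ 1` and `ϖ ∣ p`, then `g ^ p ≡ h ^ p` modulo
`ϖ ^ (r + 1)`. -/
theorem dvd_pow_sub_pow {W : Type*} [CommRing W] {ϖ g h : W} {p r : ℕ} (hp : ϖ ∣ (p : W))
    (hr : 1 ≤ r) (hgh : ϖ ^ r ∣ g - h) : ϖ ^ (r + 1) ∣ g ^ p - h ^ p := by
  obtain ⟨t, ht⟩ := hgh
  obtain ⟨c, hc⟩ := hp
  obtain ⟨k, hk⟩ := Polynomial.powAddExpansion h (ϖ ^ r * t) p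
  obtain ⟨r, rfl⟩ := Nat.exists_eq_add_of_le hr
  have hg : g = h + ϖ ^ (1 + r) * t := by rw [← ht]; ring
  rw [hg, hk, hc]
  exact ⟨c * h ^ (p - 1) * t + k * ϖ ^ r * t ^ 2, by ring⟩

theorem dvd_pow_pow_sub_pow_pow {W : Type*} [CommRing W] {ϖ g h : W} {p r : ℕ}
    (hp : ϖ ∣ (p : W)) (hr : 1 ≤ r) (hgh : ϖ ^ r ∣ g - h) (m : ℕ) :
    ϖ ^ (r + m) ∣ g ^ p ^ m - h ^ p ^ m := by
  induction m with
  | zero => simpa using hgh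
  | succ m ih =>
    have := dvd_pow_sub_pow hp (by omega) ih
    rwa [← pow_mul, ← pow_mul, ← pow_succ] at this

end Congruences

/-- The data of a functional equation: rings `V → S`, an element `ϖ` of `V` whose quotient has
characteristic `p`, a lift `σ` of the `q`-power map, and coefficients `s i` with `ϖ * s i` in `V`. -/
structure Datum (V S k : Type*) [CommRing V] [CommRing S] [CommRing k] where
  ι : V →+* S
  ρ : V →+* k
  σV : V →+* V
  σ : S →+* S
  hσ (x : V) : σ (ι x) = ι (σV x)
  ϖ : V
  hρ (x : V) : ρ x = 0 ↔ ϖ ∣ x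
  hσϖ : σV ϖ = ϖ
  p : ℕ
  hp : p.Prime
  hchar : CharP k p
  f : ℕ
  hf : f ≠ 0
  hfrob (x : V) : ρ (σV x) = ρ x ^ p ^ f
  s : ℕ → S
  w : ℕ → V
  hs (i : ℕ) : ι ϖ * s i = ι (w i)
  l : ℕ → S
  l_zero : l 0 = 1
  l_succ (m : ℕ) : l (m + 1) = ∑ i ∈ Finset.range (m + 1), s (i + 1) * (σ ^ (i + 1)) (l (m - i))

namespace Datum

variable {V S k : Type*} [CommRing V] [CommRing S] [CommRing k] (D : Datum V S k)

/-- The cardinality `q`. -/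
def q : ℕ := D.p ^ D.f

theorem two_le_q : 2 ≤ D.q :=
  D.hp.two_le.trans (Nat.le_self_pow D.hf D.p)

theorem σ_pow_ι (i : ℕ) (x : V) : (D.σ ^ i) (D.ι x) = D.ι ((D.σV ^ i) x) := by
  induction i with
  | zero => rfl
  | succ i ih => rw [pow_succ', RingHom.mul_def, RingHom.comp_apply, ih, D.hσ, pow_succ']; rfl

theorem σV_pow_ϖ (i : ℕ) : (D.σV ^ i) D.ϖ = D.ϖ := by
  induction i with
  | zero => rfl
  | succ i ih => rw [pow_succ', RingHom.mul_def, RingHom.comp_apply, ih, D.hσϖ]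

theorem ρ_σV_pow (i : ℕ) (x : V) : D.ρ ((D.σV ^ i) x) = D.ρ x ^ D.q ^ i := by
  induction i with
  | zero => simp
  | succ i ih =>
    rw [pow_succ', RingHom.mul_def, RingHom.comp_apply, D.hfrob, ih, ← pow_mul, pow_succ, q]

theorem ϖ_pow_mul_l (m : ℕ) : ∃ x : V, D.ι D.ϖ ^ m * D.l m = D.ι x := by
  induction m using Nat.strong_induction_on with
  | _ m ih =>
    rcases m with _ | m
    · exact ⟨1, by simp [D.l_zero]⟩
    · choose! x hx using ih
      refine ⟨∑ i ∈ Finset.range (m + 1),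
        D.w (i + 1) * D.ϖ ^ i * (D.σV ^ (i + 1)) (x (m - i)), ?_⟩
      rw [D.l_succ, Finset.mul_sum, map_sum]
      refine Finset.sum_congr rfl fun i hi => ?_
      have hi' := Finset.mem_range.mp hi
      have h := congrArg (D.σ ^ (i + 1)) (hx (m - i) (by omega))
      rw [map_mul, map_pow, D.σ_pow_ι, D.σV_pow_ϖ, D.σ_pow_ι] at h
      rw [map_mul, map_mul, map_pow, ← h, ← D.hs]
      have e : m + 1 = (m - i) + i + 1 := by omega
      rw [e, pow_succ, pow_add]
      have e' : m - i + i + 1 - 1 - i = m - i := by omega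
      ring_nf

variable {τ : Type*}

/-- `g ↦ (σ ^ i g)(X ^ (q ^ i))`. -/
noncomputable def E (i : ℕ) : MvPowerSeries τ S →+* MvPowerSeries τ S :=
  (MvPowerSeries.expand (D.q ^ i)
    (pow_ne_zero _ (by have := D.two_le_q; omega))).toRingHom.comp (MvPowerSeries.map (D.σ ^ i))

/-- The same on integral power series. -/
noncomputable def EV (i : ℕ) : MvPowerSeries τ V →+* MvPowerSeries τ V :=
  (MvPowerSeries.expand (D.q ^ i)
    (pow_ne_zero _ (by have := D.two_le_q; omega))).toRingHom.comp (MvPowerSeries.map (D.σV ^ i))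

theorem E_map (i : ℕ) (g : MvPowerSeries τ V) :
    D.E i (MvPowerSeries.map D.ι g) = MvPowerSeries.map D.ι (D.EV i g) := by
  have : (D.σ ^ i).comp D.ι = D.ι.comp (D.σV ^ i) := RingHom.ext fun x => D.σ_pow_ι i x
  simp only [E, EV, RingHom.comp_apply, AlgHom.toRingHom_eq_coe, RingHom.coe_coe]
  rw [MvPowerSeries.map_expand, ← RingHom.comp_apply, ← RingHom.comp_apply (MvPowerSeries.map D.ι),
    ← MvPowerSeries.map_comp, ← MvPowerSeries.map_comp, this]

theorem E_X (i : ℕ) (t : τ) : D.E i (MvPowerSeries.X t) = MvPowerSeries.X t ^ D.q ^ i := by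
  simp [E]

theorem E_C (i : ℕ) (x : S) : D.E i (MvPowerSeries.C x : MvPowerSeries τ S) =
    MvPowerSeries.C ((D.σ ^ i) x) := by
  simp only [E, RingHom.comp_apply, AlgHom.toRingHom_eq_coe, RingHom.coe_coe, MvPowerSeries.map_C,
    MvPowerSeries.expand_C]

theorem order_E (i : ℕ) (g : MvPowerSeries τ S) : D.q ^ i • g.order ≤ (D.E i g).order := by
  simp only [E, RingHom.comp_apply, AlgHom.toRingHom_eq_coe, RingHom.coe_coe]
  rw [MvPowerSeries.order_expand]
  gcongr
  exact MvPowerSeries.le_order_map _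

theorem C_dvd_of_map_eq_zero (g : MvPowerSeries τ V) (h : MvPowerSeries.map D.ρ g = 0) :
    MvPowerSeries.C D.ϖ ∣ g := by
  have : ∀ d, ∃ x, MvPowerSeries.coeff d g = D.ϖ * x := fun d => by
    have := congrArg (MvPowerSeries.coeff d) h
    rw [MvPowerSeries.coeff_map, map_zero] at this
    exact (D.hρ _).mp this
  choose x hx using this
  let y : MvPowerSeries τ V := x
  have hy : ∀ d, MvPowerSeries.coeff d y = x d := fun _ => rfl
  exact ⟨y, MvPowerSeries.ext fun d => by rw [hx, MvPowerSeries.coeff_C_mul, hy]⟩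

theorem dvd_EV (i : ℕ) (g : MvPowerSeries τ V) :
    MvPowerSeries.C D.ϖ ∣ D.EV i g - g ^ D.q ^ i := by
  apply D.C_dvd_of_map_eq_zero
  have := D.hchar
  have hp := Fact.mk D.hp
  have e : D.q ^ i = D.p ^ (D.f * i) := by rw [q, ← pow_mul]
  have e2 : (D.ρ.comp (D.σV ^ i)) = (iterateFrobenius k D.p (D.f * i)).comp D.ρ :=
    RingHom.ext fun x => by
      simp only [RingHom.comp_apply]
      rw [D.ρ_σV_pow, iterateFrobenius_def, e]
  simp only [EV, RingHom.comp_apply, AlgHom.toRingHom_eq_coe, RingHom.coe_coe, map_sub, map_pow]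
  rw [MvPowerSeries.map_expand, ← RingHom.comp_apply, ← MvPowerSeries.map_comp, e2,
    MvPowerSeries.map_comp, RingHom.comp_apply, ← MvPowerSeries.map_expand]
  simp only [e]
  rw [MvPowerSeries.map_iterateFrobenius_expand _ D.hp.ne_zero, sub_self]

theorem C_dvd_p : (MvPowerSeries.C D.ϖ : MvPowerSeries τ V) ∣ ((D.p : ℕ) : MvPowerSeries τ V) := by
  have := D.hchar
  apply D.C_dvd_of_map_eq_zero
  rw [map_natCast, ← map_natCast (MvPowerSeries.C (σ := τ) (R := k)), CharP.cast_eq_zero, map_zero]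

/-- The integrality statement at the heart of the functional equation lemma. -/
theorem integral_term (i m : ℕ) (g : MvPowerSeries τ V) :
    ∃ h : MvPowerSeries τ V, MvPowerSeries.C (D.s i * (D.σ ^ i) (D.l m)) *
      (D.E i (MvPowerSeries.map D.ι g) ^ D.q ^ m - MvPowerSeries.map D.ι g ^ D.q ^ (i + m)) =
      MvPowerSeries.map D.ι h := by
  have h1 := dvd_pow_pow_sub_pow_pow (D.C_dvd_p (τ := τ)) le_rfl
    (by rw [pow_one]; exact D.dvd_EV i g) (D.f * m)
  have h2 : (MvPowerSeries.C D.ϖ : MvPowerSeries τ V) ^ (1 + m) ∣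
      D.EV i g ^ D.q ^ m - (g ^ D.q ^ i) ^ D.q ^ m := by
    have e : D.q ^ m = D.p ^ (D.f * m) := by rw [q, ← pow_mul]
    rw [e]
    refine (pow_dvd_pow _ ?_).trans h1
    have := Nat.le_mul_of_pos_left m (Nat.pos_of_ne_zero D.hf)
    omega
  obtain ⟨y, hy⟩ := h2
  obtain ⟨x, hx⟩ := D.ϖ_pow_mul_l m
  refine ⟨MvPowerSeries.C (D.w i * (D.σV ^ i) x) * y, ?_⟩
  rw [D.E_map, ← map_pow (MvPowerSeries.map D.ι), ← map_pow (MvPowerSeries.map D.ι),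
    ← map_sub (MvPowerSeries.map D.ι), pow_add, pow_mul, hy]
  have h := congrArg (D.σ ^ i) hx
  rw [map_mul, map_pow, D.σ_pow_ι, D.σV_pow_ϖ, D.σ_pow_ι] at h
  rw [map_mul (MvPowerSeries.map D.ι), map_mul (MvPowerSeries.map D.ι), map_pow,
    MvPowerSeries.map_C, MvPowerSeries.map_C, ← mul_assoc, ← map_pow, ← map_mul, map_mul D.ι, ← h,
    ← D.hs]
  congr 2
  ring

/-- The ideal of power series of order `> N`. -/
def high (τ S : Type*) [CommRing S] (N : ℕ) : Ideal (MvPowerSeries τ S) where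
  carrier := {g | ((N + 1 : ℕ) : ℕ∞) ≤ g.order}
  add_mem' {a b} ha hb := (le_min ha hb).trans MvPowerSeries.min_order_le_add
  zero_mem' := by simp [MvPowerSeries.order_zero]
  smul_mem' c x hx := by
    rw [smul_eq_mul]
    exact (le_trans hx (le_add_of_nonneg_left (zero_le))).trans MvPowerSeries.le_order_mul

theorem mem_high {N : ℕ} {g : MvPowerSeries τ S} :
    g ∈ high τ S N ↔ ((N + 1 : ℕ) : ℕ∞) ≤ g.order := Iff.rfl

theorem coeff_of_mem_high {N : ℕ} {g : MvPowerSeries τ S} (h : g ∈ high τ S N) {d : τ →₀ ℕ}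
    (hd : d.degree ≤ N) : MvPowerSeries.coeff d g = 0 :=
  MvPowerSeries.coeff_of_lt_order (lt_of_lt_of_le (by exact_mod_cast Nat.lt_succ_of_le hd) h)

theorem mem_high_of_coeff {N : ℕ} {g : MvPowerSeries τ S}
    (h : ∀ d : τ →₀ ℕ, d.degree ≤ N → MvPowerSeries.coeff d g = 0) : g ∈ high τ S N :=
  MvPowerSeries.nat_le_order fun d hd => h d (Nat.le_of_lt_succ hd)

theorem pow_mem_high {N : ℕ} {g : MvPowerSeries τ S} (hg : MvPowerSeries.constantCoeff g = 0)
    {r : ℕ} (hr : N < r) : g ^ r ∈ high τ S N :=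
  (by exact_mod_cast hr : ((N + 1 : ℕ) : ℕ∞) ≤ (r : ℕ∞)).trans
    (MvPowerSeries.le_order_pow_of_constantCoeff_eq_zero r hg)

theorem E_mem_high {N i : ℕ} {g : MvPowerSeries τ S} (hg : g ∈ high τ S N) :
    D.E i g ∈ high τ S N := by
  refine le_trans ?_ (D.order_E i g)
  refine le_trans hg ?_
  rw [nsmul_eq_mul]
  have : (1 : ℕ∞) ≤ ((D.q ^ i : ℕ) : ℕ∞) := by
    exact_mod_cast Nat.one_le_pow _ _ (by have := D.two_le_q; omega)
  calc g.order = 1 * g.order := (one_mul _).symm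
    _ ≤ _ := by gcongr

theorem constantCoeff_E (i : ℕ) {g : MvPowerSeries τ S} (hg : MvPowerSeries.constantCoeff g = 0) :
    MvPowerSeries.constantCoeff (D.E i g) = 0 := by
  simp only [E, RingHom.comp_apply, AlgHom.toRingHom_eq_coe, RingHom.coe_coe]
  rw [MvPowerSeries.constantCoeff_expand, MvPowerSeries.constantCoeff_map, hg, map_zero]

theorem pow_sub_pow_mem_high {N : ℕ} {a b : MvPowerSeries τ S}
    (ha : MvPowerSeries.constantCoeff a = 0) (hb : MvPowerSeries.constantCoeff b = 0)
    (hab : (N : ℕ∞) ≤ (a - b).order) {r : ℕ} (hr : 2 ≤ r) : a ^ r - b ^ r ∈ high τ S N := by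
  rw [mem_high, ← (Commute.all a b).mul_geom_sum₂]
  refine le_trans ?_ MvPowerSeries.le_order_mul
  push_cast
  refine add_le_add hab ?_
  rw [MvPowerSeries.one_le_order_iff_constCoeff_eq_zero, map_sum]
  refine Finset.sum_eq_zero fun i hi => ?_
  rw [map_mul, map_pow, map_pow, ha, hb]
  rcases Nat.eq_zero_or_pos i with rfl | h
  · rw [zero_pow (n := r - 1 - 0) (by omega), mul_zero]
  · rw [zero_pow (by omega), zero_mul]

theorem E_sub_mem_high {N i : ℕ} (hN : 0 < N) (hi : 0 < i) {a b : MvPowerSeries τ S}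
    (hab : (N : ℕ∞) ≤ (a - b).order) : D.E i a - D.E i b ∈ high τ S N := by
  rw [← map_sub, mem_high]
  refine le_trans ?_ (D.order_E i _)
  refine le_trans ?_ (nsmul_le_nsmul_right hab _)
  rw [nsmul_eq_mul]
  have h2 : 2 ≤ D.q ^ i := D.two_le_q.trans (Nat.le_self_pow (by omega) _)
  have : N + 1 ≤ D.q ^ i * N := by nlinarith
  exact_mod_cast this

/-- The logarithm `∑ l m X ^ (q ^ m)`. -/
noncomputable def log : PowerSeries S :=
  PowerSeries.mk fun j => if D.q ^ Nat.log D.q j = j then D.l (Nat.log D.q j) else 0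

theorem coeff_log_pow (m : ℕ) : D.log.coeff (D.q ^ m) = D.l m := by
  rw [log, PowerSeries.coeff_mk, Nat.log_pow (by have := D.two_le_q; omega), if_pos rfl]

theorem coeff_log_eq_zero {j : ℕ} (h : ∀ m, j ≠ D.q ^ m) : D.log.coeff j = 0 := by
  rw [log, PowerSeries.coeff_mk, if_neg fun e => h _ e.symm]

theorem lt_q_pow (m : ℕ) : m < D.q ^ m := Nat.lt_pow_self (by have := D.two_le_q; omega)

theorem log_subst_mem (N : ℕ) {g : MvPowerSeries τ S} (hg : MvPowerSeries.constantCoeff g = 0) :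
    D.log.subst g - ∑ m ∈ Finset.range (N + 1), MvPowerSeries.C (D.l m) * g ^ D.q ^ m ∈
      high τ S N := by
  refine mem_high_of_coeff fun d hd => ?_
  rw [map_sub, PowerSeries.coeff_subst (PowerSeries.HasSubst.of_constantCoeff_zero hg), map_sum,
    sub_eq_zero]
  have hinj : Set.InjOn (fun m => D.q ^ m) (Finset.range (N + 1) : Set ℕ) :=
    fun a _ b _ h => Nat.pow_right_injective D.two_le_q h
  rw [finsum_eq_sum_of_support_subset (s := (Finset.range (N + 1)).image fun m => D.q ^ m),
    Finset.sum_image hinj]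
  · refine Finset.sum_congr rfl fun m _ => ?_
    rw [D.coeff_log_pow, MvPowerSeries.coeff_C_mul, smul_eq_mul]
  · intro j hj
    rw [Function.mem_support] at hj
    by_contra hj'
    apply hj
    by_cases h : ∃ m, j = D.q ^ m
    · obtain ⟨m, rfl⟩ := h
      have hm : N < m := by
        by_contra hm
        exact hj' (Finset.mem_coe.mpr (Finset.mem_image.mpr
          ⟨m, Finset.mem_range.mpr (by omega), rfl⟩))
      rw [coeff_of_mem_high (pow_mem_high hg (hm.trans (D.lt_q_pow m))) hd, smul_zero]
    · rw [D.coeff_log_eq_zero (fun m hm => h ⟨m, hm⟩), zero_smul]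

/-- The double-sum form of the recursion for `l`. -/
theorem sum_l (N : ℕ) (y : ℕ → MvPowerSeries τ S) (hy : ∀ m, N < m → y m ∈ high τ S N) :
    ∑ m ∈ Finset.range (N + 1), MvPowerSeries.C (D.l m) * y m - (y 0 +
      ∑ i ∈ Finset.range N, ∑ j ∈ Finset.range (N + 1),
        MvPowerSeries.C (D.s (i + 1) * (D.σ ^ (i + 1)) (D.l j)) * y (i + 1 + j)) ∈ high τ S N := by
  set t : ℕ → ℕ → MvPowerSeries τ S := fun i j =>
    MvPowerSeries.C (D.s (i + 1) * (D.σ ^ (i + 1)) (D.l j)) * y (i + 1 + j) with ht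
  have h1 : ∑ m ∈ Finset.range (N + 1), MvPowerSeries.C (D.l m) * y m =
      y 0 + ∑ i ∈ Finset.range N, ∑ j ∈ Finset.range (N - i), t i j := by
    rw [Finset.sum_range_succ', D.l_zero, map_one, one_mul, add_comm]
    congr 1
    rw [Finset.range_eq_Ico, Finset.sum_sigma', Finset.sum_congr rfl (fun m _ => by
      rw [D.l_succ, map_sum, Finset.sum_mul]), Finset.sum_sigma']
    refine Finset.sum_bij' (fun x _ => ⟨x.2, x.1 - x.2⟩) (fun x _ => ⟨x.1 + x.2, x.1⟩) ?_ ?_ ?_ ?_ ?_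
    · rintro ⟨m, i⟩ h
      simp only [Finset.mem_sigma, Finset.mem_Ico, Finset.mem_range] at h ⊢
      omega
    · rintro ⟨i, j⟩ h
      simp only [Finset.mem_sigma, Finset.mem_Ico, Finset.mem_range] at h ⊢
      omega
    · rintro ⟨m, i⟩ h
      simp only [Finset.mem_sigma, Finset.mem_Ico, Finset.mem_range] at h
      have : i + (m - i) = m := by omega
      simp [this]
    · rintro ⟨i, j⟩ h
      simp
    · rintro ⟨m, i⟩ h
      simp only [Finset.mem_sigma, Finset.mem_Ico, Finset.mem_range] at h
      have : i + 1 + (m - i) = m + 1 := by omega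
      simp [ht, this]
  rw [h1, add_sub_add_left_eq_sub, ← Finset.sum_sub_distrib]
  refine Ideal.sum_mem _ fun i hi => ?_
  have hi := Finset.mem_range.mp hi
  rw [← neg_mem_iff, neg_sub, ← Finset.sum_range_add_sum_Ico _ (show N - i ≤ N + 1 by omega),
    add_sub_cancel_left]
  refine Ideal.sum_mem _ fun j hj => ?_
  have hj := Finset.mem_Ico.mp hj
  exact Ideal.mul_mem_left _ _ (hy _ (by omega))

/-- The key congruence. -/
theorem key_congr [Fintype τ] (c : τ → V) (hc : ∀ t, D.σV (c t) = c t) {G : MvPowerSeries τ S}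
    (hG : MvPowerSeries.constantCoeff G = 0)
    (h : D.log.subst G = ∑ t, MvPowerSeries.C (D.ι (c t)) *
      D.log.subst (MvPowerSeries.X t : MvPowerSeries τ S)) (N : ℕ) :
    G - (∑ t, MvPowerSeries.C (D.ι (c t)) * MvPowerSeries.X t +
      ∑ i ∈ Finset.range N, ∑ j ∈ Finset.range (N + 1),
        MvPowerSeries.C (D.s (i + 1) * (D.σ ^ (i + 1)) (D.l j)) *
          (D.E (i + 1) G ^ D.q ^ j - G ^ D.q ^ (i + 1 + j))) ∈ high τ S N := by
  set I := high τ S N with hI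
  have hlt : ∀ {g : MvPowerSeries τ S}, MvPowerSeries.constantCoeff g = 0 →
      ∀ m, N < m → g ^ D.q ^ m ∈ I := fun hg m hm => pow_mem_high hg (hm.trans (D.lt_q_pow m))
  have aG := D.log_subst_mem N hG
  have bG := D.sum_l N (fun m => G ^ D.q ^ m) (hlt hG)
  have aX := fun t : τ => D.log_subst_mem N (MvPowerSeries.constantCoeff_X (R := S) t)
  have bX := fun t : τ => D.sum_l N (fun m => (MvPowerSeries.X t : MvPowerSeries τ S) ^ D.q ^ m)
    (hlt (MvPowerSeries.constantCoeff_X (R := S) t))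
  simp only [pow_zero, pow_one] at bG bX
  have hσc : ∀ i t, (D.σ ^ i) (D.ι (c t)) = D.ι (c t) := fun i t => by
    rw [D.σ_pow_ι]
    congr 1
    induction i with
    | zero => rfl
    | succ i ih => rw [pow_succ', RingHom.mul_def, RingHom.comp_apply, ih, hc]
  -- the logarithmic identity, modulo `I`
  have e1 : ∑ m ∈ Finset.range (N + 1), MvPowerSeries.C (D.l m) * G ^ D.q ^ m -
      ∑ t, MvPowerSeries.C (D.ι (c t)) *
        ∑ m ∈ Finset.range (N + 1), MvPowerSeries.C (D.l m) * MvPowerSeries.X t ^ D.q ^ m ∈ I := by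
    have := Ideal.sub_mem I
      (Ideal.sum_mem I (t := Finset.univ) fun t _ =>
        Ideal.mul_mem_left I (MvPowerSeries.C (D.ι (c t))) (aX t)) aG
    simp only [mul_sub, Finset.sum_sub_distrib] at this
    rw [← h] at this
    convert this using 1
    ring
  -- its image under `E (i + 1)`
  have e2 : ∀ i, ∑ j ∈ Finset.range (N + 1),
      MvPowerSeries.C (D.s (i + 1) * (D.σ ^ (i + 1)) (D.l j)) * D.E (i + 1) G ^ D.q ^ j -
      ∑ t, MvPowerSeries.C (D.ι (c t)) * ∑ j ∈ Finset.range (N + 1),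
        MvPowerSeries.C (D.s (i + 1) * (D.σ ^ (i + 1)) (D.l j)) *
          MvPowerSeries.X t ^ D.q ^ (i + 1 + j) ∈ I := fun i => by
    have := Ideal.mul_mem_left I (MvPowerSeries.C (D.s (i + 1))) (D.E_mem_high (i := i + 1) e1)
    simp only [map_sub, map_sum, map_mul, map_pow, E_C, E_X, hσc, mul_sub, Finset.mul_sum,
      ← pow_mul] at this
    convert this using 2
    · refine Finset.sum_congr rfl fun j _ => ?_
      rw [map_mul]
      ring
    · refine Finset.sum_congr rfl fun t _ => ?_
      rw [Finset.mul_sum]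
      refine Finset.sum_congr rfl fun j _ => ?_
      rw [map_mul, pow_add]
      ring
  have e3 := Ideal.sum_mem I (t := Finset.range N) fun i _ => e2 i
  have e4 := Ideal.sum_mem I (t := Finset.univ) fun t _ =>
        Ideal.mul_mem_left I (MvPowerSeries.C (D.ι (c t))) (bX t)
  have e5 := I.sub_mem (I.sub_mem (I.add_mem e1 e4) bG) e3
  convert e5 using 1
  simp only [mul_sub, mul_add, Finset.sum_sub_distrib, Finset.sum_add_distrib, Finset.mul_sum]
  rw [Finset.sum_comm (s := Finset.range N) (t := (Finset.univ : Finset τ))]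
  ring

/-- The functional equation lemma: if `log G = ∑ c_t log X_t` then `G` is integral. -/
theorem integral [Fintype τ] (c : τ → V) (hc : ∀ t, D.σV (c t) = c t) {G : MvPowerSeries τ S}
    (hG : MvPowerSeries.constantCoeff G = 0)
    (h : D.log.subst G = ∑ t, MvPowerSeries.C (D.ι (c t)) *
      D.log.subst (MvPowerSeries.X t : MvPowerSeries τ S)) :
    ∃ F : MvPowerSeries τ V, MvPowerSeries.map D.ι F = G := by
  suffices H : ∀ N, ∀ d : τ →₀ ℕ, d.degree = N → ∃ x, D.ι x = MvPowerSeries.coeff d G by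
    choose x hx using fun d : τ →₀ ℕ => H _ d rfl
    let y : MvPowerSeries τ V := x
    have hy : ∀ d, MvPowerSeries.coeff d y = x d := fun _ => rfl
    exact ⟨y, MvPowerSeries.ext fun d => by rw [MvPowerSeries.coeff_map, ← hx d, hy]⟩
  intro N
  induction N using Nat.strong_induction_on with
  | _ N ih =>
    intro d hd
    rcases Nat.eq_zero_or_pos N with rfl | hN
    · refine ⟨0, ?_⟩
      rw [Finsupp.degree_eq_zero_iff] at hd
      rw [hd, MvPowerSeries.coeff_zero_eq_constantCoeff_apply, hG, map_zero]
    · classical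
      -- an integral power series which agrees with `G` in degrees `< N`
      have hx : ∀ d : τ →₀ ℕ, ∃ x, (d.degree < N → D.ι x = MvPowerSeries.coeff d G) ∧
          (N ≤ d.degree → x = 0) := fun d => by
        by_cases hd : d.degree < N
        · obtain ⟨x, hx⟩ := ih _ hd d rfl
          exact ⟨x, fun _ => hx, fun h => absurd hd (by omega)⟩
        · exact ⟨0, fun h => absurd h hd, fun _ => rfl⟩
      choose x hx _ using hx
      set G' : MvPowerSeries τ V := x with hG'
      set g := MvPowerSeries.map D.ι G' with hg
      have hgG : (N : ℕ∞) ≤ (g - G).order := MvPowerSeries.nat_le_order fun d hd => by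
        rw [map_sub, hg, MvPowerSeries.coeff_map, ← hx d hd, sub_eq_zero]
        rfl
      have hg0 : MvPowerSeries.constantCoeff g = 0 := by
        have := MvPowerSeries.coeff_of_lt_order (f := g - G) (d := 0)
          (lt_of_lt_of_le (by simpa using hN) hgG)
        rw [MvPowerSeries.coeff_zero_eq_constantCoeff_apply, map_sub, hG, sub_zero] at this
        exact this
      have key := D.key_congr c hc hG h N
      set I := high τ S N with hI
      have hterm : ∀ i j, (D.E (i + 1) g ^ D.q ^ j - g ^ D.q ^ (i + 1 + j)) -
          (D.E (i + 1) G ^ D.q ^ j - G ^ D.q ^ (i + 1 + j)) ∈ I := fun i j => by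
        have h1 : D.E (i + 1) g ^ D.q ^ j - D.E (i + 1) G ^ D.q ^ j ∈ I := by
          rw [← Ideal.Quotient.mk_eq_mk_iff_sub_mem, map_pow, map_pow]
          congr 1
          exact (Ideal.Quotient.mk_eq_mk_iff_sub_mem _ _).mpr
            (D.E_sub_mem_high hN (by omega) hgG)
        have h2 : g ^ D.q ^ (i + 1 + j) - G ^ D.q ^ (i + 1 + j) ∈ I :=
          pow_sub_pow_mem_high hg0 hG hgG (D.two_le_q.trans (Nat.le_self_pow (by omega) _))
        have := I.sub_mem h1 h2
        convert this using 1
        ring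
      choose y hy using fun i j => D.integral_term (i + 1) j G'
      have key2 : G - MvPowerSeries.map D.ι (∑ t, MvPowerSeries.C (c t) * MvPowerSeries.X t +
          ∑ i ∈ Finset.range N, ∑ j ∈ Finset.range (N + 1), y i j) ∈ I := by
        have h3 : ∑ i ∈ Finset.range N, ∑ j ∈ Finset.range (N + 1),
            MvPowerSeries.C (D.s (i + 1) * (D.σ ^ (i + 1)) (D.l j)) *
            ((D.E (i + 1) g ^ D.q ^ j - g ^ D.q ^ (i + 1 + j)) -
              (D.E (i + 1) G ^ D.q ^ j - G ^ D.q ^ (i + 1 + j))) ∈ I :=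
          Ideal.sum_mem _ fun i _ => Ideal.sum_mem _ fun j _ =>
            Ideal.mul_mem_left _ _ (hterm i j)
        have := I.sub_mem key h3
        convert this using 1
        simp only [map_add, map_sum, map_mul, MvPowerSeries.map_C, MvPowerSeries.map_X, ← hy,
          mul_sub, Finset.sum_sub_distrib, ← hg]
        ring
      have := coeff_of_mem_high key2 hd.le
      rw [map_sub, sub_eq_zero, MvPowerSeries.coeff_map] at this
      exact ⟨_, this.symm⟩

end Datum

end FunctionalEquation

namespace FunctionalEquation.Datum

variable {V S k : Type*} [CommRing V] [CommRing S] [CommRing k] (D : Datum V S k) {τ : Type*}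

theorem coeff_log_subst {G : MvPowerSeries τ S} (hG : MvPowerSeries.constantCoeff G = 0)
    {d : τ →₀ ℕ} (hd : d.degree ≤ 1) :
    MvPowerSeries.coeff d (D.log.subst G) = MvPowerSeries.coeff d G := by
  have h := coeff_of_mem_high (D.log_subst_mem 1 hG) hd
  rw [map_sub, sub_eq_zero] at h
  rw [h, Finset.sum_range_succ, Finset.sum_range_one, map_add, D.l_zero, map_one, one_mul,
    pow_zero, pow_one, MvPowerSeries.coeff_C_mul, pow_one,
    coeff_of_mem_high (N := 1) (pow_mem_high hG (by have := D.two_le_q; omega)) hd, mul_zero,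
    add_zero]

theorem constantCoeff_log : D.log.constantCoeff = 0 := by
  rw [← PowerSeries.coeff_zero_eq_constantCoeff_apply]
  exact D.coeff_log_eq_zero fun m h =>
    (pow_ne_zero m (by have := D.two_le_q; omega : D.q ≠ 0)) h.symm

theorem coeff_one_log : D.log.coeff 1 = 1 := by
  have := D.coeff_log_pow 0
  rwa [pow_zero, D.l_zero] at this

theorem isUnit_coeff_one_log : IsUnit (D.log.coeff 1) := by
  rw [D.coeff_one_log]
  exact isUnit_one

/-- The compositional inverse of the logarithm. -/
noncomputable def exp : PowerSeries S := D.log.substInvOfIsUnit D.isUnit_coeff_one_log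

theorem constantCoeff_exp : D.exp.constantCoeff = 0 :=
  PowerSeries.constantCoeff_substInvOfIsUnit _ _

theorem log_exp {g : MvPowerSeries τ S} (hg : MvPowerSeries.constantCoeff g = 0) :
    D.log.subst (D.exp.subst g) = g := by
  rw [← FormalModule.comp_comp D.constantCoeff_exp hg, exp,
    PowerSeries.subst_substInvOfIsUnit_right _ D.constantCoeff_log,
    PowerSeries.subst_X (FormalModule.hasSubst_zero hg)]

theorem exp_log {g : MvPowerSeries τ S} (hg : MvPowerSeries.constantCoeff g = 0) :
    D.exp.subst (D.log.subst g) = g := by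
  rw [← FormalModule.comp_comp D.constantCoeff_log hg, exp,
    PowerSeries.subst_substInvOfIsUnit_left _ D.constantCoeff_log,
    PowerSeries.subst_X (FormalModule.hasSubst_zero hg)]

theorem eq_of_log_eq (hι : Function.Injective D.ι) {a b : MvPowerSeries τ V}
    (ha : MvPowerSeries.constantCoeff a = 0) (hb : MvPowerSeries.constantCoeff b = 0)
    (h : D.log.subst (MvPowerSeries.map D.ι a) = D.log.subst (MvPowerSeries.map D.ι b)) :
    a = b := by
  have ha' : MvPowerSeries.constantCoeff (MvPowerSeries.map D.ι a) = 0 := by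
    rw [MvPowerSeries.constantCoeff_map, ha, map_zero]
  have hb' : MvPowerSeries.constantCoeff (MvPowerSeries.map D.ι b) = 0 := by
    rw [MvPowerSeries.constantCoeff_map, hb, map_zero]
  have := congrArg (fun g => D.exp.subst g) h
  simp only [D.exp_log ha', D.exp_log hb'] at this
  exact MvPowerSeries.ext fun d => hι (by
    rw [← MvPowerSeries.coeff_map, ← MvPowerSeries.coeff_map, this])

theorem log_map_comp {f : PowerSeries V} (hf : f.constantCoeff = 0) {a : MvPowerSeries τ V}
    (ha : MvPowerSeries.constantCoeff a = 0) (x : V)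
    (h : D.log.subst (PowerSeries.map D.ι f) = PowerSeries.C (D.ι x) * D.log) :
    D.log.subst (MvPowerSeries.map D.ι (f.subst a)) =
      MvPowerSeries.C (D.ι x) * D.log.subst (MvPowerSeries.map D.ι a) := by
  have ha' : MvPowerSeries.constantCoeff (MvPowerSeries.map D.ι a) = 0 := by
    rw [MvPowerSeries.constantCoeff_map, ha, map_zero]
  have hf' : (PowerSeries.map D.ι f).constantCoeff = 0 := by
    rw [← PowerSeries.coeff_zero_eq_constantCoeff_apply, PowerSeries.coeff_map,
      PowerSeries.coeff_zero_eq_constantCoeff_apply, hf, map_zero]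
  rw [PowerSeries.map_subst (FormalModule.hasSubst_zero ha),
    ← FormalModule.comp_comp hf' ha', h, PowerSeries.subst_mul (FormalModule.hasSubst_zero ha'),
    PowerSeries.subst_C]

theorem log_map_pair {F : MvPowerSeries (Fin 2) V} (hF : MvPowerSeries.constantCoeff F = 0)
    {a b : MvPowerSeries τ V}
    (ha : MvPowerSeries.constantCoeff a = 0) (hb : MvPowerSeries.constantCoeff b = 0)
    (h : D.log.subst (MvPowerSeries.map D.ι F) =
      D.log.subst (MvPowerSeries.X 0 : MvPowerSeries (Fin 2) S) +
        D.log.subst (MvPowerSeries.X 1 : MvPowerSeries (Fin 2) S)) :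
    D.log.subst (MvPowerSeries.map D.ι (F.subst ![a, b])) =
      D.log.subst (MvPowerSeries.map D.ι a) + D.log.subst (MvPowerSeries.map D.ι b) := by
  have ha' : MvPowerSeries.constantCoeff (MvPowerSeries.map D.ι a) = 0 := by
    rw [MvPowerSeries.constantCoeff_map, ha, map_zero]
  have hb' : MvPowerSeries.constantCoeff (MvPowerSeries.map D.ι b) = 0 := by
    rw [MvPowerSeries.constantCoeff_map, hb, map_zero]
  have hF' : MvPowerSeries.constantCoeff (MvPowerSeries.map D.ι F) = 0 := by
    rw [MvPowerSeries.constantCoeff_map, hF, map_zero]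
  have hc := FormalModule.hasSubst_pair ha' hb'
  have e : (fun i => MvPowerSeries.map D.ι (![a, b] i)) =
      ![MvPowerSeries.map D.ι a, MvPowerSeries.map D.ι b] := by
    funext i
    fin_cases i <;> rfl
  rw [MvPowerSeries.map_subst (FormalModule.hasSubst_pair ha hb), e,
    ← FormalModule.comp_subst hF' hc, h, MvPowerSeries.subst_add hc,
    FormalModule.comp_X_subst 0 hc, FormalModule.comp_X_subst 1 hc]
  rfl

/-- The formal `A`-module over `V` with logarithm `log`. -/
theorem existsUnique_formalModule {A : Type*} [CommRing A] [Algebra A V]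
    (hι : Function.Injective D.ι) (hA : ∀ a, D.σV (algebraMap A V a) = algebraMap A V a) :
    ∃! G : FormalModule A V,
      D.log.subst (MvPowerSeries.map D.ι G.toPowerSeries) =
        D.log.subst (MvPowerSeries.X 0 : MvPowerSeries (Fin 2) S) +
          D.log.subst (MvPowerSeries.X 1 : MvPowerSeries (Fin 2) S) ∧
      ∀ a, D.log.subst (PowerSeries.map D.ι (G.act a)) =
        PowerSeries.C (D.ι (algebraMap A V a)) * D.log := by
  have cX : ∀ {σ : Type} (i : σ), MvPowerSeries.constantCoeff (MvPowerSeries.X i :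
      MvPowerSeries σ V) = 0 := fun i => MvPowerSeries.constantCoeff_X i
  have cX' : ∀ {σ : Type} (i : σ), MvPowerSeries.constantCoeff (MvPowerSeries.X i :
      MvPowerSeries σ S) = 0 := fun i => MvPowerSeries.constantCoeff_X i
  have hcL : ∀ {σ : Type} (i : σ), MvPowerSeries.constantCoeff
      (D.log.subst (MvPowerSeries.X i : MvPowerSeries σ S)) = 0 := fun i =>
    FormalModule.constantCoeff_comp (cX' i) D.constantCoeff_log
  have hinj0 : ∀ {σ : Type} {F : MvPowerSeries σ V} {g : MvPowerSeries σ S},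
      MvPowerSeries.constantCoeff g = 0 → MvPowerSeries.map D.ι F = g →
      MvPowerSeries.constantCoeff F = 0 := fun {σ F g} hg h => by
    apply hι
    rw [map_zero, ← hg, ← h, MvPowerSeries.constantCoeff_map]
  -- the group law
  obtain ⟨F, hF, hF0⟩ : ∃ F : MvPowerSeries (Fin 2) V,
      D.log.subst (MvPowerSeries.map D.ι F) =
        D.log.subst (MvPowerSeries.X 0 : MvPowerSeries (Fin 2) S) +
          D.log.subst (MvPowerSeries.X 1 : MvPowerSeries (Fin 2) S) ∧
      MvPowerSeries.constantCoeff F = 0 := by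
    have h0 : MvPowerSeries.constantCoeff
        (D.log.subst (MvPowerSeries.X 0 : MvPowerSeries (Fin 2) S) +
          D.log.subst (MvPowerSeries.X 1 : MvPowerSeries (Fin 2) S)) = 0 := by
      rw [map_add, hcL, hcL, add_zero]
    have h1 := FormalModule.constantCoeff_comp h0 D.constantCoeff_exp
    obtain ⟨F, hF⟩ := D.integral (τ := Fin 2) (fun _ => 1) (fun _ => map_one _) h1 (by
      rw [D.log_exp h0, Fin.sum_univ_two]
      simp only [map_one, one_mul])
    exact ⟨F, by rw [hF, D.log_exp h0], hinj0 h1 hF⟩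
  -- the action
  have hact : ∀ a : A, ∃ f : PowerSeries V,
      D.log.subst (PowerSeries.map D.ι f) = PowerSeries.C (D.ι (algebraMap A V a)) * D.log ∧
      f.constantCoeff = 0 := fun a => by
    have h0 : MvPowerSeries.constantCoeff
        (PowerSeries.C (D.ι (algebraMap A V a)) * D.log) = 0 := by
      rw [map_mul]
      exact mul_eq_zero_of_right _ D.constantCoeff_log
    have h1 := FormalModule.constantCoeff_comp h0 D.constantCoeff_exp
    obtain ⟨f, hf⟩ := D.integral (τ := Unit) (fun _ => algebraMap A V a) (fun _ => hA a) h1 (by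
      rw [D.log_exp h0, Fintype.sum_unique]
      have : D.log.subst (MvPowerSeries.X (default : Unit) : MvPowerSeries Unit S) = D.log :=
        PowerSeries.X_subst _
      rw [this]
      rfl)
    exact ⟨f, (congrArg (fun g => D.log.subst g) hf).trans (D.log_exp h0), hinj0 h1 hf⟩
  choose f hf hf0 using hact
  have Lpair := fun {σ : Type} {a b : MvPowerSeries σ V}
    (ha : MvPowerSeries.constantCoeff a = 0) (hb : MvPowerSeries.constantCoeff b = 0) =>
    D.log_map_pair hF0 ha hb hF
  have Lact := fun {σ : Type} {a : MvPowerSeries σ V}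
    (ha : MvPowerSeries.constantCoeff a = 0) (x : A) => D.log_map_comp (hf0 x) ha _ (hf x)
  have c2 := fun {σ : Type} {a b : MvPowerSeries σ V}
    (ha : MvPowerSeries.constantCoeff a = 0) (hb : MvPowerSeries.constantCoeff b = 0) =>
    FormalModule.constantCoeff_subst_pair ha hb hF0
  have c1 := fun {σ : Type} {a : MvPowerSeries σ V}
    (ha : MvPowerSeries.constantCoeff a = 0) (x : A) =>
    FormalModule.constantCoeff_comp ha (hf0 x)
  have hmapF0 : MvPowerSeries.constantCoeff (MvPowerSeries.map D.ι F) = 0 := by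
    rw [MvPowerSeries.constantCoeff_map, hF0, map_zero]
  have hlin : ∀ i : Fin 2, F.coeff (Finsupp.single i 1) = 1 := fun i => by
    have hd : (Finsupp.single i 1).degree ≤ 1 := by simp
    apply hι
    rw [map_one, ← MvPowerSeries.coeff_map, ← D.coeff_log_subst hmapF0 hd, hF, map_add,
      D.coeff_log_subst (cX' 0) hd, D.coeff_log_subst (cX' 1) hd]
    fin_cases i <;> simp [MvPowerSeries.coeff_X, Finsupp.single_left_inj]
  have hgf : ∀ a, D.log.subst (MvPowerSeries.map D.ι (f a)) =
      PowerSeries.C (D.ι (algebraMap A V a)) * D.log := hf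
  let G : FormalModule A V :=
    { toPowerSeries := F
      zero_constantCoeff := hF0
      lin_coeff_X := hlin 0
      lin_coeff_Y := hlin 1
      assoc := by
        refine D.eq_of_log_eq hι (c2 (c2 (cX _) (cX _)) (cX _)) (c2 (cX _) (c2 (cX _) (cX _))) ?_
        rw [Lpair (c2 (cX _) (cX _)) (cX _), Lpair (cX _) (cX _),
          Lpair (cX _) (c2 (cX _) (cX _)), Lpair (cX _) (cX _), add_assoc]
      comm := by
        refine D.eq_of_log_eq hι hF0 (c2 (cX _) (cX _)) ?_
        rw [Lpair (cX _) (cX _), hF, MvPowerSeries.map_X, MvPowerSeries.map_X, add_comm]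
      act := f
      act_constantCoeff := hf0
      act_coeff_one := fun a => by
        apply hι
        have h := D.coeff_log_subst (d := Finsupp.single () 1)
          (G := MvPowerSeries.map D.ι (f a))
          (by rw [MvPowerSeries.constantCoeff_map]; exact (congrArg _ (hf0 a)).trans (map_zero _))
          (by simp)
        rw [hgf, MvPowerSeries.coeff_map] at h
        refine h.symm.trans ?_
        change PowerSeries.coeff 1 (PowerSeries.C (D.ι (algebraMap A V a)) * D.log) = _
        rw [PowerSeries.coeff_C_mul, D.coeff_one_log, mul_one]
      act_one := by
        refine D.eq_of_log_eq hι (hf0 1) (cX ()) ?_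
        rw [hgf, map_one, map_one, map_one, one_mul]
        have hX : MvPowerSeries.map D.ι (PowerSeries.X : PowerSeries V) =
            (PowerSeries.X : PowerSeries S) := MvPowerSeries.map_X _ _
        rw [hX]
        exact (PowerSeries.X_subst _).symm
      act_mul := fun a b => by
        refine D.eq_of_log_eq hι (hf0 _) (c1 (hf0 b) a) ?_
        rw [Lact (hf0 b), hgf, hgf, map_mul, map_mul, map_mul, mul_assoc]
        rfl
      act_add := fun a b => by
        refine D.eq_of_log_eq hι (hf0 _) (c2 (hf0 a) (hf0 b)) ?_
        rw [Lpair (hf0 a) (hf0 b), hgf, hgf, hgf, map_add, map_add, map_add, add_mul]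
      act_hom := fun a => by
        refine D.eq_of_log_eq hι (c1 hF0 a) (c2 (c1 (cX _) a) (c1 (cX _) a)) ?_
        rw [Lpair (c1 (cX _) a) (c1 (cX _) a), Lact hF0, Lact (cX _), Lact (cX _), hF, mul_add,
          MvPowerSeries.map_X, MvPowerSeries.map_X] }
  refine ⟨G, ⟨hF, hf⟩, fun G' hG' => FormalModule.ext' ?_ ?_⟩
  · exact D.eq_of_log_eq hι G'.zero_constantCoeff hF0 (hG'.1.trans hF.symm)
  · funext a
    exact D.eq_of_log_eq hι (G'.act_constantCoeff a) (hf0 a) ((hG'.2 a).trans (hf a).symm)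

end FunctionalEquation.Datum

section Universal

variable {A : Type*} [CommRing A] [IsDomain A] [IsDiscreteValuationRing A]

/-- The coefficients `ℓ_m`, in `K[v₁, v₂, …]` with `K` the field of fractions of `A`, of Hazewinkel's
universal `A`-typical logarithm `∑ ℓ_m X ^ (q ^ m)`:
`ℓ₀ = 1` and `π ℓ_m = ∑_{0 ≤ j < m} ℓ_j v_{m-j} ^ (q ^ j)` for `m ≥ 1`, where `q` is the cardinality
of the residue field. The variable `X i` stands for `v_{i+1}`. -/
noncomputable def hazewinkelCoeff (π : A) : ℕ → MvPolynomial ℕ (FractionRing A)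
  | 0 => 1
  | m + 1 => MvPolynomial.C (algebraMap A (FractionRing A) π)⁻¹ * ∑ j : Fin (m + 1),
      hazewinkelCoeff π j.1 *
        MvPolynomial.X (m - j.1) ^ Nat.card (IsLocalRing.ResidueField A) ^ j.1

/-- Hazewinkel's universal `A`-typical logarithm `∑ ℓ_m X ^ (q ^ m)`. -/
noncomputable def hazewinkelLog (π : A) : PowerSeries (MvPolynomial ℕ (FractionRing A)) :=
  PowerSeries.mk fun j =>
    if Nat.card (IsLocalRing.ResidueField A) ^ Nat.log (Nat.card (IsLocalRing.ResidueField A)) j = j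
    then hazewinkelCoeff π (Nat.log (Nat.card (IsLocalRing.ResidueField A)) j) else 0

theorem hazewinkelCoeff_succ (π : A) (m : ℕ) : hazewinkelCoeff π (m + 1) =
    MvPolynomial.C (algebraMap A (FractionRing A) π)⁻¹ * ∑ j ∈ Finset.range (m + 1),
      hazewinkelCoeff π j *
        MvPolynomial.X (m - j) ^ Nat.card (IsLocalRing.ResidueField A) ^ j := by
  rw [hazewinkelCoeff, Finset.sum_range (n := m + 1)]

theorem residue_eq_zero_iff {π : A} (hπ : Irreducible π) (x : A) :
    IsLocalRing.residue A x = 0 ↔ π ∣ x := by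
  rw [IsLocalRing.residue_eq_zero_iff, hπ.maximalIdeal_eq, Ideal.mem_span_singleton]

/-- The functional equation satisfied by the coefficients of the logarithm. -/
theorem hazewinkelCoeff_functional (π : A)
    (σ : MvPolynomial ℕ (FractionRing A) →+* MvPolynomial ℕ (FractionRing A))
    (hC : ∀ x, σ (MvPolynomial.C x) = MvPolynomial.C x)
    (hX : ∀ i, σ (MvPolynomial.X i) =
      MvPolynomial.X i ^ Nat.card (IsLocalRing.ResidueField A)) (m : ℕ) :
    hazewinkelCoeff π (m + 1) = ∑ i ∈ Finset.range (m + 1),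
      (MvPolynomial.C (algebraMap A (FractionRing A) π)⁻¹ * MvPolynomial.X i) *
        (σ ^ (i + 1)) (hazewinkelCoeff π (m - i)) := by
  set q := Nat.card (IsLocalRing.ResidueField A) with hq
  set P : MvPolynomial ℕ (FractionRing A) :=
    MvPolynomial.C (algebraMap A (FractionRing A) π)⁻¹ with hP
  have hσC : ∀ i, (σ ^ i) P = P := fun i => by
    induction i with
    | zero => rfl
    | succ i ih => rw [pow_succ', RingHom.mul_def, RingHom.comp_apply, ih, hP, hC]
  have hσX : ∀ i j, (σ ^ i) (MvPolynomial.X j) = MvPolynomial.X j ^ q ^ i := fun i j => by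
    induction i with
    | zero => simp
    | succ i ih => rw [pow_succ', RingHom.mul_def, RingHom.comp_apply, ih, map_pow, hX, ← pow_mul,
        ← pow_succ']
  induction m using Nat.strong_induction_on with
  | _ m ih =>
    rw [hazewinkelCoeff_succ, Finset.sum_range_succ', Finset.sum_range_succ _ m]
    have e0 : hazewinkelCoeff π 0 = 1 := by rw [hazewinkelCoeff]
    simp only [Nat.sub_self, e0, map_one, mul_one, Nat.sub_zero, pow_zero, pow_one, one_mul,
      mul_add]
    congr 1
    have h1 : ∀ j ∈ Finset.range m, hazewinkelCoeff π (j + 1) *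
        MvPolynomial.X (m - (j + 1)) ^ q ^ (j + 1) = ∑ i ∈ Finset.range (j + 1),
        P * MvPolynomial.X i * (σ ^ (i + 1)) (hazewinkelCoeff π (j - i)) *
          MvPolynomial.X (m - (j + 1)) ^ q ^ (j + 1) := fun j hj => by
      rw [ih j (Finset.mem_range.mp hj), Finset.sum_mul]
    have h2 : ∀ i ∈ Finset.range m, P * MvPolynomial.X i *
        (σ ^ (i + 1)) (hazewinkelCoeff π (m - i)) = ∑ k ∈ Finset.range (m - i),
        P * (P * MvPolynomial.X i * (σ ^ (i + 1)) (hazewinkelCoeff π k) *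
          MvPolynomial.X (m - i - 1 - k) ^ q ^ (i + 1 + k)) := fun i hi => by
      have hi := Finset.mem_range.mp hi
      obtain ⟨r, hr⟩ : ∃ r, m - i = r + 1 := ⟨m - i - 1, by omega⟩
      rw [hr, hazewinkelCoeff_succ, map_mul, ← hP, hσC, map_sum, Finset.mul_sum, Finset.mul_sum]
      refine Finset.sum_congr rfl fun k _ => ?_
      rw [map_mul, map_pow, hσX, ← pow_mul, ← pow_add]
      have : r + 1 - 1 - k = r - k := by omega
      rw [this]
      ring
    rw [Finset.sum_congr rfl h1, Finset.sum_congr rfl h2, Finset.mul_sum]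
    simp only [Finset.mul_sum]
    rw [Finset.sum_sigma', Finset.sum_sigma']
    refine Finset.sum_bij' (fun x _ => ⟨x.2, x.1 - x.2⟩) (fun x _ => ⟨x.1 + x.2, x.1⟩) ?_ ?_ ?_ ?_ ?_
    · rintro ⟨m, i⟩ h
      simp only [Finset.mem_sigma, Finset.mem_range] at h ⊢
      omega
    · rintro ⟨i, j⟩ h
      simp only [Finset.mem_sigma, Finset.mem_range] at h ⊢
      omega
    · rintro ⟨m, i⟩ h
      simp only [Finset.mem_sigma, Finset.mem_range] at h
      have : i + (m - i) = m := by omega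
      simp [this]
    · rintro ⟨i, j⟩ h
      simp
    · rintro ⟨j, i⟩ h
      simp only [Finset.mem_sigma, Finset.mem_range] at h
      have e1 : m - i - 1 - (j - i) = m - (j + 1) := by omega
      have e2 : i + 1 + (j - i) = j + 1 := by omega
      simp only [e1, e2, hP]

variable [Finite (IsLocalRing.ResidueField A)]

/-- There is a unique formal `A`-module over `A[v₁, v₂, …]` with Hazewinkel's logarithm. -/
theorem existsUnique_universal {π : A} (hπ : Irreducible π) :
    ∃! G : FormalModule A (MvPolynomial ℕ A),
      (hazewinkelLog π).subst
          (MvPowerSeries.map (MvPolynomial.map (algebraMap A (FractionRing A))) G.toPowerSeries) =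
        (hazewinkelLog π).subst
          (MvPowerSeries.X 0 : MvPowerSeries (Fin 2) (MvPolynomial ℕ (FractionRing A))) +
        (hazewinkelLog π).subst
          (MvPowerSeries.X 1 : MvPowerSeries (Fin 2) (MvPolynomial ℕ (FractionRing A))) ∧
      ∀ a, (hazewinkelLog π).subst
          (PowerSeries.map (MvPolynomial.map (algebraMap A (FractionRing A))) (G.act a)) =
        PowerSeries.C (MvPolynomial.C (algebraMap A (FractionRing A) a)) * hazewinkelLog π := by
  classical
  have := Fintype.ofFinite (IsLocalRing.ResidueField A)
  obtain ⟨p, hchar, f, hp, hcard⟩ := FiniteField.card' (IsLocalRing.ResidueField A)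
  rw [← Nat.card_eq_fintype_card] at hcard
  have hfact := Fact.mk hp
  set ι := MvPolynomial.map (σ := ℕ) (algebraMap A (FractionRing A)) with hι
  set q := Nat.card (IsLocalRing.ResidueField A) with hq
  let σS : MvPolynomial ℕ (FractionRing A) →+* MvPolynomial ℕ (FractionRing A) :=
    (MvPolynomial.expand q).toRingHom
  have hσS : ∀ x, σS x = MvPolynomial.expand q x := fun _ => rfl
  let D : FunctionalEquation.Datum (MvPolynomial ℕ A) (MvPolynomial ℕ (FractionRing A))
      (MvPolynomial ℕ (IsLocalRing.ResidueField A)) :=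
    { ι := ι
      ρ := MvPolynomial.map (IsLocalRing.residue A)
      σV := (MvPolynomial.expand q).toRingHom
      σ := σS
      hσ := fun x => (MvPolynomial.map_expand _ _ _).symm
      ϖ := MvPolynomial.C π
      hρ := fun x =>
        (MvPolynomial.C_dvd_iff_map_hom_eq_zero _ _ (residue_eq_zero_iff hπ) x).symm
      hσϖ := by simp
      p := p
      hp := hp
      hchar := inferInstance
      f := f
      hf := f.ne_zero
      hfrob := fun x => by
        rw [← hcard]
        have hexp : ((MvPolynomial.map (IsLocalRing.residue A)).comp
            (MvPolynomial.expand (σ := ℕ) q).toRingHom) =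
            (iterateFrobenius _ p f).comp (MvPolynomial.map (IsLocalRing.residue A)) := by
          refine MvPolynomial.ringHom_ext (fun a => ?_) (fun i => ?_)
          · simp only [RingHom.comp_apply, AlgHom.toRingHom_eq_coe, RingHom.coe_coe,
              MvPolynomial.expand_C, MvPolynomial.map_C, iterateFrobenius_def, ← map_pow,
              ← hcard]
            rw [map_pow, hq, Nat.card_eq_fintype_card, FiniteField.pow_card]
          · simp only [RingHom.comp_apply, AlgHom.toRingHom_eq_coe, RingHom.coe_coe,
              MvPolynomial.expand_X, MvPolynomial.map_X, iterateFrobenius_def, map_pow,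
              ← hcard]
        have := RingHom.congr_fun hexp x
        simp only [RingHom.comp_apply, iterateFrobenius_def, ← hcard] at this
        exact this
      s := fun i => MvPolynomial.C (algebraMap A (FractionRing A) π)⁻¹ * MvPolynomial.X (i - 1)
      w := fun i => MvPolynomial.X (i - 1)
      hs := fun i => by
        rw [hι, MvPolynomial.map_C, ← mul_assoc, ← MvPolynomial.C_mul, mul_inv_cancel₀,
          MvPolynomial.C_1, one_mul, MvPolynomial.map_X]
        exact (map_ne_zero_iff _ (IsFractionRing.injective A (FractionRing A))).mpr hπ.ne_zero
      l := hazewinkelCoeff π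
      l_zero := by rw [hazewinkelCoeff]
      l_succ := fun m => hazewinkelCoeff_functional π σS (fun x => by simp [hσS])
        (fun i => (MvPolynomial.expand_X _ _)) m }
  have hDq : D.q = q := hcard.symm
  have hlog : D.log = hazewinkelLog π := by
    rw [FunctionalEquation.Datum.log, hazewinkelLog, hDq]
  have key := D.existsUnique_formalModule (A := A)
    (MvPolynomial.map_injective _ (IsFractionRing.injective A (FractionRing A)))
    (fun a => MvPolynomial.expand_C _ _)
  rw [hlog] at key
  have hC : ∀ a, D.ι (algebraMap A (MvPolynomial ℕ A) a) =
      MvPolynomial.C (algebraMap A (FractionRing A) a) := fun a => MvPolynomial.map_C _ _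
  simp only [hC] at key
  exact key

/-- The universal `A`-typical formal `A`-module over `V^A = A[v₁, v₂, …]`, on Hazewinkel's
generators `v_i` (with respect to the uniformizer `π`). -/
noncomputable def universalModule (π : A) (hπ : Irreducible π) :
    FormalModule A (MvPolynomial ℕ A) :=
  (existsUnique_universal hπ).choose

/-- The formal `A`-module `_α 𝔾^A_{1/n}` over an `A`-algebra `R`: the `A`-typical formal `A`-module
classified by the map `V^A → R` which sends `v_n` to `α` and `v_i` to `0` for `i ≠ n`. -/
noncomputable def hazewinkelModule {R : Type*} [CommRing R] [Algebra A R] (π : A)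
    (hπ : Irreducible π) (n : ℕ) (α : R) : FormalModule A R :=
  (universalModule π hπ).baseChange (MvPolynomial.aeval fun i => if i + 1 = n then α else 0)

end Universal

section PadicIntegers

theorem faithfulSMul_integralClosure (p : ℕ) [Fact p.Prime] (K : Type*) [Field K] [Algebra ℚ_[p] K]
    [Algebra ℤ_[p] K] [IsScalarTower ℤ_[p] ℚ_[p] K] :
    FaithfulSMul ℤ_[p] (integralClosure ℤ_[p] K) := by
  rw [faithfulSMul_iff_algebraMap_injective]
  intro a b h
  have h' : algebraMap ℤ_[p] K a = algebraMap ℤ_[p] K b :=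
    congrArg (fun y : integralClosure ℤ_[p] K => (y : K)) h
  rw [IsScalarTower.algebraMap_apply ℤ_[p] ℚ_[p] K, IsScalarTower.algebraMap_apply ℤ_[p] ℚ_[p] K,
    (algebraMap ℚ_[p] K).injective.eq_iff] at h'
  exact IsFractionRing.injective ℤ_[p] ℚ_[p] h'

variable (p : ℕ) [Fact p.Prime] (K : Type*) [Field K] [Algebra ℚ_[p] K] [FiniteDimensional ℚ_[p] K]
  [Algebra ℤ_[p] K] [IsScalarTower ℤ_[p] ℚ_[p] K]

theorem isIntegral_iff_spectralNorm_le_one (x : K) :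
    IsIntegral ℤ_[p] x ↔ spectralNorm ℚ_[p] K x ≤ 1 := by
  have hx : IsIntegral ℚ_[p] x := IsIntegral.of_finite _ _
  rw [spectralNorm, spectralValue_le_one_iff (minpoly.monic hx)]
  constructor
  · intro h n
    rw [minpoly.isIntegrallyClosed_eq_field_fractions' ℚ_[p] h, Polynomial.coeff_map]
    exact PadicInt.norm_le_one _
  · intro h
    have hl : minpoly ℚ_[p] x ∈ Polynomial.lifts (algebraMap ℤ_[p] ℚ_[p]) := by
      rw [Polynomial.lifts_iff_coeff_lifts]
      exact fun n => ⟨⟨_, h n⟩, rfl⟩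
    obtain ⟨P, hP, _, hm⟩ := Polynomial.lifts_and_natDegree_eq_and_monic hl (minpoly.monic hx)
    refine ⟨P, hm, ?_⟩
    rw [IsScalarTower.algebraMap_eq ℤ_[p] ℚ_[p] K, ← Polynomial.eval₂_map, hP]
    exact minpoly.aeval _ _

instance isLocalRing_integralClosure : IsLocalRing (integralClosure ℤ_[p] K) := by
  refine IsLocalRing.of_isUnit_or_isUnit_one_sub_self fun a => ?_
  have hunit : ∀ b : integralClosure ℤ_[p] K, spectralNorm ℚ_[p] K b = 1 → IsUnit b := by
    intro b hb
    have hb0 : (b : K) ≠ 0 := by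
      intro h
      rw [h, spectralNorm_zero] at hb
      exact zero_ne_one hb
    have hinv : spectralNorm ℚ_[p] K (b : K)⁻¹ = 1 := by
      have h := map_mul (spectralMulAlgNorm ℚ_[p] K) (b : K) (b : K)⁻¹
      rw [mul_inv_cancel₀ hb0, map_one, spectralMulAlgNorm_def, spectralMulAlgNorm_def, hb,
        one_mul] at h
      exact h.symm
    refine IsUnit.of_mul_eq_one ⟨(b : K)⁻¹, ?_⟩ (Subtype.ext (mul_inv_cancel₀ hb0))
    exact (isIntegral_iff_spectralNorm_le_one p K _).mpr hinv.le
  have ha := (isIntegral_iff_spectralNorm_le_one p K a).mp a.2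
  have hs := (isIntegral_iff_spectralNorm_le_one p K _).mp (1 - a).2
  rcases ha.lt_or_eq with h | h
  · right
    refine hunit _ (le_antisymm hs ?_)
    have h1 := isNonarchimedean_spectralNorm (K := ℚ_[p]) (L := K) ((1 - a : integralClosure ℤ_[p] K) : K) a
    have e : ((1 - a : integralClosure ℤ_[p] K) : K) + a = 1 := by push_cast; ring
    rw [e, spectralNorm_one] at h1
    rcases le_max_iff.mp h1 with h2 | h2
    · exact h2
    · exact absurd h2 (not_le.mpr h)
  · exact Or.inl (hunit _ h)

instance finite_integralClosure : Module.Finite ℤ_[p] (integralClosure ℤ_[p] K) :=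
  IsIntegralClosure.finite ℤ_[p] ℚ_[p] K _

instance isDiscreteValuationRing_integralClosure :
    IsDiscreteValuationRing (integralClosure ℤ_[p] K) := by
  have h1 : IsDedekindDomain (integralClosure ℤ_[p] K) :=
    IsIntegralClosure.isDedekindDomain ℤ_[p] ℚ_[p] K _
  have h2 : ¬ IsField (integralClosure ℤ_[p] K) := by
    intro h
    have := faithfulSMul_integralClosure p K
    have : IsField ℤ_[p] := isField_of_isIntegral_of_isField
      (FaithfulSMul.algebraMap_injective ℤ_[p] (integralClosure ℤ_[p] K)) h
    exact IsDiscreteValuationRing.not_isField ℤ_[p] this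
  exact ((IsDiscreteValuationRing.TFAE _ h2).out 0 2).mpr h1

instance finite_residueField_padicInt : Finite (IsLocalRing.ResidueField ℤ_[p]) :=
  Finite.of_equiv (ZMod p) (PadicInt.residueField (p := p)).symm.toEquiv

instance finite_residueField_integralClosure :
    Finite (IsLocalRing.ResidueField (integralClosure ℤ_[p] K)) := by
  have := faithfulSMul_integralClosure p K
  have : IsLocalHom (algebraMap ℤ_[p] (integralClosure ℤ_[p] K)) := inferInstance
  have : Module.Finite (IsLocalRing.ResidueField ℤ_[p])
      (IsLocalRing.ResidueField (integralClosure ℤ_[p] K)) := inferInstance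
  exact Module.finite_of_finite (IsLocalRing.ResidueField ℤ_[p])

end PadicIntegers

/-! Write `u` for the unit `π ^ e / p`. The argument rests on two facts about `p`-typical formal
`ℤ_p`-modules, those classified by a sequence of Hazewinkel parameters `v_1, v_2, …`.

The first is integrality of the parameters. Over a torsion-free `ℤ_p`-algebra, a formal group law
whose logarithm is supported in degrees `p ^ m` has parameters in that algebra
(`exists_isHazewinkelLog_of_typical`). The logarithm of a lift of `G` is supported on powers of `q`,
hence on powers of `p`; so the formal `ℤ_p`-module underlying `G` is `p`-typical
(`exists_restrictScalars_eq_typicalModule`).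

The second is that in characteristic `p` the series `[p](X)` shows the parameters. If among the
parameters before `v_{i+1}` at most `v_{h+1} = a` is nonzero, then `[p](X) ≡ a X ^ (p ^ (h+1)) +
v_{i+1} X ^ (p ^ (i+1))` up to degree `p ^ (i+1)` (`act_uniformizer_leading`, valid for any `A` and
`[π]`).

For `G` the same lemma gives `[π](X) = ω X ^ (q ^ n)` exactly. Iterating it `e` times produces a
geometric sum in the exponent of `ω`, and the equation imposed on `ω` makes the coefficient equal to
the residue class of `u`. As `q ^ e = p ^ d`, this says `[p](X) = [u⁻¹](u X ^ (p ^ (dn))) ≡ X ^ (p ^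
(dn))` to leading order. So `v_{dn} = 1` and all earlier parameters vanish. If `u ^ (q - 1) = 1`,
then `[u⁻¹]` is linear, the congruence is an equality, and every parameter agrees with that of `H`;
this is (iii).

In general the parameters after `v_{dn}` are removed one at a time by coordinate changes `X ↦ F(X, b
X ^ (p ^ m))`. Comparing the two sides of `ψ([p]) = [p](ψ)` in one degree shows that the next
parameter disappears when `b ^ (p ^ (dn)) - b + v_{dn+m} = 0`, which is solvable over an
algebraically closed field. The coordinate changes tend to the identity, and their infinite
composite is the strict isomorphism of (i).

For (ii), conjugation is a homeomorphism because composition respects congruences modulo any degree,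
and `Aut(G)` is cut out of the automorphisms of the underlying `ℤ_p`-module by commutation with all
`[a]`, a closed condition. -/

namespace FunctionalEquation.Datum

/-! ### Substitution and congruences modulo high order -/

section Congruence

variable {σ τ R : Type*} [CommRing R]

theorem PowerSeries.mem_high {N : ℕ} {g : PowerSeries R} :
    g ∈ high Unit R N ↔ ∀ n ≤ N, PowerSeries.coeff n g = 0 := by
  constructor
  · intro h n hn
    exact coeff_of_mem_high h (by simpa using hn)
  · intro h
    refine mem_high_of_coeff fun d hd => ?_
    have e : d = Finsupp.single () (d ()) := by
      ext
      simp
    have := h (d ()) (by rw [e] at hd; simpa using hd)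
    rw [e]
    exact this

theorem high_mono {M N : ℕ} (h : M ≤ N) : high τ R N ≤ high τ R M := fun _ hg =>
  mem_high.mpr (le_trans (by exact_mod_cast Nat.succ_le_succ h) (mem_high.mp hg))

theorem eq_zero_of_forall_mem_high {g : MvPowerSeries τ R} (h : ∀ N, g ∈ high τ R N) : g = 0 :=
  MvPowerSeries.ext fun d => by
    rw [coeff_of_mem_high (h d.degree) le_rfl, map_zero]

theorem mem_high_zero_iff {g : MvPowerSeries τ R} :
    g ∈ high τ R 0 ↔ MvPowerSeries.constantCoeff g = 0 := by
  rw [mem_high, zero_add, Nat.cast_one, MvPowerSeries.one_le_order_iff_constCoeff_eq_zero]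

theorem constantCoeff_of_mem_high {N : ℕ} {g : MvPowerSeries τ R} (h : g ∈ high τ R N) :
    MvPowerSeries.constantCoeff g = 0 := mem_high_zero_iff.mp (high_mono (Nat.zero_le N) h)

theorem map_mem_high {S : Type*} [CommRing S] (φ : R →+* S) {N : ℕ} {g : MvPowerSeries τ R}
    (h : g ∈ high τ R N) : MvPowerSeries.map φ g ∈ high τ S N :=
  mem_high_of_coeff fun d hd => by
    rw [MvPowerSeries.coeff_map, coeff_of_mem_high h hd, map_zero]

theorem mem_high_of_map {S : Type*} [CommRing S] {φ : R →+* S} (hφ : Function.Injective φ) {N : ℕ}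
    {g : MvPowerSeries τ R} (h : MvPowerSeries.map φ g ∈ high τ S N) : g ∈ high τ R N :=
  mem_high_of_coeff fun d hd => hφ (by
    rw [← MvPowerSeries.coeff_map, coeff_of_mem_high h hd, map_zero])

theorem mul_mem_high {M N : ℕ} {a b : MvPowerSeries τ R} (ha : a ∈ high τ R M)
    (hb : b ∈ high τ R N) : a * b ∈ high τ R (M + N + 1) := by
  refine le_trans ?_ MvPowerSeries.le_order_mul
  refine le_trans ?_ (add_le_add ha hb)
  norm_cast
  omega

/-- If `g` has order `≥ M` then `g ^ k` has order `≥ M * k`. -/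
theorem pow_mem_high_of_mem {M N k : ℕ} {g : MvPowerSeries τ R} (hg : g ∈ high τ R M)
    (h : N < (M + 1) * k) : g ^ k ∈ high τ R N := by
  refine le_trans ?_ (MvPowerSeries.le_order_pow k)
  refine le_trans ?_ (nsmul_le_nsmul_right hg k)
  rw [nsmul_eq_mul]
  norm_cast
  rw [mul_comm]
  exact h

theorem C_mul_X_pow_mem_high (a : R) {N k : ℕ} (h : N < k) :
    PowerSeries.C a * PowerSeries.X ^ k ∈ high Unit R N :=
  PowerSeries.mem_high.mpr fun n hn => by
    rw [PowerSeries.coeff_C_mul, PowerSeries.coeff_X_pow, if_neg (by omega), mul_zero]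

/-- Substitution preserves congruences in the arguments, provided that it is known for the
monomials which occur. -/
theorem subst_sub_subst_mem_of_monomial {N : ℕ} {a b : σ → MvPowerSeries τ R}
    (ha : MvPowerSeries.HasSubst a)
    (hb : MvPowerSeries.HasSubst b) (f : MvPowerSeries σ R)
    (h : ∀ d : σ →₀ ℕ, f.coeff d ≠ 0 →
      (d.prod fun s e => a s ^ e) - (d.prod fun s e => b s ^ e) ∈ high τ R N) :
    f.subst a - f.subst b ∈ high τ R N := by
  refine mem_high_of_coeff fun e he => ?_
  rw [map_sub, MvPowerSeries.coeff_subst ha, MvPowerSeries.coeff_subst hb, sub_eq_zero]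
  refine finsum_congr fun d => ?_
  by_cases hd : f.coeff d = 0
  · rw [hd, zero_smul, zero_smul]
  · congr 1
    rw [← sub_eq_zero, ← map_sub]
    exact coeff_of_mem_high (h d hd) he

theorem subst_sub_subst_mem {N : ℕ} {a b : σ → MvPowerSeries τ R} (ha : MvPowerSeries.HasSubst a)
    (hb : MvPowerSeries.HasSubst b) (h : ∀ s, a s - b s ∈ high τ R N) (f : MvPowerSeries σ R) :
    f.subst a - f.subst b ∈ high τ R N := by
  refine subst_sub_subst_mem_of_monomial ha hb f fun d _ => ?_
  rw [← Ideal.Quotient.mk_eq_mk_iff_sub_mem, Finsupp.prod, Finsupp.prod, map_prod, map_prod]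
  refine Finset.prod_congr rfl fun s _ => ?_
  rw [map_pow, map_pow, (Ideal.Quotient.mk_eq_mk_iff_sub_mem _ _).mpr (h s)]

theorem subst_mem_high {N : ℕ} {a : σ → MvPowerSeries τ R} (ha : MvPowerSeries.HasSubst a)
    (ha0 : ∀ s, MvPowerSeries.constantCoeff (a s) = 0) {f : MvPowerSeries σ R}
    (hf : f ∈ high σ R N) : f.subst a ∈ high τ R N := by
  refine le_trans ?_ (MvPowerSeries.le_order_subst ha f)
  refine le_trans hf ?_
  calc f.order = 1 * f.order := (one_mul _).symm
    _ ≤ _ := by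
      gcongr
      exact le_iInf fun i => MvPowerSeries.one_le_order_iff_constCoeff_eq_zero.mpr (ha0 i)

theorem comp_mem_high {N : ℕ} {a : MvPowerSeries τ R} (ha : MvPowerSeries.constantCoeff a = 0)
    {f : PowerSeries R} (hf : f ∈ high Unit R N) : f.subst a ∈ high τ R N :=
  subst_mem_high (FormalModule.hasSubst_zero ha).const (fun _ => ha) hf

theorem comp_sub_comp_mem {N : ℕ} {a b : MvPowerSeries τ R}
    (ha : MvPowerSeries.constantCoeff a = 0) (hb : MvPowerSeries.constantCoeff b = 0)
    {f g : PowerSeries R} (hab : a - b ∈ high τ R N) (hfg : f - g ∈ high Unit R N) :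
    f.subst a - g.subst b ∈ high τ R N := by
  have h1 := subst_sub_subst_mem (FormalModule.hasSubst_zero ha).const
    (FormalModule.hasSubst_zero hb).const (fun _ => hab) f
  have h2 := comp_mem_high hb hfg
  rw [PowerSeries.subst_sub (FormalModule.hasSubst_zero hb)] at h2
  have := Ideal.add_mem _ h1 h2
  rw [← PowerSeries.subst_def, ← PowerSeries.subst_def] at this
  convert this using 1
  ring

theorem pair_sub_pair_mem {N : ℕ} {a b a' b' : MvPowerSeries τ R}
    (ha : MvPowerSeries.constantCoeff a = 0) (hb : MvPowerSeries.constantCoeff b = 0)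
    (ha' : MvPowerSeries.constantCoeff a' = 0) (hb' : MvPowerSeries.constantCoeff b' = 0)
    (haa : a - a' ∈ high τ R N) (hbb : b - b' ∈ high τ R N)
    {F G : MvPowerSeries (Fin 2) R} (hFG : F - G ∈ high (Fin 2) R N) :
    F.subst ![a, b] - G.subst ![a', b'] ∈ high τ R N := by
  have hs := FormalModule.hasSubst_pair ha hb
  have hs' := FormalModule.hasSubst_pair ha' hb'
  have h1 := subst_sub_subst_mem (N := N) hs hs' (fun s => by fin_cases s <;> simpa) F
  have h2 := subst_mem_high hs' (fun s => by fin_cases s <;> simpa) hFG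
  rw [MvPowerSeries.subst_sub hs'] at h2
  have := Ideal.add_mem _ h1 h2
  convert this using 1
  ring

/-- A correction of order at least `N` (this is what `high τ R (N - 1)` means) is felt up to degree
`N` only through the linear term of `f`, because `(a + c) ^ k - a ^ k` with `k ≥ 2` is `c` times a
series without constant term. -/
theorem comp_add_sub_mem {N : ℕ} {a c : MvPowerSeries τ R}
    (ha : MvPowerSeries.constantCoeff a = 0) (hN : 0 < N) (hc : c ∈ high τ R (N - 1))
    {f : PowerSeries R} (hf : f.coeff 1 = 1) :
    f.subst (a + c) - (f.subst a + c) ∈ high τ R N := by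
  have hc0 := constantCoeff_of_mem_high hc
  have hac : MvPowerSeries.constantCoeff (a + c) = 0 := by rw [map_add, ha, hc0, add_zero]
  have hs := FormalModule.hasSubst_zero hac
  have hs' := FormalModule.hasSubst_zero ha
  have hcN : (N : ℕ∞) ≤ (a + c - a).order := by
    rw [add_sub_cancel_left]
    refine le_trans ?_ (mem_high.mp hc)
    exact_mod_cast (by omega : N ≤ N - 1 + 1)
  have h := subst_sub_subst_mem_of_monomial (N := N) hs.const hs'.const (f - PowerSeries.X)
    fun d hd => by
      have e : d = Finsupp.single () (d ()) := by
        ext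
        simp
      have e' : ∀ g : MvPowerSeries τ R, (d.prod fun _ k => g ^ k) = g ^ d () := fun g => by
        rw [Finsupp.prod_fintype _ _ fun _ => pow_zero _, Fintype.prod_unique]
      rw [e', e']
      rcases h : d () with _ | _ | k
      · simp
      · exfalso
        apply hd
        rw [e, h]
        change PowerSeries.coeff 1 (f - PowerSeries.X) = 0
        rw [map_sub, hf, PowerSeries.coeff_one_X, sub_self]
      · exact pow_sub_pow_mem_high hac ha hcN (by omega)
  rw [← PowerSeries.subst_def, ← PowerSeries.subst_def, PowerSeries.subst_sub hs,
    PowerSeries.subst_sub hs', PowerSeries.subst_X hs, PowerSeries.subst_X hs'] at h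
  convert h using 1
  ring

/-- If `c` has order `≥ N` then `F(a, c) ≡ a + c` modulo order `> N`. -/
theorem formalGroup_pair_sub_add_mem (F : FormalGroup R) {N : ℕ} {a c : MvPowerSeries τ R}
    (ha : MvPowerSeries.constantCoeff a = 0) (hN : 0 < N) (hc : c ∈ high τ R (N - 1)) :
    F.toPowerSeries.subst ![a, c] - (a + c) ∈ high τ R N := by
  have hc0 := constantCoeff_of_mem_high hc
  have hs := FormalModule.hasSubst_pair ha hc0
  have hs' := FormalModule.hasSubst_pair ha (map_zero (MvPowerSeries.constantCoeff (R := R)))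
  -- The comparison is made for `F - Y` between the points `(a, c)` and `(a, 0)`. Its coefficient at
  -- `Y` is zero, and every other monomial involving `Y` contains either `XY` or `Y ^ 2`, which
  -- raises the order of the contribution of `c` above `N`.
  have h := subst_sub_subst_mem_of_monomial (N := N) hs hs'
    (F.toPowerSeries - MvPowerSeries.X 1) fun d hd => by
      rw [Finsupp.prod_fintype _ _ fun _ => pow_zero _,
        Finsupp.prod_fintype _ _ fun _ => pow_zero _, Fin.prod_univ_two, Fin.prod_univ_two]
      simp only [Matrix.cons_val_zero, Matrix.cons_val_one]
      rw [← mul_sub]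
      have hc' : c ∈ high τ R (N - 1) := hc
      rcases h1 : d 1 with _ | k
      · simp
      · rw [zero_pow (Nat.succ_ne_zero k), sub_zero]
        rcases Nat.eq_zero_or_pos (d 0) with h0 | h0
        · rcases k with _ | k
          · exfalso
            apply hd
            have e : d = Finsupp.single 1 1 := by
              ext i
              fin_cases i
              · simpa using h0
              · simpa using h1
            rw [map_sub, e, F.lin_coeff_Y, MvPowerSeries.coeff_index_single_self_X, sub_self]
          · refine Ideal.mul_mem_left _ _ (pow_mem_high_of_mem hc ?_)
            have : 2 ≤ k + 1 + 1 := by omega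
            nlinarith [Nat.sub_add_cancel hN]
        · have h2 : a ^ d 0 ∈ high τ R 0 := pow_mem_high ha h0
          have h3 : c ^ (k + 1) ∈ high τ R (N - 1) :=
            pow_mem_high_of_mem hc (by nlinarith [Nat.sub_add_cancel hN])
          have := mul_mem_high h2 h3
          rwa [zero_add, Nat.sub_add_cancel hN] at this
  rw [MvPowerSeries.subst_sub hs, MvPowerSeries.subst_sub hs', MvPowerSeries.subst_X hs,
    MvPowerSeries.subst_X hs', F.add_zero (FormalModule.hasSubst_zero ha)] at h
  convert h using 1
  simp
  ring

end Congruence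

end FunctionalEquation.Datum

open FunctionalEquation.Datum in
-- The compositional inverse of `f` also preserves congruences, so congruences may be checked on
-- logarithms.
theorem PowerSeries.sub_mem_high_of_comp {L τ : Type*} [CommRing L] {f : PowerSeries L}
    (hf0 : f.constantCoeff = 0) (hf1 : f.coeff 1 = 1) {N : ℕ} {a b : MvPowerSeries τ L}
    (ha : MvPowerSeries.constantCoeff a = 0) (hb : MvPowerSeries.constantCoeff b = 0)
    (h : f.subst a - f.subst b ∈ high τ L N) : a - b ∈ high τ L N := by
  have hu : IsUnit (f.coeff 1) := by rw [hf1]; exact isUnit_one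
  have key : ∀ {c : MvPowerSeries τ L}, MvPowerSeries.constantCoeff c = 0 →
      (f.substInvOfIsUnit hu).subst (f.subst c) = c := fun hc => by
    rw [← FormalModule.comp_comp hf0 hc, PowerSeries.subst_substInvOfIsUnit_left _ hf0,
      PowerSeries.subst_X (FormalModule.hasSubst_zero hc)]
  have := comp_sub_comp_mem (f := f.substInvOfIsUnit hu) (g := f.substInvOfIsUnit hu)
    (FormalModule.constantCoeff_comp ha hf0) (FormalModule.constantCoeff_comp hb hf0) h
    (by rw [sub_self]; exact Ideal.zero_mem _)
  rwa [key ha, key hb] at this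

theorem PowerSeries.exists_inverse {L : Type*} [CommRing L] {f : PowerSeries L}
    (hf0 : f.constantCoeff = 0) (hf1 : IsUnit (f.coeff 1)) :
    ∃ g : PowerSeries L, g.constantCoeff = 0 ∧ IsUnit (g.coeff 1) ∧
      f.subst g = PowerSeries.X ∧ g.subst f = PowerSeries.X :=
  ⟨f.substInvOfIsUnit hf1, PowerSeries.constantCoeff_substInvOfIsUnit _ _,
    by rw [PowerSeries.coeff_one_substInvOfIsUnit]; exact Units.isUnit _,
    PowerSeries.subst_substInvOfIsUnit_right _ hf0 _,
    PowerSeries.subst_substInvOfIsUnit_left _ hf0 _⟩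

/-! ### Logarithms of formal modules -/

namespace FormalModule

open FunctionalEquation.Datum

/-- `f` is a logarithm, with coefficients in the `R`-algebra `L`, of the formal module `G`. -/
structure IsLogarithm {B R L : Type*} [CommRing B] [CommRing R] [CommRing L] [Algebra B R]
    (ι : R →+* L) (G : FormalModule B R) (f : PowerSeries L) : Prop where
  constantCoeff_eq : f.constantCoeff = 0
  coeff_one : f.coeff 1 = 1
  map_group : f.subst (MvPowerSeries.map ι G.toPowerSeries) =
    f.subst (MvPowerSeries.X 0 : MvPowerSeries (Fin 2) L) +
      f.subst (MvPowerSeries.X 1 : MvPowerSeries (Fin 2) L)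
  map_act (x : B) : f.subst (PowerSeries.map ι (G.act x)) =
    PowerSeries.C (ι (algebraMap B R x)) * f

section

variable {R L : Type*} [CommRing R] [CommRing L] {ι : R →+* L} {τ : Type*}

theorem constantCoeff_map {a : MvPowerSeries τ R} (ha : MvPowerSeries.constantCoeff a = 0) :
    MvPowerSeries.constantCoeff (MvPowerSeries.map ι a) = 0 := by
  rw [MvPowerSeries.constantCoeff_map, ha, map_zero]

theorem constantCoeff_map' {a : PowerSeries R} (ha : a.constantCoeff = 0) :
    (PowerSeries.map ι a).constantCoeff = 0 := constantCoeff_map (τ := Unit) ha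

theorem map_comp {a : MvPowerSeries τ R} (ha : MvPowerSeries.constantCoeff a = 0)
    (f : PowerSeries R) : MvPowerSeries.map ι (f.subst a) =
      (PowerSeries.map ι f).subst (MvPowerSeries.map ι a) :=
  PowerSeries.map_subst (hasSubst_zero ha) _

theorem map_pair {a b : MvPowerSeries τ R} (ha : MvPowerSeries.constantCoeff a = 0)
    (hb : MvPowerSeries.constantCoeff b = 0) (F : MvPowerSeries (Fin 2) R) :
    MvPowerSeries.map ι (F.subst ![a, b]) =
      (MvPowerSeries.map ι F).subst ![MvPowerSeries.map ι a, MvPowerSeries.map ι b] := by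
  rw [MvPowerSeries.map_subst (hasSubst_pair ha hb)]
  congr 1
  funext i
  fin_cases i <;> rfl

theorem log_pair {f : PowerSeries L} {F : MvPowerSeries (Fin 2) R}
    (hF : MvPowerSeries.constantCoeff F = 0) (h : f.subst (MvPowerSeries.map ι F) =
    f.subst (MvPowerSeries.X 0 : MvPowerSeries (Fin 2) L) +
      f.subst (MvPowerSeries.X 1 : MvPowerSeries (Fin 2) L)) {a b : MvPowerSeries τ R}
    (ha : MvPowerSeries.constantCoeff a = 0) (hb : MvPowerSeries.constantCoeff b = 0) :
    f.subst (MvPowerSeries.map ι (F.subst ![a, b])) =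
      f.subst (MvPowerSeries.map ι a) + f.subst (MvPowerSeries.map ι b) := by
  have hc := hasSubst_pair (constantCoeff_map (ι := ι) ha) (constantCoeff_map (ι := ι) hb)
  rw [map_pair ha hb, ← comp_subst (constantCoeff_map hF) hc, h, MvPowerSeries.subst_add hc,
    comp_X_subst 0 hc, comp_X_subst 1 hc]
  rfl

end

namespace IsLogarithm

variable {B R L : Type*} [CommRing B] [CommRing R] [CommRing L] [Algebra B R]
  {ι : R →+* L} {G G' : FormalModule B R} {f f' : PowerSeries L} {τ : Type*}

theorem pair (h : IsLogarithm ι G f) {a b : MvPowerSeries τ R}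
    (ha : MvPowerSeries.constantCoeff a = 0) (hb : MvPowerSeries.constantCoeff b = 0) :
    f.subst (MvPowerSeries.map ι (G.toPowerSeries.subst ![a, b])) =
      f.subst (MvPowerSeries.map ι a) + f.subst (MvPowerSeries.map ι b) :=
  log_pair G.zero_constantCoeff h.map_group ha hb

theorem act_comp (h : IsLogarithm ι G f) {a : MvPowerSeries τ R}
    (ha : MvPowerSeries.constantCoeff a = 0) (x : B) :
    f.subst (MvPowerSeries.map ι ((G.act x).subst a)) =
      MvPowerSeries.C (ι (algebraMap B R x)) * f.subst (MvPowerSeries.map ι a) := by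
  have ha' := constantCoeff_map (ι := ι) ha
  rw [map_comp ha, ← comp_comp (constantCoeff_map' (G.act_constantCoeff x)) ha',
    h.map_act, PowerSeries.subst_mul (hasSubst_zero ha'), PowerSeries.subst_C]

theorem sub_mem_high (h : IsLogarithm ι G f) (hι : Function.Injective ι) {N : ℕ}
    {a b : MvPowerSeries τ R}
    (ha : MvPowerSeries.constantCoeff a = 0) (hb : MvPowerSeries.constantCoeff b = 0)
    (hab : f.subst (MvPowerSeries.map ι a) - f.subst (MvPowerSeries.map ι b) ∈ high τ L N) :
    a - b ∈ high τ R N := by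
  refine mem_high_of_map hι ?_
  rw [map_sub]
  exact PowerSeries.sub_mem_high_of_comp h.constantCoeff_eq h.coeff_one (constantCoeff_map ha)
    (constantCoeff_map hb) hab

theorem eq_of_comp_eq (h : IsLogarithm ι G f) (hι : Function.Injective ι)
    {a b : MvPowerSeries τ R}
    (ha : MvPowerSeries.constantCoeff a = 0) (hb : MvPowerSeries.constantCoeff b = 0)
    (hab : f.subst (MvPowerSeries.map ι a) = f.subst (MvPowerSeries.map ι b)) : a = b :=
  sub_eq_zero.mp (eq_zero_of_forall_mem_high fun N => h.sub_mem_high hι ha hb (by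
    rw [hab, sub_self]
    exact Ideal.zero_mem _))

/-- Formal modules whose logarithms are congruent are congruent. -/
theorem congr (h : IsLogarithm ι G f) (h' : IsLogarithm ι G' f') (hι : Function.Injective ι)
    {N : ℕ} (hff : f - f' ∈ high Unit L N) :
    G.toPowerSeries - G'.toPowerSeries ∈ high (Fin 2) R N ∧
      ∀ x, G.act x - G'.act x ∈ high Unit R N := by
  have hsub : ∀ {σ : Type} {a : MvPowerSeries σ L}, MvPowerSeries.constantCoeff a = 0 →
      f.subst a - f'.subst a ∈ high σ L N := fun ha =>
    comp_sub_comp_mem ha ha (by rw [sub_self]; exact Ideal.zero_mem _) hff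
  refine ⟨h.sub_mem_high hι G.zero_constantCoeff G'.zero_constantCoeff ?_, fun x =>
    h.sub_mem_high hι (G.act_constantCoeff x) (G'.act_constantCoeff x) ?_⟩
  · have h0 := hsub (MvPowerSeries.constantCoeff_X (R := L) (0 : Fin 2))
    have h1 := hsub (MvPowerSeries.constantCoeff_X (R := L) (1 : Fin 2))
    have h2 := hsub (constantCoeff_map (ι := ι) G'.zero_constantCoeff)
    rw [h'.map_group] at h2
    rw [h.map_group]
    have := Ideal.sub_mem _ (Ideal.add_mem _ h0 h1) h2
    convert this using 1
    ring
  · have h2 := hsub (constantCoeff_map (τ := Unit) (ι := ι) (G'.act_constantCoeff x))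
    have e := h'.map_act x
    have e' := h.map_act x
    change PowerSeries.subst (MvPowerSeries.map ι (G'.act x)) f' = _ at e
    change PowerSeries.subst (MvPowerSeries.map ι (G.act x)) f = _ at e'
    rw [e] at h2
    rw [e']
    have := Ideal.sub_mem _
      (Ideal.mul_mem_left _ (PowerSeries.C (ι (algebraMap B R x))) hff) h2
    convert this using 1
    ring

theorem eq_of_eq (h : IsLogarithm ι G f) (h' : IsLogarithm ι G' f) (hι : Function.Injective ι) :
    G = G' := by
  have := fun N => h.congr h' hι (N := N) (by rw [sub_self]; exact Ideal.zero_mem _)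
  refine ext' (sub_eq_zero.mp (eq_zero_of_forall_mem_high fun N => (this N).1)) ?_
  funext x
  exact sub_eq_zero.mp (eq_zero_of_forall_mem_high fun N => (this N).2 x)

/-- If `f(ψ)` is a logarithm of `G'` and `f` is a logarithm of `G`, then `ψ : G' → G` is an
isomorphism. -/
noncomputable def iso (h : IsLogarithm ι G f) (hι : Function.Injective ι) {ψ : PowerSeries R}
    (hψ0 : ψ.constantCoeff = 0) (hψ1 : IsUnit (ψ.coeff 1))
    (h' : IsLogarithm ι G' (f.subst (PowerSeries.map ι ψ))) : Iso G' G where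
  toSeries := ψ
  constantCoeff_eq := hψ0
  isUnit_coeff_one := hψ1
  map_group := by
    have hψ0' : (PowerSeries.map ι ψ).constantCoeff = 0 := constantCoeff_map' hψ0
    have c0 := MvPowerSeries.constantCoeff_X (R := R) (0 : Fin 2)
    have c1 := MvPowerSeries.constantCoeff_X (R := R) (1 : Fin 2)
    have k0 := constantCoeff_comp c0 hψ0
    have k1 := constantCoeff_comp c1 hψ0
    refine h.eq_of_comp_eq hι (constantCoeff_comp G'.zero_constantCoeff hψ0)
      (constantCoeff_subst_pair k0 k1 G.zero_constantCoeff) ?_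
    have e := h'.map_group
    rw [comp_comp hψ0' (constantCoeff_map G'.zero_constantCoeff),
      comp_comp hψ0' (MvPowerSeries.constantCoeff_X 0),
      comp_comp hψ0' (MvPowerSeries.constantCoeff_X 1)] at e
    rw [h.pair k0 k1, map_comp G'.zero_constantCoeff, e, map_comp c0, map_comp c1,
      MvPowerSeries.map_X, MvPowerSeries.map_X]
  map_act x := by
    have hψ0' : (PowerSeries.map ι ψ).constantCoeff = 0 := constantCoeff_map' hψ0
    refine h.eq_of_comp_eq hι (constantCoeff_comp (G'.act_constantCoeff x) hψ0)
      (constantCoeff_comp hψ0 (G.act_constantCoeff x)) ?_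
    have e := h'.map_act x
    rw [comp_comp hψ0' (constantCoeff_map' (G'.act_constantCoeff x))] at e
    rw [h.act_comp hψ0, map_comp (G'.act_constantCoeff x)]
    exact e

theorem restrictScalars (B' : Type*) [CommRing B'] [Algebra B' B] [Algebra B' R]
    [IsScalarTower B' B R] (h : IsLogarithm ι G f) :
    IsLogarithm ι (G.restrictScalars B') f where
  constantCoeff_eq := h.constantCoeff_eq
  coeff_one := h.coeff_one
  map_group := h.map_group
  map_act x := (h.map_act (algebraMap B' B x)).trans (by
    rw [← IsScalarTower.algebraMap_apply B' B R])

end IsLogarithm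

end FormalModule

/-- `f` is the logarithm `∑ ℓ_m X ^ (q ^ m)` given by Hazewinkel's recursion
`ϖ ℓ_{m+1} = ∑_{j ≤ m} ℓ_j w_{m-j} ^ (q ^ j)`, `ℓ_0 = 1`, where `w i` stands for `v_{i+1}`. -/
structure IsHazewinkelLog {L : Type*} [CommRing L] (q : ℕ) (ϖ : L) (w : ℕ → L)
    (f : PowerSeries L) : Prop where
  coeff_one : f.coeff 1 = 1
  coeff_eq_zero (j : ℕ) (hj : ∀ m, j ≠ q ^ m) : f.coeff j = 0
  coeff_succ (m : ℕ) : ϖ * f.coeff (q ^ (m + 1)) =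
    ∑ j ∈ Finset.range (m + 1), f.coeff (q ^ j) * w (m - j) ^ q ^ j

/-! ### Consequences of Hazewinkel's recursion -/

namespace IsHazewinkelLog

open FunctionalEquation.Datum

variable {L : Type*} [Field L] {q : ℕ} {ϖ : L} {w w' : ℕ → L} {f f' : PowerSeries L}

theorem constantCoeff_eq (h : IsHazewinkelLog q ϖ w f) (hq : 2 ≤ q) : f.constantCoeff = 0 := by
  rw [← PowerSeries.coeff_zero_eq_constantCoeff_apply]
  exact h.coeff_eq_zero 0 fun m => (pow_pos (by omega) m).ne

theorem coeff_congr (h : IsHazewinkelLog q ϖ w f) (h' : IsHazewinkelLog q ϖ w' f') (hϖ : ϖ ≠ 0)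
    {M : ℕ} (hw : ∀ i < M, w i = w' i) {m : ℕ} (hm : m ≤ M) :
    f.coeff (q ^ m) = f'.coeff (q ^ m) := by
  induction m using Nat.strong_induction_on with
  | _ m ih =>
    rcases m with _ | m
    · rw [pow_zero, h.coeff_one, h'.coeff_one]
    · apply mul_left_cancel₀ hϖ
      rw [h.coeff_succ, h'.coeff_succ]
      refine Finset.sum_congr rfl fun j hj => ?_
      have hj := Finset.mem_range.mp hj
      rw [ih j (by omega) (by omega), hw _ (by omega)]

/-- The parameter `w i`, standing for `v_{i+1}`, enters the recursion for the first time in degree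
`q ^ (i + 1)`. -/
theorem sub_mem_high (h : IsHazewinkelLog q ϖ w f) (h' : IsHazewinkelLog q ϖ w' f') (hϖ : ϖ ≠ 0)
    {N : ℕ} (hw : ∀ i, q ^ (i + 1) ≤ N → w i = w' i) (hq : 2 ≤ q) : f - f' ∈ high Unit L N := by
  refine PowerSeries.mem_high.mpr fun n hn => ?_
  rw [map_sub, sub_eq_zero]
  by_cases hj : ∃ m, n = q ^ m
  · obtain ⟨m, rfl⟩ := hj
    refine h.coeff_congr h' hϖ (fun i hi => hw i (le_trans ?_ hn)) le_rfl
    exact Nat.pow_le_pow_right (by omega) hi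
  · push Not at hj
    rw [h.coeff_eq_zero n hj, h'.coeff_eq_zero n hj]

theorem eq (h : IsHazewinkelLog q ϖ w f) (h' : IsHazewinkelLog q ϖ w f') (hϖ : ϖ ≠ 0)
    (hq : 2 ≤ q) : f = f' :=
  sub_eq_zero.mp (eq_zero_of_forall_mem_high fun _ => h.sub_mem_high h' hϖ (fun _ _ => rfl) hq)

/-- Each step of the recursion divides by `π` once, so `π ^ m` clears the denominator of `ℓ_m`. -/
theorem exists_pow_mul_coeff {R : Type*} [CommRing R] {ι : R →+* L} {π : R} {c : ℕ → R}
    (h : IsHazewinkelLog q (ι π) (fun i => ι (c i)) f) (m : ℕ) :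
    ∃ x, ι x = ι π ^ m * f.coeff (q ^ m) := by
  induction m using Nat.strong_induction_on with
  | _ m ih =>
    rcases m with _ | m
    · exact ⟨1, by rw [pow_zero, pow_zero, h.coeff_one, mul_one, map_one]⟩
    · choose! x hx using ih
      refine ⟨∑ j ∈ Finset.range (m + 1), π ^ (m - j) * x j * c (m - j) ^ q ^ j, ?_⟩
      rw [pow_succ, mul_assoc, h.coeff_succ, Finset.mul_sum, map_sum]
      refine Finset.sum_congr rfl fun j hj => ?_
      have hj := Finset.mem_range.mp hj
      rw [map_mul, map_mul, hx j hj, map_pow, map_pow, ← mul_assoc, ← mul_assoc, ← pow_add]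
      congr 4
      omega

end IsHazewinkelLog

theorem PowerSeries.coeff_comp_C_mul_X_pow {L : Type*} [CommRing L] (f : PowerSeries L) (b : L)
    {K : ℕ} (hK : K ≠ 0) (n : ℕ) :
    PowerSeries.coeff n (f.subst (PowerSeries.C b * PowerSeries.X ^ K : PowerSeries L)) =
      if K ∣ n then f.coeff (n / K) * b ^ (n / K) else 0 := by
  have h0 : PowerSeries.HasSubst (PowerSeries.C b * PowerSeries.X ^ K : PowerSeries L) :=
    PowerSeries.HasSubst.of_constantCoeff_zero' (by simp [hK])
  have key : ∀ d, (PowerSeries.coeff n ((PowerSeries.C b * PowerSeries.X ^ K) ^ d)) =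
      if n = K * d then b ^ d else 0 := fun d => by
    rw [mul_pow, ← map_pow, ← pow_mul, PowerSeries.coeff_C_mul, PowerSeries.coeff_X_pow]
    simp
  rw [PowerSeries.coeff_subst' h0]
  simp only [key]
  split_ifs with h
  · obtain ⟨d, rfl⟩ := h
    rw [finsum_eq_single _ d, if_pos rfl, smul_eq_mul, Nat.mul_div_cancel_left d (by omega)]
    intro e he
    rw [if_neg, smul_zero]
    intro h
    exact he (Nat.eq_of_mul_eq_mul_left (by omega) h).symm
  · rw [finsum_eq_zero_of_forall_eq_zero]
    intro d
    rw [if_neg, smul_zero]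
    rintro rfl
    exact h ⟨d, rfl⟩

/-! ### Formal modules with given parameters, and their logarithms -/

section TypicalModule

open FunctionalEquation.Datum FormalModule

variable {A : Type*} [CommRing A] [IsDomain A] [IsDiscreteValuationRing A]
  [Finite (IsLocalRing.ResidueField A)] {R S : Type*} [CommRing R] [Algebra A R]
  [CommRing S] [Algebra A S]

/-- The `A`-typical formal `A`-module over `R` classified by the map `V^A → R` which sends
`v_{i+1}` to `c i`. -/
noncomputable def typicalModule (π : A) (hπ : Irreducible π) (c : ℕ → R) : FormalModule A R :=
  (universalModule π hπ).baseChange (MvPolynomial.aeval c)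

theorem hazewinkelModule_eq_typicalModule (π : A) (hπ : Irreducible π) (n : ℕ) (α : R) :
    hazewinkelModule π hπ n α = typicalModule π hπ fun i => if i + 1 = n then α else 0 := rfl

theorem typicalModule_baseChange (π : A) (hπ : Irreducible π) (c : ℕ → R) (ρ : R →ₐ[A] S) :
    (typicalModule π hπ c).baseChange ρ = typicalModule π hπ fun i => ρ (c i) := by
  have e : (ρ : R →+* S).comp ((MvPolynomial.aeval c : MvPolynomial ℕ A →ₐ[A] R) :
      MvPolynomial ℕ A →+* R) = ((MvPolynomial.aeval fun i => ρ (c i) :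
        MvPolynomial ℕ A →ₐ[A] S) : MvPolynomial ℕ A →+* S) := by
    refine MvPolynomial.ringHom_ext (fun a => ?_) fun i => ?_ <;> simp
  refine ext' ?_ ?_
  · change MvPowerSeries.map _ (MvPowerSeries.map _ _) = MvPowerSeries.map _ _
    rw [← e, MvPowerSeries.map_comp]
    rfl
  · funext a
    change MvPowerSeries.map _ (MvPowerSeries.map _ _) = MvPowerSeries.map _ _
    rw [← e, MvPowerSeries.map_comp]
    rfl

theorem two_le_card_residueField : 2 ≤ Nat.card (IsLocalRing.ResidueField A) :=
  Finite.one_lt_card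

variable {L : Type*} [Field L] {ι : R →+* L}

/-- Injectivity of `A → L` extends it to the field of fractions of `A`, so the universal logarithm
can be specialised at the parameters. Both the recursion and the logarithm identities are images of
the universal ones. -/
theorem exists_log_typicalModule (hι : Function.Injective (ι.comp (algebraMap A R))) (π : A)
    (hπ : Irreducible π) (c : ℕ → R) : ∃ f : PowerSeries L,
      IsHazewinkelLog (Nat.card (IsLocalRing.ResidueField A)) (ι (algebraMap A R π))
        (fun i => ι (c i)) f ∧ IsLogarithm ι (typicalModule π hπ c) f := by
  have hq := two_le_card_residueField (A := A)
  set q := Nat.card (IsLocalRing.ResidueField A) with hqdef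
  set κ : FractionRing A →+* L := IsFractionRing.lift hι with hκ
  have hκA : ∀ a, κ (algebraMap A (FractionRing A) a) = ι (algebraMap A R a) := fun a =>
    IsFractionRing.lift_algebraMap hι a
  set φ : MvPolynomial ℕ (FractionRing A) →+* L := MvPolynomial.eval₂Hom κ fun i => ι (c i) with hφ
  have hφC : ∀ a, φ (MvPolynomial.C a) = κ a := fun a => MvPolynomial.eval₂Hom_C _ _ _
  have hφX : ∀ i, φ (MvPolynomial.X i) = ι (c i) := fun i => MvPolynomial.eval₂Hom_X' _ _ _
  have hϖ : ι (algebraMap A R π) ≠ 0 := fun h => hπ.ne_zero (hι (by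
    rw [map_zero]
    exact h))
  have hcomp : φ.comp (MvPolynomial.map (algebraMap A (FractionRing A))) =
      ι.comp ((MvPolynomial.aeval c : MvPolynomial ℕ A →ₐ[A] R) : MvPolynomial ℕ A →+* R) := by
    refine MvPolynomial.ringHom_ext (fun a => ?_) fun i => ?_
    · simp [hφC, hκA]
    · simp [hφX]
  have hco : ∀ m, PowerSeries.coeff (q ^ m) (PowerSeries.map φ (hazewinkelLog π)) =
      φ (hazewinkelCoeff π m) := fun m => by
    rw [PowerSeries.coeff_map, hazewinkelLog, PowerSeries.coeff_mk, ← hqdef,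
      Nat.log_pow (by omega), if_pos rfl]
  have hHaz : IsHazewinkelLog q (ι (algebraMap A R π)) (fun i => ι (c i))
      (PowerSeries.map φ (hazewinkelLog π)) := by
    refine ⟨?_, fun j hj => ?_, fun m => ?_⟩
    · have := hco 0
      rw [pow_zero, hazewinkelCoeff, map_one] at this
      exact this
    · rw [PowerSeries.coeff_map, hazewinkelLog, PowerSeries.coeff_mk, ← hqdef,
        if_neg fun e => hj _ e.symm, map_zero]
    · simp only [hco]
      rw [hazewinkelCoeff_succ, map_mul, hφC, map_inv₀, hκA, ← mul_assoc, mul_inv_cancel₀ hϖ,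
        one_mul, map_sum]
      refine Finset.sum_congr rfl fun j _ => ?_
      rw [map_mul, map_pow, hφX]
  obtain ⟨hgroup, hact⟩ := (existsUnique_universal hπ).choose_spec.1
  change (hazewinkelLog π).subst (MvPowerSeries.map _ (universalModule π hπ).toPowerSeries) = _
    at hgroup
  change ∀ a, (hazewinkelLog π).subst (PowerSeries.map _ ((universalModule π hπ).act a)) = _
    at hact
  refine ⟨_, hHaz, hHaz.constantCoeff_eq hq, hHaz.coeff_one, ?_, fun x => ?_⟩
  · have h := congrArg (MvPowerSeries.map φ) hgroup
    rw [map_comp (constantCoeff_map (universalModule π hπ).zero_constantCoeff), map_add,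
      map_comp (MvPowerSeries.constantCoeff_X _), map_comp (MvPowerSeries.constantCoeff_X _),
      MvPowerSeries.map_X, MvPowerSeries.map_X] at h
    rw [← h]
    congr 1
    change MvPowerSeries.map ι (MvPowerSeries.map _ _) = _
    rw [← RingHom.comp_apply, ← MvPowerSeries.map_comp, ← hcomp, MvPowerSeries.map_comp]
    rfl
  · have h := congrArg (MvPowerSeries.map φ) (hact x)
    rw [map_comp (constantCoeff_map' ((universalModule π hπ).act_constantCoeff x))] at h
    have e : MvPowerSeries.map φ (PowerSeries.C (MvPolynomial.C (algebraMap A (FractionRing A) x)) *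
        hazewinkelLog π) = PowerSeries.C (ι (algebraMap A R x)) *
          PowerSeries.map φ (hazewinkelLog π) := by
      refine (map_mul _ _ _).trans ?_
      congr 1
      refine (PowerSeries.map_C _ _).trans ?_
      rw [hφC, hκA]
    rw [e] at h
    rw [← h]
    congr 1
    change MvPowerSeries.map ι (MvPowerSeries.map _ _) = _
    rw [← RingHom.comp_apply, ← MvPowerSeries.map_comp, ← hcomp, MvPowerSeries.map_comp]
    rfl

/-- The recursion has only one solution, since `π` is nonzero in the field `L`. -/
theorem IsHazewinkelLog.isLogarithm (hι : Function.Injective (ι.comp (algebraMap A R))) {π : A}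
    (hπ : Irreducible π) {c : ℕ → R} {f : PowerSeries L}
    (h : IsHazewinkelLog (Nat.card (IsLocalRing.ResidueField A)) (ι (algebraMap A R π))
        (fun i => ι (c i)) f) : IsLogarithm ι (typicalModule π hπ c) f := by
  obtain ⟨f', h', hlog⟩ := exists_log_typicalModule hι π hπ c
  have hϖ : ι (algebraMap A R π) ≠ 0 := fun h => hπ.ne_zero (hι (by
    rw [map_zero]
    exact h))
  rwa [h.eq h' hϖ two_le_card_residueField]

end TypicalModule

open FunctionalEquation.Datum FormalModule

/-! ### The series `[π]` after reduction modulo `π` -/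

section Uniformizer

variable {A : Type*} [CommRing A] [IsDomain A] [IsDiscreteValuationRing A]
  [Finite (IsLocalRing.ResidueField A)] {R : Type*} [CommRing R] [Algebra A R]
  {L : Type*} [Field L] {ι : R →+* L}

/-- The power series `exp(πX)` is integral and divisible by `π`. -/
theorem IsHazewinkelLog.exists_comp_eq_C_mul_X {q : ℕ} (hq : 2 ≤ q) (hι : Function.Injective ι)
    {π : R} {c : ℕ → R} {f : PowerSeries L}
    (h : IsHazewinkelLog q (ι π) (fun i => ι (c i)) f) :
    ∃ χ : PowerSeries R, χ.constantCoeff = 0 ∧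
      f.subst (PowerSeries.map ι (PowerSeries.C π * χ)) =
        PowerSeries.C (ι π) * (PowerSeries.X : PowerSeries L) := by
  -- The nonzero coefficients are `ℓ_m` in degree `q ^ m`, with denominator at most `π ^ m`, and `m
  -- ≤ q ^ m - 1`. Hence `f(πX) = π g(X)` with `g` integral of linear coefficient `1`. For the
  -- inverse `χ` of `g` this gives `f(πχ) = π g(χ) = πX`.
  have hint : ∀ n, ∃ x, ι x = f.coeff n * ι π ^ (n - 1) := fun n => by
    by_cases hn : ∃ m, n = q ^ m
    · obtain ⟨m, rfl⟩ := hn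
      obtain ⟨x, hx⟩ := h.exists_pow_mul_coeff m
      have hm : m < q ^ m := Nat.lt_pow_self (by omega)
      refine ⟨π ^ (q ^ m - 1 - m) * x, ?_⟩
      rw [map_mul, hx, map_pow, ← mul_assoc, ← pow_add, mul_comm]
      congr 2
      omega
    · push Not at hn
      exact ⟨0, by rw [h.coeff_eq_zero n hn, map_zero, zero_mul]⟩
  choose x hx using hint
  set g : PowerSeries R := PowerSeries.mk x with hg
  have hg' : PowerSeries.rescale (ι π) f = PowerSeries.C (ι π) * PowerSeries.map ι g := by
    ext n
    rw [PowerSeries.coeff_rescale, PowerSeries.coeff_C_mul, PowerSeries.coeff_map, hg,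
      PowerSeries.coeff_mk, hx]
    rcases n with _ | n
    · rw [PowerSeries.coeff_zero_eq_constantCoeff_apply, h.constantCoeff_eq hq, mul_zero, zero_mul,
        mul_zero]
    · rw [Nat.add_sub_cancel, pow_succ]
      ring
  have hg0 : g.constantCoeff = 0 := by
    apply hι
    rw [hg, PowerSeries.constantCoeff_mk, hx, PowerSeries.coeff_zero_eq_constantCoeff_apply,
      h.constantCoeff_eq hq, zero_mul, map_zero]
  have hg1 : IsUnit (g.coeff 1) := by
    have : g.coeff 1 = 1 := hι (by
      rw [hg, PowerSeries.coeff_mk, hx, h.coeff_one, map_one, Nat.sub_self, pow_zero, mul_one])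
    rw [this]
    exact isUnit_one
  obtain ⟨χ, hχ0, -, hχ, -⟩ := PowerSeries.exists_inverse hg0 hg1
  refine ⟨χ, hχ0, ?_⟩
  have hχ0' := constantCoeff_map' (ι := ι) hχ0
  have hs := PowerSeries.HasSubst.of_constantCoeff_zero' hχ0'
  have e1 : PowerSeries.map ι (PowerSeries.C π * χ) =
      PowerSeries.subst (PowerSeries.map ι χ) (ι π • (PowerSeries.X : PowerSeries L)) := by
    rw [PowerSeries.subst_smul hs, PowerSeries.subst_X hs, map_mul, PowerSeries.map_C,
      PowerSeries.smul_eq_C_mul]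
  rw [e1, ← comp_comp (by simp) hχ0', ← PowerSeries.rescale_eq_subst, hg',
    PowerSeries.subst_mul hs, PowerSeries.subst_C]
  have e2 : PowerSeries.subst (PowerSeries.map ι χ) (PowerSeries.map ι g) =
      (PowerSeries.X : PowerSeries L) := by
    have := map_comp (ι := ι) (τ := Unit) hχ0 g
    rw [hχ] at this
    refine this.symm.trans (PowerSeries.map_X _)
  rw [e2]
  rfl

/-- A congruence for `[π]` over a quotient in which `π` vanishes, by comparison of logarithms. -/
theorem act_uniformizer_sub_mem {κ : Type*} [CommRing κ] [Algebra A κ] {π : A}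
    (hπ : Irreducible π) (hι : Function.Injective ι)
    (hA : Function.Injective (algebraMap A R)) (ρ : R →ₐ[A] κ) (hρ : algebraMap A κ π = 0)
    {c : ℕ → R} {f : PowerSeries L}
    (h : IsHazewinkelLog (Nat.card (IsLocalRing.ResidueField A)) (ι (algebraMap A R π))
        (fun i => ι (c i)) f) {γ : PowerSeries R} (hγ : γ.constantCoeff = 0) {N : ℕ}
    (hf : PowerSeries.C (ι (algebraMap A R π)) * f -
      (PowerSeries.C (ι (algebraMap A R π)) * PowerSeries.X + f.subst (PowerSeries.map ι γ)) ∈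
        high Unit L N) :
    (typicalModule π hπ fun i => ρ (c i)).act π - PowerSeries.map (ρ : R →+* κ) γ ∈
      high Unit κ N := by
  have hιA : Function.Injective (ι.comp (algebraMap A R)) := hι.comp hA
  have hlog := h.isLogarithm hιA hπ
  obtain ⟨χ, hχ0, hχ⟩ := h.exists_comp_eq_C_mul_X two_le_card_residueField hι
  have hε : (PowerSeries.C (algebraMap A R π) * χ).constantCoeff = 0 := by
    rw [map_mul, hχ0, mul_zero]
  -- Before reduction, `[π](X)` is compared with the formal sum of `exp(πX) = πχ` and `γ`. Their
  -- logarithms are `π f` and `πX + f(γ)`, which `hf` declares congruent. Applying `ρ` kills `πχ`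
  -- and leaves `γ`.
  have key := hlog.sub_mem_high (N := N) hι ((typicalModule π hπ c).act_constantCoeff π)
    (constantCoeff_subst_pair (σ := Unit) hε hγ (typicalModule π hπ c).zero_constantCoeff) (by
      rw [hlog.pair (τ := Unit) hε hγ]
      have e1 := hlog.map_act π
      change f.subst (MvPowerSeries.map ι ((typicalModule π hπ c).act π)) = _ at e1
      rw [e1]
      change _ - (PowerSeries.subst (PowerSeries.map ι _) f +
        PowerSeries.subst (PowerSeries.map ι γ) f) ∈ _
      rw [hχ]
      exact hf)
  have := map_mem_high (ρ : R →+* κ) key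
  rw [map_sub, map_pair (τ := Unit) hε hγ] at this
  have e0 : MvPowerSeries.map (ρ : R →+* κ) (PowerSeries.C (algebraMap A R π) * χ) = 0 := by
    refine (map_mul (PowerSeries.map (ρ : R →+* κ)) _ _).trans ?_
    rw [PowerSeries.map_C]
    change PowerSeries.C (ρ _) * _ = _
    rw [AlgHom.commutes, hρ, map_zero, zero_mul]
  rw [e0] at this
  rw [← typicalModule_baseChange π hπ c ρ]
  have e2 := ((typicalModule π hπ c).baseChange ρ).toFormalGroup.zero_add (σ := Unit)
    (f := MvPowerSeries.map (ρ : R →+* κ) γ)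
    (hasSubst_zero (constantCoeff_map (τ := Unit) hγ))
  have e3 := congrArg (fun z => MvPowerSeries.map (ρ : R →+* κ) ((typicalModule π hπ c).act π) - z) e2
  refine (iff_of_eq (congrArg (· ∈ high Unit κ N) e3)).mp this

end Uniformizer

/-! ### Torsion-free lifts of the base ring -/

section Lift

variable (A κ : Type*) [CommRing A]

/-- A torsion-free `A`-algebra which surjects onto the `A`-algebra `κ`. -/
abbrev LiftRing : Type _ := MvPolynomial κ A

/-- The projection onto `κ`. -/
noncomputable def LiftRing.proj [CommRing κ] [Algebra A κ] : LiftRing A κ →ₐ[A] κ := MvPolynomial.aeval id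

open Classical in
/-- A section of the projection which preserves `0`. -/
noncomputable def LiftRing.lift [Zero κ] (x : κ) : LiftRing A κ := if x = 0 then 0 else MvPolynomial.X x

variable {κ}

theorem LiftRing.proj_lift [CommRing κ] [Algebra A κ] (x : κ) : LiftRing.proj A κ (LiftRing.lift A κ x) = x := by
  rw [lift, proj]
  split_ifs with h
  · rw [map_zero, h]
  · rw [MvPolynomial.aeval_X, id]

theorem LiftRing.lift_zero [Zero κ] : LiftRing.lift A κ 0 = 0 := if_pos rfl

variable (κ)

theorem LiftRing.algebraMap_injective : Function.Injective (algebraMap A (LiftRing A κ)) :=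
  MvPolynomial.C_injective κ A

theorem LiftRing.toFractionRing_injective [IsDomain A] :
    Function.Injective (algebraMap (LiftRing A κ) (FractionRing (LiftRing A κ))) :=
  IsFractionRing.injective _ _

theorem LiftRing.comp_injective [IsDomain A] :
    Function.Injective ((algebraMap (LiftRing A κ) (FractionRing (LiftRing A κ))).comp
      (algebraMap A (LiftRing A κ))) := by
  rw [RingHom.coe_comp]
  exact (toFractionRing_injective A κ).comp (algebraMap_injective A κ)

end Lift

/-! ### Parameters and `[π]` over an `A`-algebra killed by `π` -/

section ResidueChar

variable {A : Type*} [CommRing A] [IsDomain A] [IsDiscreteValuationRing A]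
  [Finite (IsLocalRing.ResidueField A)] {κ : Type*}

theorem LiftRing.exists_log {π : A} (hπ : Irreducible π) (c : ℕ → LiftRing A κ) :
    ∃ f : PowerSeries (FractionRing (LiftRing A κ)),
      IsHazewinkelLog (Nat.card (IsLocalRing.ResidueField A))
        (algebraMap _ (FractionRing (LiftRing A κ)) (algebraMap A (LiftRing A κ) π))
        (fun i => algebraMap _ (FractionRing (LiftRing A κ)) (c i)) f ∧
      IsLogarithm (algebraMap _ (FractionRing (LiftRing A κ))) (typicalModule π hπ c) f :=
  exists_log_typicalModule (LiftRing.comp_injective A κ) π hπ c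

variable [CommRing κ] [Algebra A κ]

theorem typicalModule_eq_baseChange_lift {π : A} (hπ : Irreducible π) (c : ℕ → κ) :
    typicalModule π hπ c =
      (typicalModule π hπ fun i => LiftRing.lift A κ (c i)).baseChange (LiftRing.proj A κ) := by
  rw [typicalModule_baseChange]
  simp only [LiftRing.proj_lift]

/-- Equal parameters have equal lifts, so the lifted logarithms agree up to degree `N`; so do the
lifted modules, and the congruence descends along the projection. -/
theorem typicalModule_congr {π : A} (hπ : Irreducible π) {c c' : ℕ → κ} {N : ℕ}
    (h : ∀ i, Nat.card (IsLocalRing.ResidueField A) ^ (i + 1) ≤ N → c i = c' i) :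
    (typicalModule π hπ c).toPowerSeries - (typicalModule π hπ c').toPowerSeries ∈
        high (Fin 2) κ N ∧
      ∀ a, (typicalModule π hπ c).act a - (typicalModule π hπ c').act a ∈ high Unit κ N := by
  obtain ⟨f, hf, hlog⟩ := LiftRing.exists_log hπ fun i => LiftRing.lift A κ (c i)
  obtain ⟨f', hf', hlog'⟩ := LiftRing.exists_log hπ fun i => LiftRing.lift A κ (c' i)
  have hϖ : algebraMap _ (FractionRing (LiftRing A κ)) (algebraMap A (LiftRing A κ) π) ≠ 0 :=
    fun h => hπ.ne_zero (LiftRing.comp_injective A κ (by simpa using h))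
  have key := hlog.congr hlog' (LiftRing.toFractionRing_injective A κ) (hf.sub_mem_high hf' hϖ
    (N := N) (fun i hi => by rw [h i hi]) two_le_card_residueField)
  rw [typicalModule_eq_baseChange_lift hπ c, typicalModule_eq_baseChange_lift hπ c']
  refine ⟨?_, fun a => ?_⟩
  · have := map_mem_high (LiftRing.proj A κ : LiftRing A κ →+* κ) key.1
    rwa [map_sub] at this
  · have := map_mem_high (LiftRing.proj A κ : LiftRing A κ →+* κ) (key.2 a)
    rwa [map_sub] at this

/-- The leading terms of `[π]` when at most one of the classes `c j`, `j < i`, is not zero. -/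
theorem act_uniformizer_leading {π : A} (hπ : Irreducible π) (hκ : algebraMap A κ π = 0)
    {c : ℕ → κ} {a : κ} {h i : ℕ} (hc : ∀ j < i, c j = if j = h then a else 0)
    (ha : h < i ∨ a = 0) :
    (typicalModule π hπ c).act π -
      (PowerSeries.C a * PowerSeries.X ^ Nat.card (IsLocalRing.ResidueField A) ^ (h + 1) +
        PowerSeries.C (c i) *
          PowerSeries.X ^ Nat.card (IsLocalRing.ResidueField A) ^ (i + 1)) ∈
      high Unit κ (Nat.card (IsLocalRing.ResidueField A) ^ (i + 1)) := by
  have hq := two_le_card_residueField (A := A)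
  set q := Nat.card (IsLocalRing.ResidueField A) with hqdef
  have hq0 : ∀ k, q ^ k ≠ 0 := fun k => (pow_pos (by omega) k).ne'
  set s := LiftRing.lift A κ with hs
  obtain ⟨f, hf, hlog⟩ := LiftRing.exists_log hπ fun i => s (c i)
  set ι := algebraMap (LiftRing A κ) (FractionRing (LiftRing A κ)) with hιdef
  rw [← hqdef] at hf
  set F := typicalModule π hπ fun i => s (c i) with hF
  have hmono : ∀ (b : LiftRing A κ) k, PowerSeries.constantCoeff
      (PowerSeries.C b * PowerSeries.X ^ q ^ k) = 0 := fun b k => by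
    rw [map_mul, map_pow, PowerSeries.constantCoeff_X, zero_pow (hq0 k), mul_zero]
  have h1 := hmono (s a) (h + 1)
  have h2 := hmono (s (c i)) (i + 1)
  have hmap : ∀ (b : LiftRing A κ) k, MvPowerSeries.map ι (PowerSeries.C b * PowerSeries.X ^ k) =
      (PowerSeries.C (ι b) * PowerSeries.X ^ k : PowerSeries _) := fun b k => by
    refine (map_mul (PowerSeries.map ι) _ _).trans ?_
    rw [map_pow, PowerSeries.map_C, PowerSeries.map_X]
  have hmap' : ∀ (b : κ) k, MvPowerSeries.map (LiftRing.proj A κ : LiftRing A κ →+* κ)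
      (PowerSeries.C (s b) * PowerSeries.X ^ k) =
      (PowerSeries.C b * PowerSeries.X ^ k : PowerSeries _) := fun b k => by
    refine (map_mul (PowerSeries.map (LiftRing.proj A κ : LiftRing A κ →+* κ)) _ _).trans ?_
    rw [map_pow, PowerSeries.map_C, PowerSeries.map_X]
    change PowerSeries.C (LiftRing.proj A κ (LiftRing.lift A κ b)) * _ = _
    rw [LiftRing.proj_lift]
  -- Here `γ` is the formal sum of the lifts of `a X ^ (q ^ (h+1))` and `c_i X ^ (q ^ (i+1))`, so
  -- that `f(γ)` is the ordinary sum of their logarithms. The required congruence between `π f` and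
  -- `πX + f(γ)` is then exactly Hazewinkel's recursion, read in each degree `q ^ (m+1)` with `m ≤
  -- i`.
  have key := act_uniformizer_sub_mem hπ (LiftRing.toFractionRing_injective A κ)
    (LiftRing.algebraMap_injective A κ) (LiftRing.proj A κ) hκ hf
    (constantCoeff_subst_pair (σ := Unit) h1 h2 F.zero_constantCoeff) (N := q ^ (i + 1)) (by
      change _ - (_ + f.subst (MvPowerSeries.map ι _)) ∈ _
      rw [hlog.pair (τ := Unit) h1 h2, hmap, hmap]
      refine PowerSeries.mem_high.mpr fun n hn => ?_
      rw [map_sub, map_add, PowerSeries.coeff_C_mul, PowerSeries.coeff_C_mul]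
      rw [show PowerSeries.coeff n (PowerSeries.subst (PowerSeries.C (ι (s a)) *
          PowerSeries.X ^ q ^ (h + 1)) f + PowerSeries.subst (PowerSeries.C (ι (s (c i))) *
          PowerSeries.X ^ q ^ (i + 1)) f : PowerSeries _) = _ from map_add (PowerSeries.coeff n) _ _,
        PowerSeries.coeff_comp_C_mul_X_pow _ _ (hq0 _),
        PowerSeries.coeff_comp_C_mul_X_pow _ _ (hq0 _), PowerSeries.coeff_X]
      by_cases hm : ∃ m, n = q ^ m
      · obtain ⟨m, rfl⟩ := hm
        have hmi : m ≤ i + 1 := (Nat.pow_le_pow_iff_right (by omega)).mp hn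
        simp only [Nat.pow_dvd_pow_iff_le_right (show 1 < q by omega)]
        rcases m with _ | m
        · simp [hf.coeff_one]
        · rw [hf.coeff_succ, if_neg
            (Nat.one_lt_pow (Nat.succ_ne_zero m) (show 1 < q by omega)).ne', mul_zero, zero_add, sub_eq_zero]
          -- This uses that the section sends `0` to `0`: vanishing parameters lift to vanishing
          -- ones. The excluded pair `k = 0`, `m = i` is the term of `c i` itself, about which
          -- nothing is assumed.
          have hterm : ∀ k ≤ m, k ≠ 0 ∨ m < i → ι (s (c (m - k))) = if m - k = h then ι (s a) else 0 :=
            fun k hk hk' => by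
              rw [hc _ (by omega)]
              split_ifs <;> simp [hs, LiftRing.lift_zero]
          have hdiv : ∀ k, k ≤ m → q ^ (m + 1) / q ^ (k + 1) = q ^ (m - k) := fun k hk => by
            rw [Nat.pow_div (by omega) (by omega)]
            congr 1
            omega
          -- Only the index `k = m - h` survives in the recursion, and its term is the coefficient
          -- of `f(a X ^ (q ^ (h+1)))`. The set `S` is the full range when `m < i`, and omits `k =
          -- 0` when `m = i`; in the latter case the surviving index can be lost only if `h = i`,
          -- where `ha` forces `a = 0`.
          have hsingle : ∀ S : Finset ℕ, S ⊆ Finset.range (m + 1) → (h ≤ m → m - h ∉ S → a = 0) →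
              (∀ k ∈ S, k ≠ 0 ∨ m < i) →
              ∑ k ∈ S, f.coeff (q ^ k) * ι (s (c (m - k))) ^ q ^ k =
              if h + 1 ≤ m + 1 then f.coeff (q ^ (m + 1) / q ^ (h + 1)) *
                ι (s a) ^ (q ^ (m + 1) / q ^ (h + 1)) else 0 := fun S hS hS' hS0 => by
            have e : ∀ k ∈ S, f.coeff (q ^ k) * ι (s (c (m - k))) ^ q ^ k =
                if k = m - h ∧ h ≤ m then f.coeff (q ^ (m - h)) * ι (s a) ^ q ^ (m - h) else 0 :=
              fun k hk => by
                have hkm := Finset.mem_range.mp (hS hk)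
                rw [hterm k (by omega) (hS0 k hk)]
                split_ifs with h3 h4 h4
                · rw [h4.1]
                · omega
                · omega
                · rw [zero_pow (hq0 k), mul_zero]
            rw [Finset.sum_congr rfl e]
            by_cases hh : h ≤ m
            · rw [if_pos (by omega), hdiv h hh]
              simp only [hh, and_true]
              rw [Finset.sum_ite_eq' S]
              split_ifs with h3
              · rfl
              · rw [hS' hh h3, hs, LiftRing.lift_zero, map_zero, zero_pow (hq0 _), mul_zero]
            · rw [if_neg (by omega)]
              exact Finset.sum_eq_zero fun k _ => if_neg (by omega)
          rcases Nat.lt_or_ge m i with hmi' | hmi'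
          · rw [if_neg (show ¬ i + 1 ≤ m + 1 by omega), add_zero]
            refine hsingle _ subset_rfl (fun h3 h4 => ?_) (fun _ _ => Or.inr hmi')
            exact absurd (Finset.mem_range.mpr (by omega)) h4
          · obtain rfl : m = i := by omega
            rw [if_pos le_rfl, Nat.div_self (pow_pos (by omega) _), Finset.sum_range_succ', pow_zero,
              Nat.sub_zero]
            congr 1
            have := hsingle (Finset.Ico 1 (m + 1)) (fun k hk => by
              simp only [Finset.mem_Ico, Finset.mem_range] at hk ⊢
              omega) (fun h3 h4 => ha.resolve_left fun h5 => h4 (Finset.mem_Ico.mpr (by omega)))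
              (fun k hk => Or.inl (by
                have := Finset.mem_Ico.mp hk
                omega))
            rw [← this, Finset.sum_Ico_eq_sum_range]
            refine Finset.sum_congr rfl fun k _ => ?_
            rw [add_comm 1 k]
      · push Not at hm
        rw [hf.coeff_eq_zero n hm, if_neg (fun e => hm 0 (by rw [e, pow_zero]))]
        have : ∀ (b : FractionRing (LiftRing A κ)) k, (if q ^ k ∣ n then
            f.coeff (n / q ^ k) * b ^ (n / q ^ k) else 0) = 0 := fun b k => by
          split_ifs with hd
          · rw [hf.coeff_eq_zero, zero_mul]
            intro m e
            apply hm (k + m)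
            rw [pow_add, ← e, Nat.mul_div_cancel' hd]
          · rfl
        rw [this, this]
        simp)
  simp only [hs, LiftRing.proj_lift] at key
  have e := map_pair (ι := (LiftRing.proj A κ : LiftRing A κ →+* κ)) (τ := Unit) h1 h2
    F.toPowerSeries
  rw [hmap', hmap'] at e
  have e2 : MvPowerSeries.map (LiftRing.proj A κ : LiftRing A κ →+* κ) F.toPowerSeries =
      (typicalModule π hπ c).toPowerSeries := by
    rw [typicalModule_eq_baseChange_lift hπ c]
    rfl
  rw [e2] at e
  -- The second summand already has order at least `q ^ (i + 1)`, so the formal sum may be replaced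
  -- by the ordinary sum.
  have hadd := formalGroup_pair_sub_add_mem (typicalModule π hπ c).toFormalGroup (τ := Unit)
    (a := (PowerSeries.C a * PowerSeries.X ^ q ^ (h + 1) : PowerSeries κ))
    (c := (PowerSeries.C (c i) * PowerSeries.X ^ q ^ (i + 1) : PowerSeries κ))
    (N := q ^ (i + 1))
    (mem_high_zero_iff.mp (C_mul_X_pow_mem_high _ (pow_pos (by omega) _)))
    (pow_pos (by omega) _) (C_mul_X_pow_mem_high _ (Nat.sub_lt (pow_pos (by omega) _) one_pos))
  rw [← e] at hadd
  have := Ideal.add_mem _ key hadd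
  convert this using 1
  exact (sub_add_sub_cancel _ _ _).symm

end ResidueChar

/-! ### Integrality of the parameters of a `p`-typical formal group law -/

/-- The valuations of `(p ^ n).choose k` and of `k` add up to `n`; for `n = m + 1` and `k = p ^ m`
the binomial coefficient has valuation exactly `1`. This cancels the single factor `p` lost in
Hazewinkel's recursion. -/
theorem PadicInt.exists_mul_choose_prime_pow (p : ℕ) [Fact p.Prime] (m : ℕ) :
    ∃ (t : ℕ) (s : ℤ_[p]), (p ^ (m + 1)).choose (p ^ m) = p * t ∧ s * t = 1 := by
  have hp : p.Prime := Fact.out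
  have h := hp.emultiplicity_choose_prime_pow_add_emultiplicity (n := m + 1) (k := p ^ m)
    (Nat.pow_le_pow_right hp.pos (Nat.le_succ m)) (pow_ne_zero _ hp.ne_zero)
  rw [emultiplicity_pow_self hp.ne_zero hp.prime.not_isUnit] at h
  have h1 : emultiplicity p ((p ^ (m + 1)).choose (p ^ m)) = ((1 : ℕ) : ℕ∞) := by
    have e : (((m + 1 : ℕ) : ℕ) : ℕ∞) = ((1 : ℕ) : ℕ∞) + (m : ℕ∞) := by
      push_cast
      rw [add_comm]
    rw [e] at h
    exact ENat.add_left_injective_of_ne_top (ENat.natCast_ne_top m) h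
  obtain ⟨⟨t, ht⟩, hn⟩ := emultiplicity_eq_coe.mp h1
  rw [pow_one] at ht
  have hcop : ¬ p ∣ t := fun ⟨r, hr⟩ => hn ⟨r, by rw [ht, hr]; ring⟩
  have hu : IsUnit (t : ℤ_[p]) := by
    rw [PadicInt.isUnit_iff]
    refine le_antisymm (PadicInt.norm_le_one _) (not_lt.mp fun hlt => hcop ?_)
    have := (PadicInt.norm_int_lt_one_iff_dvd (p := p) (t : ℤ)).mp (by exact_mod_cast hlt)
    exact_mod_cast this
  obtain ⟨s, hs⟩ := hu.exists_left_inv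
  exact ⟨t, s, ht, hs⟩

theorem PadicInt.card_residueField (p : ℕ) [Fact p.Prime] :
    Nat.card (IsLocalRing.ResidueField ℤ_[p]) = p := by
  rw [Nat.card_congr (PadicInt.residueField (p := p)).toEquiv, Nat.card_zmod]

/-- The parameters `v_{m+1}` of a logarithm, defined by solving Hazewinkel's recursion. -/
noncomputable def hazewinkelParam {L : Type*} [CommRing L] (q : ℕ) (ϖ : L) (f : PowerSeries L) :
    ℕ → L
  | m => ϖ * f.coeff (q ^ (m + 1)) - ∑ j : Fin m,
      f.coeff (q ^ (j.1 + 1)) * hazewinkelParam q ϖ f (m - (j.1 + 1)) ^ q ^ (j.1 + 1)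
decreasing_by exact Nat.sub_lt (lt_of_le_of_lt (Nat.zero_le _) j.2) (Nat.succ_pos _)

theorem isHazewinkelLog_hazewinkelParam {L : Type*} [CommRing L] {q : ℕ} (ϖ : L)
    {f : PowerSeries L} (h1 : f.coeff 1 = 1) (h0 : ∀ j, (∀ m, j ≠ q ^ m) → f.coeff j = 0) :
    IsHazewinkelLog q ϖ (hazewinkelParam q ϖ f) f := by
  refine ⟨h1, h0, fun m => ?_⟩
  rw [Finset.sum_range_succ', pow_zero, pow_one, h1, one_mul, Nat.sub_zero, hazewinkelParam,
    Finset.sum_range]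
  ring

section

variable {R : Type*} [CommRing R]

/-- In the factorisation of `a ^ N - b ^ N`, the factor `a - b` has order at least `2` and the
cofactor has order at least `N - 1`. -/
theorem pow_sub_pow_mem_high_of_le {σ : Type*} {a b : MvPowerSeries σ R}
    (ha : MvPowerSeries.constantCoeff a = 0) (hb : MvPowerSeries.constantCoeff b = 0)
    (hab : a - b ∈ high σ R 1) (N : ℕ) : a ^ N - b ^ N ∈ high σ R N := by
  rw [mem_high, ← (Commute.all a b).mul_geom_sum₂]
  refine le_trans ?_ MvPowerSeries.le_order_mul
  have h1 := mem_high.mp hab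
  rcases N with _ | N
  · rw [Finset.range_zero, Finset.sum_empty, MvPowerSeries.order_zero]
    exact le_trans le_top le_add_self
  have h2 : ∑ i ∈ Finset.range (N + 1), a ^ i * b ^ (N + 1 - 1 - i) ∈
      ({g | (N : ℕ∞) ≤ g.order} : Set (MvPowerSeries σ R)) := by
    rcases N with _ | N
    · simp
    · change _ ∈ high σ R N
      refine Ideal.sum_mem _ fun i hi => ?_
      have hi := Finset.mem_range.mp hi
      refine le_trans ?_ MvPowerSeries.le_order_mul
      refine le_trans ?_ (add_le_add (MvPowerSeries.le_order_pow_of_constantCoeff_eq_zero i ha)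
        (MvPowerSeries.le_order_pow_of_constantCoeff_eq_zero _ hb))
      norm_cast
      omega
  refine le_trans ?_ (add_le_add h1 h2)
  norm_cast
  omega

theorem comp_sub_self_mem_high {σ : Type*} {f : PowerSeries R} (hf0 : f.constantCoeff = 0)
    (hf1 : f.coeff 1 = 1) {a : MvPowerSeries σ R} (ha : MvPowerSeries.constantCoeff a = 0) :
    f.subst a - a ∈ high σ R 1 := by
  have h : f - PowerSeries.X ∈ high Unit R 1 := PowerSeries.mem_high.mpr fun n hn => by
    interval_cases n
    · simp [hf0]
    · simp [hf1]
  have := comp_mem_high ha h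
  rwa [PowerSeries.subst_sub (hasSubst_zero ha), PowerSeries.subst_X (hasSubst_zero ha)] at this

/-- Formal group laws whose logarithms differ by `δ X ^ N` to first order. -/
theorem formalGroup_sub_mem_high {F F' : MvPowerSeries (Fin 2) R} {f f' : PowerSeries R}
    (hF0 : MvPowerSeries.constantCoeff F = 0) (hF0' : MvPowerSeries.constantCoeff F' = 0)
    (hf0 : f.constantCoeff = 0) (hf1 : f.coeff 1 = 1)
    (hf0' : f'.constantCoeff = 0) (hf1' : f'.coeff 1 = 1)
    (hF : f.subst F = f.subst (MvPowerSeries.X 0 : MvPowerSeries (Fin 2) R) +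
      f.subst (MvPowerSeries.X 1 : MvPowerSeries (Fin 2) R))
    (hF' : f'.subst F' = f'.subst (MvPowerSeries.X 0 : MvPowerSeries (Fin 2) R) +
      f'.subst (MvPowerSeries.X 1 : MvPowerSeries (Fin 2) R)) {δ : R} {N : ℕ} (hN : 0 < N)
    (hδ : f - (f' + PowerSeries.C δ * PowerSeries.X ^ N) ∈ high Unit R N) :
    F - (F' + MvPowerSeries.C δ * (MvPowerSeries.X 0 ^ N + MvPowerSeries.X 1 ^ N -
      (MvPowerSeries.X 0 + MvPowerSeries.X 1) ^ N)) ∈ high (Fin 2) R N := by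
  have c0 := MvPowerSeries.constantCoeff_X (R := R) (0 : Fin 2)
  have c1 := MvPowerSeries.constantCoeff_X (R := R) (1 : Fin 2)
  set C : MvPowerSeries (Fin 2) R := MvPowerSeries.C δ * (MvPowerSeries.X 0 ^ N +
    MvPowerSeries.X 1 ^ N - (MvPowerSeries.X 0 + MvPowerSeries.X 1) ^ N) with hC
  have hCmem : C ∈ high (Fin 2) R (N - 1) := by
    have hp : ∀ a : MvPowerSeries (Fin 2) R, MvPowerSeries.constantCoeff a = 0 →
      a ^ N ∈ high (Fin 2) R (N - 1) := fun a ha => pow_mem_high ha (Nat.sub_lt hN one_pos)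
    exact Ideal.mul_mem_left _ _ (Ideal.sub_mem _ (Ideal.add_mem _ (hp _ c0) (hp _ c1))
      (hp _ (by rw [map_add, c0, c1, add_zero])))
  have hC0 := constantCoeff_of_mem_high hCmem
  -- It suffices to compare values of `f'`. From `f ≡ f' + δ X ^ N` applied to `f(F) = f(X) + f(Y)`
  -- one gets `f'(F) + δ F ^ N ≡ f'(F') + δ (X ^ N + Y ^ N)`. Up to degree `N` the power `F ^ N` is
  -- `(X + Y) ^ N`, and adding `C` to `F'` adds `C` to `f'(F')`.
  refine PowerSeries.sub_mem_high_of_comp hf0' hf1' hF0 (by rw [map_add, hF0', hC0, add_zero]) ?_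
  have hE := comp_add_sub_mem hF0' hN hCmem hf1'
  have key : ∀ {a : MvPowerSeries (Fin 2) R}, MvPowerSeries.constantCoeff a = 0 →
      f.subst a - (f'.subst a + MvPowerSeries.C δ * a ^ N) ∈ high (Fin 2) R N := fun {a} ha => by
    have hs := hasSubst_zero ha
    have := comp_mem_high ha hδ
    rwa [PowerSeries.subst_sub hs, PowerSeries.subst_add hs, PowerSeries.subst_mul hs,
      PowerSeries.subst_pow hs, PowerSeries.subst_X hs, PowerSeries.subst_C] at this
  have hlin : F - (MvPowerSeries.X 0 + MvPowerSeries.X 1) ∈ high (Fin 2) R 1 := by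
    have h := Ideal.sub_mem _ (Ideal.add_mem _ (comp_sub_self_mem_high hf0 hf1 c0)
      (comp_sub_self_mem_high hf0 hf1 c1)) (comp_sub_self_mem_high hf0 hf1 hF0)
    rw [hF] at h
    convert h using 1
    ring
  have hpow := pow_sub_pow_mem_high_of_le hF0 (by rw [map_add, c0, c1, add_zero]) hlin N
  have := Ideal.sub_mem _ (Ideal.sub_mem _ (Ideal.sub_mem _ (Ideal.add_mem _ (key c0) (key c1))
    (key hF0)) (Ideal.mul_mem_left _ (MvPowerSeries.C δ) hpow)) hE
  rw [hF, hF'] at this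
  convert this using 1
  rw [hC]
  ring

end

/-- Every formal group law over a torsion-free `ℤ_p`-algebra with a `p`-typical logarithm arises
from Hazewinkel's generators. -/
theorem exists_isHazewinkelLog_of_typical (p : ℕ) [Fact p.Prime] {R : Type*} [CommRing R]
    [Algebra ℤ_[p] R] {L : Type*} [Field L] {ι : R →+* L}
    (hR : Function.Injective (ι.comp (algebraMap ℤ_[p] R))) {f : PowerSeries L}
    (h1 : f.coeff 1 = 1) (h0 : ∀ j, (∀ m, j ≠ p ^ m) → f.coeff j = 0)
    {F : MvPowerSeries (Fin 2) R} (hF0 : MvPowerSeries.constantCoeff F = 0)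
    (hF : f.subst (MvPowerSeries.map ι F) =
      f.subst (MvPowerSeries.X 0 : MvPowerSeries (Fin 2) L) +
        f.subst (MvPowerSeries.X 1 : MvPowerSeries (Fin 2) L)) :
    ∃ c : ℕ → R, IsHazewinkelLog p (ι (algebraMap ℤ_[p] R p)) (fun i => ι (c i)) f := by
  have hp : p.Prime := Fact.out
  set ϖ := ι (algebraMap ℤ_[p] R p) with hϖdef
  have hϖ : ϖ ≠ 0 := fun h => PadicInt.irreducible_p.ne_zero (hR (by
    rw [map_zero]
    exact h))
  -- Over the field `L` the recursion can always be solved for the parameters; the content is that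
  -- the solution lies in `R`.
  set w := hazewinkelParam p ϖ f with hw
  have hH := isHazewinkelLog_hazewinkelParam ϖ h1 h0
  suffices H : ∀ m, ∃ x, ι x = w m by
    choose c hc using H
    exact ⟨c, by simpa only [hc] using hH⟩
  intro m
  induction m using Nat.strong_induction_on with
  | _ m ih =>
    choose! x hx using ih
    -- The parameters known to be integral, truncated by zero, define an integral law `F'`. Its
    -- logarithm agrees with `f` below degree `N = p ^ (m+1)`, and the difference `δ` in degree `N`
    -- satisfies `p δ = w m` since the missing parameter is the only discrepancy.
    set c' : ℕ → R := fun i => if i < m then x i else 0 with hc'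
    obtain ⟨f', hf', hlog⟩ := exists_log_typicalModule hR (p : ℤ_[p]) PadicInt.irreducible_p c'
    rw [PadicInt.card_residueField] at hf'
    set F' := (typicalModule (p : ℤ_[p]) PadicInt.irreducible_p c').toPowerSeries
    set N := p ^ (m + 1) with hN
    set δ := f.coeff N - f'.coeff N with hδ
    have hcw : ∀ i < m, w i = ι (c' i) := fun i hi => by rw [hc', ← hx i hi]; simp [hi]
    have hco : ∀ k ≤ m, f.coeff (p ^ k) = f'.coeff (p ^ k) := fun k hk =>
      hH.coeff_congr hf' hϖ hcw hk
    have hwδ : ϖ * δ = w m := by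
      rw [hδ, mul_sub, hN, hH.coeff_succ, hf'.coeff_succ, Finset.sum_range_succ',
        Finset.sum_range_succ' _ m, Finset.sum_congr rfl fun j hj => by
          have := Finset.mem_range.mp hj
          rw [hco (j + 1) (by omega), ← hw, hcw _ (by omega)]]
      simp [h1, hf'.coeff_one, hc', hw]
    have hdiff : f - (f' + PowerSeries.C δ * PowerSeries.X ^ N) ∈ high Unit L N := by
      refine PowerSeries.mem_high.mpr fun n hn => ?_
      rw [map_sub, map_add, PowerSeries.coeff_C_mul, PowerSeries.coeff_X_pow]
      by_cases hj : ∃ k, n = p ^ k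
      · obtain ⟨k, rfl⟩ := hj
        have hk : k ≤ m + 1 := (Nat.pow_le_pow_iff_right hp.one_lt).mp hn
        rcases hk.lt_or_eq with hk | rfl
        · rw [if_neg (fun e => hk.ne (Nat.pow_right_injective hp.two_le e)), hco k (by omega)]
          ring
        · rw [if_pos rfl, hδ]
          ring
      · push Not at hj
        rw [hH.coeff_eq_zero n hj, hf'.coeff_eq_zero n hj, if_neg (hj _)]
        ring
    have key := formalGroup_sub_mem_high (constantCoeff_map (ι := ι) hF0)
      (constantCoeff_map (ι := ι)
        (typicalModule (p : ℤ_[p]) PadicInt.irreducible_p c').zero_constantCoeff)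
      (hH.constantCoeff_eq hp.two_le) h1 hlog.constantCoeff_eq hlog.coeff_one hF hlog.map_group
      (pow_pos hp.pos _) hdiff
    -- The coefficient of `X ^ k Y ^ (N - k)` with `k = p ^ m` in `F - F'` is `-δ (N.choose k) = -δ
    -- p t = -t w_m`. It is integral and `t` is a unit of `ℤ_p`, so `w_m` is integral.
    obtain ⟨t, s, ht, hs⟩ := PadicInt.exists_mul_choose_prime_pow p m
    set k := p ^ m with hk
    have hkpos : 0 < k := pow_pos hp.pos _
    have hkN : k < N := Nat.pow_lt_pow_right hp.one_lt (Nat.lt_succ_self m)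
    set d : Fin 2 →₀ ℕ := Finsupp.single 0 k + Finsupp.single 1 (N - k) with hd
    have hd0 : d 0 = k := by simp [hd]
    have hd1 : d 1 = N - k := by simp [hd]
    have hdeg : d.degree ≤ N := by
      rw [hd, map_add, Finsupp.degree_single, Finsupp.degree_single]
      omega
    have hcoef := coeff_of_mem_high key hdeg
    have hchoose : MvPowerSeries.coeff d
        ((MvPowerSeries.X 0 + MvPowerSeries.X 1 : MvPowerSeries (Fin 2) L) ^ N) =
          (N.choose k : L) := by
      have h := PowerSeries.coeff_subst_X_zero_add_X_one (R := L) (PowerSeries.X ^ N) d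
      have hs : PowerSeries.HasSubst
          (MvPowerSeries.X 0 + MvPowerSeries.X 1 : MvPowerSeries (Fin 2) L) :=
        hasSubst_zero (by simp)
      rw [PowerSeries.subst_pow hs, PowerSeries.subst_X hs, hd0, hd1, Nat.add_sub_cancel' hkN.le,
        PowerSeries.coeff_X_pow, if_pos rfl, mul_one] at h
      exact h
    have hX : ∀ i : Fin 2, MvPowerSeries.coeff d
        (MvPowerSeries.X i ^ N : MvPowerSeries (Fin 2) L) = 0 := fun i => by
      rw [MvPowerSeries.coeff_X_pow, if_neg]
      intro e
      have e0 := DFunLike.congr_fun e 0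
      have e1 := DFunLike.congr_fun e 1
      rw [hd0] at e0
      rw [hd1] at e1
      fin_cases i <;> simp at e0 e1 <;> omega
    rw [map_sub, map_add, MvPowerSeries.coeff_C_mul, map_sub, map_add, hX, hX, hchoose,
      MvPowerSeries.coeff_map, MvPowerSeries.coeff_map, ht] at hcoef
    have hϖp : ϖ = (p : L) := by rw [hϖdef, map_natCast, map_natCast]
    have hst : ι (algebraMap ℤ_[p] R s) * (t : L) = 1 := by
      have := congrArg (fun z => ι (algebraMap ℤ_[p] R z)) hs
      simpa using this
    refine ⟨algebraMap ℤ_[p] R s * (MvPowerSeries.coeff d F' - MvPowerSeries.coeff d F), ?_⟩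
    rw [map_mul, map_sub, ← hwδ, hϖp]
    push_cast at hcoef
    linear_combination (-ι (algebraMap ℤ_[p] R s)) * hcoef + (p : L) * δ * hst

/-- Base change of an isomorphism of formal modules. -/
noncomputable def FormalModule.Iso.baseChange {A R S : Type*} [CommRing A] [CommRing R]
    [CommRing S] [Algebra A R] [Algebra A S] {G H : FormalModule A R} (φ : Iso G H)
    (ρ : R →ₐ[A] S) : Iso (G.baseChange ρ) (H.baseChange ρ) where
  toSeries := PowerSeries.map (ρ : R →+* S) φ.toSeries
  constantCoeff_eq := constantCoeff_map' φ.constantCoeff_eq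
  isUnit_coeff_one := by
    rw [PowerSeries.coeff_map]
    exact φ.isUnit_coeff_one.map _
  map_group := by
    have c0 := MvPowerSeries.constantCoeff_X (R := R) (0 : Fin 2)
    have c1 := MvPowerSeries.constantCoeff_X (R := R) (1 : Fin 2)
    have h := congrArg (MvPowerSeries.map (ρ : R →+* S)) φ.map_group
    rw [map_comp G.zero_constantCoeff, map_pair (constantCoeff_comp c0 φ.constantCoeff_eq)
      (constantCoeff_comp c1 φ.constantCoeff_eq), map_comp c0, map_comp c1, MvPowerSeries.map_X,
      MvPowerSeries.map_X] at h
    exact h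
  map_act a := by
    have h := congrArg (MvPowerSeries.map (ρ : R →+* S)) (φ.map_act a)
    rw [map_comp (G.act_constantCoeff a), map_comp φ.constantCoeff_eq] at h
    exact h

/-! ### A coordinate change between `p`-typical formal modules -/

section Step

variable {p : ℕ} [Fact p.Prime]

theorem constantCoeff_C_mul_X_pow {R : Type*} [CommRing R] (b : R) {k : ℕ} (hk : k ≠ 0) :
    (PowerSeries.C b * PowerSeries.X ^ k : PowerSeries R).constantCoeff = 0 := by
  rw [map_mul, map_pow, PowerSeries.constantCoeff_X, zero_pow hk, mul_zero]

/-- The change of coordinates `X ↦ F(X, b X ^ (p ^ m))` transforms a `p`-typical formal module into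
a `p`-typical formal module. -/
theorem exists_iso_typicalModule {κ : Type*} [CommRing κ] [Algebra ℤ_[p] κ] (c : ℕ → κ) (b : κ)
    {m : ℕ} (hm : 0 < m) : ∃ (c' : ℕ → κ)
      (ψ : Iso (typicalModule (p : ℤ_[p]) PadicInt.irreducible_p c')
        (typicalModule (p : ℤ_[p]) PadicInt.irreducible_p c)),
      ψ.toSeries = (typicalModule (p : ℤ_[p]) PadicInt.irreducible_p c).toPowerSeries.subst
        ![PowerSeries.X, (PowerSeries.C b * PowerSeries.X ^ p ^ m : PowerSeries κ)] := by
  have hp : p.Prime := Fact.out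
  have hpm : p ^ m ≠ 0 := (pow_pos hp.pos m).ne'
  have hpm1 : 1 < p ^ m := Nat.one_lt_pow hm.ne' hp.one_lt
  set s := LiftRing.lift ℤ_[p] κ with hs
  obtain ⟨f, hf, hlog⟩ := LiftRing.exists_log PadicInt.irreducible_p fun i => s (c i)
  rw [PadicInt.card_residueField] at hf
  have hι := LiftRing.toFractionRing_injective ℤ_[p] κ
  have hιA := LiftRing.comp_injective ℤ_[p] κ
  set ι := algebraMap (LiftRing ℤ_[p] κ) (FractionRing (LiftRing ℤ_[p] κ)) with hιdef
  set M := typicalModule (p : ℤ_[p]) PadicInt.irreducible_p fun i => s (c i) with hM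
  set Y : PowerSeries (LiftRing ℤ_[p] κ) := PowerSeries.C (s b) * PowerSeries.X ^ p ^ m with hY
  have hX0 : MvPowerSeries.constantCoeff (PowerSeries.X : PowerSeries (LiftRing ℤ_[p] κ)) = 0 :=
    PowerSeries.constantCoeff_X
  have hY0 : MvPowerSeries.constantCoeff Y = 0 := constantCoeff_C_mul_X_pow _ hpm
  have hYmem : Y ∈ high Unit (LiftRing ℤ_[p] κ) 1 := C_mul_X_pow_mem_high _ hpm1
  set ψ : PowerSeries (LiftRing ℤ_[p] κ) := M.toPowerSeries.subst ![PowerSeries.X, Y] with hψ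
  have hψ0 : ψ.constantCoeff = 0 := constantCoeff_subst_pair hX0 hY0 M.zero_constantCoeff
  have hψ1 : ψ.coeff 1 = 1 := by
    have h := formalGroup_pair_sub_add_mem M.toFormalGroup hX0 one_pos
      (high_mono (Nat.sub_le 1 1) hYmem)
    have h2 := Ideal.add_mem _ h hYmem
    have h3 : ψ - PowerSeries.X ∈ high Unit (LiftRing ℤ_[p] κ) 1 := by
      convert h2 using 1
      rw [hψ]
      ring
    have := PowerSeries.mem_high.mp h3 1 le_rfl
    rwa [map_sub, PowerSeries.coeff_one_X, sub_eq_zero] at this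
  have hψ1' : IsUnit (ψ.coeff 1) := by rw [hψ1]; exact isUnit_one
  have hψ0' := constantCoeff_map' (ι := ι) hψ0
  have hYmap : MvPowerSeries.map ι Y =
      (PowerSeries.C (ι (s b)) * PowerSeries.X ^ p ^ m : PowerSeries _) := by
    refine (map_mul (PowerSeries.map ι) _ _).trans ?_
    rw [map_pow, PowerSeries.map_C, PowerSeries.map_X]
  -- The logarithm turns the formal sum into `f(X) + f(b X ^ (p ^ m))`, again supported on powers of
  -- `p`. This is why the coordinate change is made with the formal sum and not with `X + b X ^ (p ^
  -- m)`.
  have hfψ : f.subst (PowerSeries.map ι ψ) =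
      f + f.subst (PowerSeries.C (ι (s b)) * PowerSeries.X ^ p ^ m : PowerSeries _) := by
    have := hlog.pair hX0 hY0
    rw [hYmap] at this
    refine this.trans (congrArg (· + _) ?_)
    have e : MvPowerSeries.map ι (PowerSeries.X : PowerSeries (LiftRing ℤ_[p] κ)) =
      (PowerSeries.X : PowerSeries _) := PowerSeries.map_X _
    rw [e]
    exact PowerSeries.X_subst _
  -- the transported formal group law
  obtain ⟨χ, hχ0, -, hχ, -⟩ := PowerSeries.exists_inverse hψ0 hψ1'
  have c0 := MvPowerSeries.constantCoeff_X (R := LiftRing ℤ_[p] κ) (0 : Fin 2)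
  have c1 := MvPowerSeries.constantCoeff_X (R := LiftRing ℤ_[p] κ) (1 : Fin 2)
  have k0 := constantCoeff_comp c0 hψ0
  have k1 := constantCoeff_comp c1 hψ0
  have k2 := constantCoeff_subst_pair k0 k1 M.zero_constantCoeff
  have k3 := constantCoeff_comp k2 hχ0
  -- The series `f(ψ)` is a logarithm of `χ(F(ψ(X), ψ(Y)))` with `χ` the inverse of `ψ`. This law is
  -- integral, hence so are its parameters.
  obtain ⟨c', hc'⟩ := exists_isHazewinkelLog_of_typical p (ι := ι) hιA
    (f := f.subst (PowerSeries.map ι ψ)) (by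
      rw [Iso.coeff_one_comp _ _ hψ0', hf.coeff_one, PowerSeries.coeff_map, hψ1, map_one, mul_one])
    (fun j hj => by
      rw [hfψ]
      refine (map_add (PowerSeries.coeff j) _ _).trans ?_
      rw [hf.coeff_eq_zero j hj, PowerSeries.coeff_comp_C_mul_X_pow _ _ hpm, zero_add]
      split_ifs with hd
      · rw [hf.coeff_eq_zero, zero_mul]
        intro i e
        apply hj (m + i)
        rw [pow_add, ← e, Nat.mul_div_cancel' hd]
      · rfl) k3 (by
      rw [comp_comp hψ0' (constantCoeff_map k3),
        comp_comp hψ0' (MvPowerSeries.constantCoeff_X 0),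
        comp_comp hψ0' (MvPowerSeries.constantCoeff_X 1), ← map_comp k3,
        ← comp_comp hχ0 k2, hχ, PowerSeries.subst_X (hasSubst_zero k2), hlog.pair k0 k1,
        map_comp c0, map_comp c1, MvPowerSeries.map_X, MvPowerSeries.map_X])
  have hlog' : IsLogarithm ι (typicalModule (p : ℤ_[p]) PadicInt.irreducible_p c')
      (f.subst (PowerSeries.map ι ψ)) :=
    IsHazewinkelLog.isLogarithm hιA PadicInt.irreducible_p (by
      rw [PadicInt.card_residueField]
      exact hc')
  refine ⟨fun i => LiftRing.proj ℤ_[p] κ (c' i), ?_⟩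
  rw [← typicalModule_baseChange, typicalModule_eq_baseChange_lift PadicInt.irreducible_p c]
  refine ⟨(hlog.iso hι hψ0 hψ1' hlog').baseChange (LiftRing.proj ℤ_[p] κ), ?_⟩
  change MvPowerSeries.map _ ψ = _
  rw [hψ, map_pair hX0 hY0]
  have e1 : MvPowerSeries.map (LiftRing.proj ℤ_[p] κ : LiftRing ℤ_[p] κ →+* κ)
      (PowerSeries.X : PowerSeries (LiftRing ℤ_[p] κ)) = (PowerSeries.X : PowerSeries κ) :=
    PowerSeries.map_X _
  have e2 : MvPowerSeries.map (LiftRing.proj ℤ_[p] κ : LiftRing ℤ_[p] κ →+* κ) Y =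
      (PowerSeries.C b * PowerSeries.X ^ p ^ m : PowerSeries κ) := by
    refine (map_mul (PowerSeries.map _) _ _).trans ?_
    rw [map_pow, PowerSeries.map_C, PowerSeries.map_X]
    change PowerSeries.C (LiftRing.proj ℤ_[p] κ (LiftRing.lift ℤ_[p] κ b)) * _ = _
    rw [LiftRing.proj_lift]
  rw [e1, e2]
  rfl

variable {κ : Type*} [Field κ] [Algebra ℤ_[p] κ]

theorem charP_of_algebraMap_eq_zero (hκ : algebraMap ℤ_[p] κ p = 0) : CharP κ p := by
  rw [map_natCast] at hκ
  exact ringChar.of_eq (CharP.ringChar_of_prime_eq_zero Fact.out hκ)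

end Step

/-! ### Effect of the coordinate change on the parameters -/

section Compare

variable {p : ℕ} [Fact p.Prime] {κ : Type*} [Field κ] [Algebra ℤ_[p] κ]

theorem exists_pow_sub_self_add_eq_zero [IsAlgClosed κ] {Q : ℕ} (hQ : 1 < Q) (c : κ) :
    ∃ b : κ, b ^ Q - b + c = 0 := by
  have hdeg : (Polynomial.X ^ Q - Polynomial.X + Polynomial.C c : Polynomial κ).natDegree = Q := by
    rw [Polynomial.natDegree_add_C]
    exact FiniteField.X_pow_card_sub_X_natDegree_eq κ hQ
  obtain ⟨b, hb⟩ := IsAlgClosed.exists_root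
    (Polynomial.X ^ Q - Polynomial.X + Polynomial.C c : Polynomial κ) fun h => by
      rw [Polynomial.natDegree_eq_zero_iff_degree_le_zero.mpr h.le] at hdeg
      omega
  exact ⟨b, by simpa using hb⟩

/-- The effect on `[p]` of the change of coordinates `X ↦ F(X, b X ^ (p ^ m))`. -/
theorem typicalModule_param_of_iso (hκ : algebraMap ℤ_[p] κ p = 0) {g m : ℕ} (hm : 0 < m)
    {c c' : ℕ → κ} {b : κ} (hc : ∀ i < g + m, c i = if i = g then 1 else 0)
    (hb : b ^ p ^ (g + 1) - b + c (g + m) = 0)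
    {M M' : FormalModule ℤ_[p] κ} (hM : M = typicalModule (p : ℤ_[p]) PadicInt.irreducible_p c)
    (hM' : M' = typicalModule (p : ℤ_[p]) PadicInt.irreducible_p c') (ψ : Iso M' M)
    (hψ : ψ.toSeries = M.toPowerSeries.subst
        ![PowerSeries.X, (PowerSeries.C b * PowerSeries.X ^ p ^ m : PowerSeries κ)]) :
    ∀ i ≤ g + m, c' i = if i = g then 1 else 0 := by
  have hp : p.Prime := Fact.out
  have hpos : ∀ k, 0 < p ^ k := fun k => pow_pos hp.pos k
  have hlt : ∀ {k l}, k < l → p ^ k < p ^ l := fun h => Nat.pow_lt_pow_right hp.one_lt h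
  have hle : ∀ {k l}, k ≤ l → p ^ k ≤ p ^ l := fun h => Nat.pow_le_pow_right hp.pos h
  have := charP_of_algebraMap_eq_zero hκ
  have : CharP (PowerSeries κ) p := charP_of_injective_ringHom PowerSeries.C_injective p
  have hb' : c (g + m) + b ^ p ^ (g + 1) = b := by linear_combination hb
  set T := p ^ (g + m + 1) with hT
  set Y : PowerSeries κ := PowerSeries.C b * PowerSeries.X ^ p ^ m with hY
  set D := M'.act (p : ℤ_[p]) with hD
  have hX0 : MvPowerSeries.constantCoeff (PowerSeries.X : PowerSeries κ) = 0 :=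
    PowerSeries.constantCoeff_X
  have hY0 : MvPowerSeries.constantCoeff Y = 0 := constantCoeff_C_mul_X_pow _ (hpos m).ne'
  have hD0 : MvPowerSeries.constantCoeff D = 0 := M'.act_constantCoeff _
  have hP0 : (M.act (p : ℤ_[p])).constantCoeff = 0 := M.act_constantCoeff _
  have hP := act_uniformizer_leading PadicInt.irreducible_p hκ (c := c) (a := 1) (h := g)
    (i := g + m) hc (Or.inl (by omega))
  rw [PadicInt.card_residueField, ← hM, ← hT, map_one, one_mul] at hP
  -- the left-hand side
  set B : PowerSeries κ := PowerSeries.C b * D ^ p ^ m with hB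
  have hlhs : ψ.toSeries.subst D = M.toPowerSeries.subst ![D, B] := by
    rw [hψ]
    change MvPowerSeries.subst (fun _ => D) (M.toPowerSeries.subst ![PowerSeries.X, Y]) = _
    rw [subst_pair_subst hX0 hY0 (hasSubst_zero hD0).const]
    have hs := hasSubst_zero hD0
    have e1 : MvPowerSeries.subst (fun _ => D) (PowerSeries.X : PowerSeries κ) = D :=
      PowerSeries.subst_X hs
    have e2 : MvPowerSeries.subst (fun _ => D) Y = B := by
      change PowerSeries.subst D Y = B
      rw [hY, PowerSeries.subst_mul hs, PowerSeries.subst_pow hs, PowerSeries.subst_X hs,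
        PowerSeries.subst_C]
      rfl
    rw [e1, e2]
  -- the right-hand side
  have hYT : Y ^ T ∈ high Unit κ T := by
    have h1 : Y ∈ high Unit κ 1 := C_mul_X_pow_mem_high _ (Nat.one_lt_pow hm.ne' hp.one_lt)
    refine pow_mem_high_of_mem h1 ?_
    have := hpos (g + m + 1)
    omega
  set Z : PowerSeries κ := PowerSeries.C (b ^ p ^ (g + 1)) * PowerSeries.X ^ T with hZ
  have hYg : Y ^ p ^ (g + 1) = Z := by
    rw [hY, hZ, mul_pow, ← pow_mul, ← pow_add, map_pow, hT]
    congr 3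
    omega
  have hPY : (M.act (p : ℤ_[p])).subst Y - Z ∈ high Unit κ T := by
    have h := comp_mem_high hY0 hP
    have hs := hasSubst_zero hY0
    rw [PowerSeries.subst_sub hs, PowerSeries.subst_add hs, PowerSeries.subst_mul hs,
      PowerSeries.subst_pow hs, PowerSeries.subst_pow hs, PowerSeries.subst_X hs,
      PowerSeries.subst_C, hYg] at h
    have := Ideal.add_mem _ h (Ideal.mul_mem_left _ (MvPowerSeries.C (c (g + m))) hYT)
    convert this using 1
    ring
  have hZmem : Z ∈ high Unit κ (T - 1) := C_mul_X_pow_mem_high _ (Nat.sub_lt (hpos _) one_pos)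
  have hPYmem : (M.act (p : ℤ_[p])).subst Y ∈ high Unit κ (T - 1) := by
    have := Ideal.add_mem _ (high_mono (Nat.sub_le T 1) hPY) hZmem
    rwa [sub_add_cancel] at this
  have hrhs : (M.act (p : ℤ_[p])).subst ψ.toSeries - (PowerSeries.X ^ p ^ (g + 1) +
      PowerSeries.C b * PowerSeries.X ^ T) ∈ high Unit κ T := by
    have e : (M.act (p : ℤ_[p])).subst ψ.toSeries =
        M.toPowerSeries.subst ![M.act (p : ℤ_[p]), (M.act (p : ℤ_[p])).subst Y] := by
      rw [hψ]
      refine (hom_pair hX0 hY0 M.zero_constantCoeff hP0 (M.act_hom _)).trans ?_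
      congr 2
      exact PowerSeries.X_subst _
    rw [e]
    have h := formalGroup_pair_sub_add_mem M.toFormalGroup (τ := Unit) hP0 (hpos _) hPYmem
    have := Ideal.add_mem _ (Ideal.add_mem _ h hP) hPY
    convert this using 1
    have eC : (PowerSeries.C b : PowerSeries κ) =
        PowerSeries.C (c (g + m)) + PowerSeries.C (b ^ p ^ (g + 1)) := by rw [← map_add, hb']
    rw [hZ, eC]
    ring
  -- In `ψ([p]) = [p](ψ)`, with `D` the series `[p]` of the source, the left side is the formal sum
  -- of `D` and `b D ^ (p ^ m)`. The right side is the formal sum of `[p](X)` and `[p](Y)`, which by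
  -- the equation for `b` is `X ^ (p ^ (g+1)) + b X ^ T` up to degree `T`. The leading terms of `D`,
  -- hence the parameters `c'`, are read off degree by degree.
  have hmain := ψ.map_act (p : ℤ_[p])
  rw [← hD, hlhs] at hmain
  rw [← hmain] at hrhs
  intro i
  induction i using Nat.strong_induction_on with
  | _ i ih =>
    intro hi
    set N := p ^ (i + 1) with hN
    have hNT : N ≤ T := hle (by omega)
    -- The value of the parameter of index `g` once induction has reached it. Before that no
    -- parameter is nonzero, and `a` must be `0` to satisfy the hypotheses on leading terms.
    set a : κ := if g < i then 1 else 0 with ha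
    have hDi := act_uniformizer_leading PadicInt.irreducible_p hκ (c := c') (a := a) (h := g)
      (i := i) (fun j hj => by
        rw [ih j hj (by omega), ha]
        split_ifs <;> first | rfl | omega) (by
        rw [ha]
        by_cases h : g < i
        · exact Or.inl h
        · exact Or.inr (if_neg h))
    rw [PadicInt.card_residueField, ← hM', ← hD, ← hN] at hDi
    have hr := high_mono hNT hrhs
    rcases hi.lt_or_eq with hi' | hi'
    · -- a degree in which the correction term does not contribute
      have hDmem : D ∈ high Unit κ (p ^ (min g i + 1) - 1) := by
        have h1 : PowerSeries.C a * PowerSeries.X ^ p ^ (g + 1) ∈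
            high Unit κ (p ^ (min g i + 1) - 1) :=
          C_mul_X_pow_mem_high _ (lt_of_lt_of_le (Nat.sub_lt (hpos _) one_pos) (hle (by omega)))
        have h2 : PowerSeries.C (c' i) * PowerSeries.X ^ N ∈
            high Unit κ (p ^ (min g i + 1) - 1) :=
          C_mul_X_pow_mem_high _ (lt_of_lt_of_le (Nat.sub_lt (hpos _) one_pos) (hle (by omega)))
        have h3 := high_mono ((Nat.sub_le _ 1).trans (hle (by omega) :
          p ^ (min g i + 1) ≤ p ^ (i + 1))) hDi
        have := Ideal.add_mem _ h3 (Ideal.add_mem _ h1 h2)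
        rwa [sub_add_cancel] at this
      -- The order of `D ^ (p ^ m)` is at least `p ^ (min g i + 1 + m)`. This exceeds `p ^ (i + 1)`
      -- because `m > 0` and `i < g + m`.
      have hBmem : B ∈ high Unit κ N := by
        refine Ideal.mul_mem_left _ _ (pow_mem_high_of_mem hDmem ?_)
        rw [Nat.sub_add_cancel (hpos _), ← pow_add]
        exact hlt (by omega)
      have h := formalGroup_pair_sub_add_mem M.toFormalGroup (τ := Unit) hD0 (hpos _)
        (high_mono (Nat.sub_le N 1) hBmem)
      have h4 := Ideal.sub_mem _ (Ideal.add_mem _ (Ideal.add_mem _ h hBmem) hDi) hr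
      have h5 : PowerSeries.X ^ p ^ (g + 1) + PowerSeries.C b *
          PowerSeries.X ^ T - (PowerSeries.C a * PowerSeries.X ^ p ^ (g + 1) +
            PowerSeries.C (c' i) * PowerSeries.X ^ N) ∈ high Unit κ N := by
        convert h4 using 1
        ring
      have h6 := PowerSeries.mem_high.mp h5 N le_rfl
      have hinj : N = p ^ (g + 1) ↔ i = g := by
        rw [hN, Nat.pow_right_inj hp.two_le]
        omega
      rw [map_sub, map_add, map_add, PowerSeries.coeff_C_mul, PowerSeries.coeff_C_mul,
        PowerSeries.coeff_C_mul, PowerSeries.coeff_X_pow, PowerSeries.coeff_X_pow,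
        PowerSeries.coeff_X_pow, if_pos rfl, if_neg (hlt (by omega) : N < T).ne] at h6
      simp only [hinj] at h6
      by_cases hig : i = g
      · simp only [hig, ha, lt_irrefl, if_true, if_false] at h6 ⊢
        linear_combination -h6
      · simp only [hig, if_false] at h6 ⊢
        linear_combination -h6
    · have hTN : T = N := by rw [hT, hN, hi']
      have ha1 : a = 1 := if_pos (by omega)
      rw [← hTN] at hDi hr
      rw [ha1, map_one, one_mul] at hDi
      set E := D - PowerSeries.X ^ p ^ (g + 1) with hE
      have hEmem : E ∈ high Unit κ (p ^ (g + 1)) := by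
        have h1 : PowerSeries.C (c' i) * PowerSeries.X ^ T ∈ high Unit κ (p ^ (g + 1)) :=
          C_mul_X_pow_mem_high _ (hlt (by omega))
        have := Ideal.add_mem _ (high_mono (hle (by omega) : p ^ (g + 1) ≤ T) hDi) h1
        convert this using 1
        rw [hE]
        ring
      -- In the last degree the correction does matter. The `p ^ m`-th power is additive in
      -- characteristic `p`, so `b D ^ (p ^ m)` equals `b X ^ T` up to degree `T`; this cancels the
      -- same term on the right side and leaves `c' (g + m) = 0`.
      have hDpow : D ^ p ^ m - PowerSeries.X ^ T ∈ high Unit κ T := by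
        have e : D ^ p ^ m - PowerSeries.X ^ T = E ^ p ^ m := by
          rw [hE, sub_pow_char_pow, ← pow_mul, ← pow_add, hT]
          congr 3
          omega
        rw [e]
        refine pow_mem_high_of_mem hEmem ?_
        calc T = p ^ (g + 1) * p ^ m := by rw [hT, ← pow_add]; congr 1; omega
          _ < (p ^ (g + 1) + 1) * p ^ m := Nat.mul_lt_mul_of_pos_right (Nat.lt_succ_self _) (hpos m)
      have hB' : B - PowerSeries.C b * PowerSeries.X ^ T ∈ high Unit κ T := by
        rw [hB, ← mul_sub]
        exact Ideal.mul_mem_left _ _ hDpow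
      have hBmem : B ∈ high Unit κ (T - 1) := by
        have := Ideal.add_mem _ (high_mono (Nat.sub_le T 1) hB') (C_mul_X_pow_mem_high b
          (Nat.sub_lt (hpos _) one_pos : T - 1 < T))
        rwa [sub_add_cancel] at this
      have h := formalGroup_pair_sub_add_mem M.toFormalGroup (τ := Unit) hD0 (hpos _) hBmem
      have h4 := Ideal.sub_mem _ (Ideal.add_mem _ (Ideal.add_mem _ h hB') hDi) hr
      have h5 : PowerSeries.C b * PowerSeries.X ^ T -
          (PowerSeries.C b * PowerSeries.X ^ T + PowerSeries.C (c' i) * PowerSeries.X ^ T) ∈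
          high Unit κ T := by
        convert h4 using 1
        ring
      have h6 := PowerSeries.mem_high.mp h5 T le_rfl
      simp only [map_sub, map_add, PowerSeries.coeff_C_mul, PowerSeries.coeff_X_pow, if_true] at h6
      rw [if_neg (by omega)]
      linear_combination -h6

end Compare

/-- The limit of a sequence of isomorphisms of formal modules which converges coefficientwise, for
a convergent sequence of sources. -/
theorem FormalModule.exists_iso_of_limit {A R : Type*} [CommRing A] [CommRing R] [Algebra A R]
    {G H : FormalModule A R} {K : ℕ → FormalModule A R} (φ : ∀ m, Iso (K m) G)
    (h1 : ∀ m, (φ m).toSeries.coeff 1 = 1)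
    (hφ : ∀ m, (φ (m + 1)).toSeries - (φ m).toSeries ∈ high Unit R m)
    (hK : ∀ m, (K m).toPowerSeries - H.toPowerSeries ∈ high (Fin 2) R m)
    (hK' : ∀ m a, (K m).act a - H.act a ∈ high Unit R m) :
    ∃ ψ : Iso H G, ψ.IsStrict := by
  -- The diagonal is the limit, since the `n`-th coefficient of `φ m` no longer changes once `m ≥
  -- n`.
  set ψ : PowerSeries R := PowerSeries.mk fun n => (φ n).toSeries.coeff n with hψ
  have hstable : ∀ m k n, n ≤ m → (φ (m + k)).toSeries.coeff n = (φ m).toSeries.coeff n := by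
    intro m k n hn
    induction k with
    | zero => rfl
    | succ k ih =>
      have := PowerSeries.mem_high.mp (hφ (m + k)) n (by omega)
      rw [map_sub, sub_eq_zero] at this
      rw [← ih, ← this, add_assoc]
  have hlim : ∀ m, ψ - (φ m).toSeries ∈ high Unit R m := fun m =>
    PowerSeries.mem_high.mpr fun n hn => by
      obtain ⟨k, rfl⟩ := Nat.exists_eq_add_of_le hn
      rw [map_sub, hψ, PowerSeries.coeff_mk, hstable n k n le_rfl, sub_self]
  have hlim' : ∀ m, (φ m).toSeries - ψ ∈ high Unit R m := fun m => by
    rw [← neg_sub]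
    exact Ideal.neg_mem_iff _ |>.mpr (hlim m)
  have hψ0 : ψ.constantCoeff = 0 := by
    rw [hψ, PowerSeries.constantCoeff_mk, PowerSeries.coeff_zero_eq_constantCoeff_apply]
    exact (φ 0).constantCoeff_eq
  have hψ1 : ψ.coeff 1 = 1 := by rw [hψ, PowerSeries.coeff_mk, h1]
  have hself : ∀ {σ : Type} {N : ℕ} (a : MvPowerSeries σ R), a - a ∈ high σ R N := fun a => by
    rw [sub_self]
    exact Ideal.zero_mem _
  refine ⟨⟨ψ, hψ0, by rw [hψ1]; exact isUnit_one, ?_, fun a => ?_⟩, hψ1⟩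
  · refine sub_eq_zero.mp (eq_zero_of_forall_mem_high fun m => ?_)
    have c0 := MvPowerSeries.constantCoeff_X (R := R) (0 : Fin 2)
    have c1 := MvPowerSeries.constantCoeff_X (R := R) (1 : Fin 2)
    have hm0 := (φ m).constantCoeff_eq
    have hKH : H.toPowerSeries - (K m).toPowerSeries ∈ high (Fin 2) R m := by
      rw [← neg_sub]
      exact Ideal.neg_mem_iff _ |>.mpr (hK m)
    have e1 := comp_sub_comp_mem H.zero_constantCoeff (K m).zero_constantCoeff hKH (hlim m)
    have e2 := pair_sub_pair_mem (constantCoeff_comp c0 hm0) (constantCoeff_comp c1 hm0)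
      (constantCoeff_comp c0 hψ0) (constantCoeff_comp c1 hψ0)
      (comp_sub_comp_mem c0 c0 (hself _) (hlim' m)) (comp_sub_comp_mem c1 c1 (hself _) (hlim' m))
      (hself G.toPowerSeries)
    rw [← (φ m).map_group] at e2
    have := Ideal.add_mem _ e1 e2
    rwa [sub_add_sub_cancel] at this
  · refine sub_eq_zero.mp (eq_zero_of_forall_mem_high fun m => ?_)
    have hKH : H.act a - (K m).act a ∈ high Unit R m := by
      rw [← neg_sub]
      exact Ideal.neg_mem_iff _ |>.mpr (hK' m a)
    have e1 := comp_sub_comp_mem (τ := Unit) (H.act_constantCoeff a) ((K m).act_constantCoeff a)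
      hKH (hlim m)
    have e2 := comp_sub_comp_mem (τ := Unit) (φ m).constantCoeff_eq hψ0 (hlim' m)
      (hself (G.act a))
    rw [← (φ m).map_act] at e2
    have := Ideal.add_mem _ e1 e2
    rwa [sub_add_sub_cancel] at this

/-! ### The strict isomorphism as an infinite composite -/

section Strict

variable {p : ℕ} [Fact p.Prime] {κ : Type*} [Field κ] [Algebra ℤ_[p] κ]

/-- One further parameter is removed, by solving `b ^ (p ^ (g+1)) - b + c (g + m) = 0`. The
congruence of `ψ` to `X` in growing degrees is what makes the successive composites converge. -/
theorem exists_iso_improve [IsAlgClosed κ] (hκ : algebraMap ℤ_[p] κ p = 0) {g m : ℕ} (hm : 0 < m)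
    {c : ℕ → κ} (hc : ∀ i < g + m, c i = if i = g then 1 else 0) :
    ∃ (c' : ℕ → κ) (ψ : Iso (typicalModule (p : ℤ_[p]) PadicInt.irreducible_p c')
        (typicalModule (p : ℤ_[p]) PadicInt.irreducible_p c)),
      (∀ i < g + (m + 1), c' i = if i = g then 1 else 0) ∧
      ψ.toSeries - PowerSeries.X ∈ high Unit κ m := by
  have hp : p.Prime := Fact.out
  obtain ⟨b, hb⟩ := exists_pow_sub_self_add_eq_zero (κ := κ)
    (Nat.one_lt_pow (Nat.succ_ne_zero g) hp.one_lt) (c (g + m))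
  obtain ⟨c', ψ, hψ⟩ := exists_iso_typicalModule (p := p) c b hm
  refine ⟨c', ψ, fun i hi => typicalModule_param_of_iso hκ hm hc hb rfl rfl ψ hψ i (by omega), ?_⟩
  have hmem : (PowerSeries.C b * PowerSeries.X ^ p ^ m : PowerSeries κ) ∈ high Unit κ m :=
    C_mul_X_pow_mem_high _ (Nat.lt_pow_self hp.one_lt)
  have h := formalGroup_pair_sub_add_mem
    (typicalModule (p : ℤ_[p]) PadicInt.irreducible_p c).toFormalGroup (τ := Unit) (N := m)
    (a := (PowerSeries.X : PowerSeries κ)) PowerSeries.constantCoeff_X hm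
    (high_mono (Nat.sub_le m 1) hmem)
  rw [hψ]
  have := Ideal.add_mem _ h hmem
  convert this using 1
  ring

/-- Over an algebraically closed field of characteristic `p`, a `p`-typical formal module with
`[p](X) ≡ X ^ (p ^ (g + 1))` is strictly isomorphic to the one with `v_{g+1} = 1` and `v_i = 0`
otherwise. -/
theorem exists_strictIso_typicalModule [IsAlgClosed κ] (hκ : algebraMap ℤ_[p] κ p = 0) {g : ℕ}
    {c : ℕ → κ} (hc : ∀ i ≤ g, c i = if i = g then 1 else 0) :
    ∃ φ : Iso (typicalModule (p : ℤ_[p]) PadicInt.irreducible_p fun i => if i = g then (1 : κ) else 0)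
        (typicalModule (p : ℤ_[p]) PadicInt.irreducible_p c), φ.IsStrict := by
  have hp : p.Prime := Fact.out
  set M : (ℕ → κ) → FormalModule ℤ_[p] κ := typicalModule (p : ℤ_[p]) PadicInt.irreducible_p
  have hstep : ∀ m (c : {c : ℕ → κ // ∀ i < g + (m + 1), c i = if i = g then 1 else 0}),
      ∃ (c' : {c : ℕ → κ // ∀ i < g + (m + 1 + 1), c i = if i = g then 1 else 0})
        (ψ : Iso (M c'.1) (M c.1)), ψ.toSeries - PowerSeries.X ∈ high Unit κ (m + 1) :=
    fun m c => by
      obtain ⟨c', ψ, hc', hψ⟩ := exists_iso_improve hκ (Nat.succ_pos m) c.2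
      exact ⟨⟨c', hc'⟩, ψ, hψ⟩
  choose next ψ hψ using hstep
  -- Stage `m` has standard parameters at all indices below `g + m + 1`, and `φ m` composes the
  -- coordinate changes made so far, with fixed target the original module. A new change acts on the
  -- source side and is congruent to `X`, so it alters `φ m` only in high degree.
  let s : ∀ m, {c : ℕ → κ // ∀ i < g + (m + 1), c i = if i = g then 1 else 0} :=
    fun m => Nat.rec ⟨c, fun i hi => hc i (Nat.le_of_lt_succ hi)⟩ (fun m x => next m x) m
  let φ : ∀ m, Iso (M (s m).1) (M c) :=
    fun m => Nat.rec (Iso.refl _) (fun m x => (ψ m (s m)).trans x) m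
  have hφs : ∀ m, (φ (m + 1)).toSeries = (φ m).toSeries.subst (ψ m (s m)).toSeries := fun _ => rfl
  have hφ : ∀ m, (φ (m + 1)).toSeries - (φ m).toSeries ∈ high Unit κ (m + 1) := fun m => by
    have := comp_sub_comp_mem (τ := Unit) (f := (φ m).toSeries) (g := (φ m).toSeries)
      (ψ m (s m)).constantCoeff_eq PowerSeries.constantCoeff_X (hψ m (s m))
      (by rw [sub_self]; exact Ideal.zero_mem _)
    have e : PowerSeries.subst PowerSeries.X (φ m).toSeries = (φ m).toSeries :=
      PowerSeries.X_subst _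
    rw [hφs]
    rwa [e] at this
  have h1 : ∀ m, (φ m).toSeries.coeff 1 = 1 := fun m => by
    induction m with
    | zero => exact PowerSeries.coeff_one_X
    | succ m ih =>
      have := PowerSeries.mem_high.mp (hφ m) 1 (by omega)
      rw [map_sub, sub_eq_zero] at this
      rw [this, ih]
  -- Any parameter visible up to degree `m` has index `i` with `i + 1 < p ^ (i + 1) ≤ m`, and is
  -- already standard at stage `m`.
  have hcong := fun m => typicalModule_congr (π := (p : ℤ_[p])) PadicInt.irreducible_p (c := (s m).1)
    (c' := fun i => if i = g then (1 : κ) else 0) (N := m) fun i hi => by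
      rw [PadicInt.card_residueField] at hi
      have : i + 1 < p ^ (i + 1) := Nat.lt_pow_self hp.one_lt
      exact (s m).2 i (by omega)
  exact exists_iso_of_limit φ h1 (fun m => high_mono (Nat.le_succ m) (hφ m))
    (fun m => (hcong m).1) fun m a => (hcong m).2 a

end Strict

/-! ### Topology of the automorphism groups -/

namespace FormalModule.Aut

open Topology Filter

variable {A R : Type*} [CommRing A] [CommRing R] [Algebra A R] {G H : FormalModule A R}

/-- Each of the finitely many coefficients of degree at most `N` is locally constant. Together with
`continuous_of_eventually`, this turns topological statements into congruences of power series. -/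
theorem eventually_sub_mem_high (θ : Aut G) (N : ℕ) :
    ∀ᶠ η in 𝓝 θ, Iso.toSeries η - Iso.toSeries θ ∈ high Unit R N := by
  have h : ∀ n, ∀ᶠ η : Aut G in 𝓝 θ,
      PowerSeries.coeff n (Iso.toSeries η) = PowerSeries.coeff n (Iso.toSeries θ) := fun n => by
    let _ : TopologicalSpace R := ⊥
    have : DiscreteTopology R := ⟨rfl⟩
    have hc : Continuous fun η : Aut G => PowerSeries.coeff n (Iso.toSeries η) :=
      continuous_iff_le_induced.mpr (iInf_le _ n)
    have := hc.continuousAt (x := θ)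
    rw [ContinuousAt, nhds_discrete R, tendsto_pure] at this
    exact this
  filter_upwards [(Finset.range (N + 1)).eventually_all.mpr fun n _ => h n] with η hη
  refine PowerSeries.mem_high.mpr fun n hn => ?_
  rw [map_sub, hη n (Finset.mem_range.mpr (by omega)), sub_self]

theorem continuous_of_eventually {X : Type*} [TopologicalSpace X] {f : X → Aut G}
    (h : ∀ x N, ∀ᶠ y in 𝓝 x, Iso.toSeries (f y) - Iso.toSeries (f x) ∈ high Unit R N) :
    Continuous f := by
  refine continuous_iInf_rng.mpr fun n => continuous_induced_rng.mpr ?_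
  let _ : TopologicalSpace R := ⊥
  have : DiscreteTopology R := ⟨rfl⟩
  refine continuous_iff_continuousAt.mpr fun x => ?_
  rw [ContinuousAt, nhds_discrete R, tendsto_pure]
  filter_upwards [h x n] with y hy
  have := PowerSeries.mem_high.mp hy n le_rfl
  rwa [map_sub, sub_eq_zero] at this

/-- Composition with fixed series on either side preserves congruences modulo every degree. -/
theorem continuous_conj (φ : Iso G H) : Continuous (conj φ) := by
  refine continuous_of_eventually fun θ N => ?_
  filter_upwards [eventually_sub_mem_high θ N] with η hη
  have hself : ∀ a : PowerSeries R, a - a ∈ high Unit R N := fun a => by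
    rw [sub_self]
    exact Ideal.zero_mem _
  have h1 := comp_sub_comp_mem (τ := Unit) φ.symm.constantCoeff_eq φ.symm.constantCoeff_eq
    (hself _) hη
  exact comp_sub_comp_mem (τ := Unit)
    (constantCoeff_comp φ.symm.constantCoeff_eq (Iso.constantCoeff_eq η))
    (constantCoeff_comp φ.symm.constantCoeff_eq (Iso.constantCoeff_eq θ)) h1 (hself φ.toSeries)

theorem continuous_conj_symm (φ : Iso G H) : Continuous (conj φ).symm := by
  refine continuous_of_eventually fun θ N => ?_
  filter_upwards [eventually_sub_mem_high θ N] with η hη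
  have hself : ∀ a : PowerSeries R, a - a ∈ high Unit R N := fun a => by
    rw [sub_self]
    exact Ideal.zero_mem _
  have h1 := comp_sub_comp_mem (τ := Unit) φ.constantCoeff_eq φ.constantCoeff_eq (hself _) hη
  exact comp_sub_comp_mem (τ := Unit)
    (constantCoeff_comp φ.constantCoeff_eq (Iso.constantCoeff_eq η))
    (constantCoeff_comp φ.constantCoeff_eq (Iso.constantCoeff_eq θ)) h1 (hself φ.symm.toSeries)

/-- Conjugation by an isomorphism, as a homeomorphism. -/
noncomputable def conjHomeomorph (φ : Iso G H) : Aut G ≃ₜ Aut H where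
  toEquiv := (conj φ).toEquiv
  continuous_toFun := continuous_conj φ
  continuous_invFun := continuous_conj_symm φ

variable (B : Type*) [CommRing B] [Algebra B A] [Algebra B R] [IsScalarTower B A R]

theorem range_restrictScalars (G : FormalModule A R) :
    Set.range (restrictScalars B G) = {θ | ∀ a, (Iso.toSeries θ).subst (G.act a) =
      (G.act a).subst (Iso.toSeries θ)} := by
  ext θ
  constructor
  · rintro ⟨η, rfl⟩ a
    exact Iso.map_act η a
  · intro h
    exact ⟨⟨Iso.toSeries θ, Iso.constantCoeff_eq θ, Iso.isUnit_coeff_one θ, Iso.map_group θ, h⟩,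
      rfl⟩

/-- If `θ` fails to commute with some `[a]`, the failure is visible below some degree `N`, and
therefore persists for all automorphisms congruent to `θ` up to degree `N`. -/
theorem isClosed_range_restrictScalars (G : FormalModule A R) :
    IsClosed (Set.range (restrictScalars B G)) := by
  rw [range_restrictScalars, ← isOpen_compl_iff, isOpen_iff_eventually]
  intro θ hθ
  simp only [Set.mem_compl_iff, Set.mem_ofPred_eq, not_forall] at hθ ⊢
  obtain ⟨a, ha⟩ := hθ
  obtain ⟨N, hN⟩ : ∃ N, (Iso.toSeries θ).subst (G.act a) - (G.act a).subst (Iso.toSeries θ) ∉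
      high Unit R N := by
    by_contra! h
    exact ha (sub_eq_zero.mp (eq_zero_of_forall_mem_high h))
  filter_upwards [eventually_sub_mem_high θ N] with η hη
  refine ⟨a, fun h => hN ?_⟩
  have hself : ∀ b : PowerSeries R, b - b ∈ high Unit R N := fun b => by
    rw [sub_self]
    exact Ideal.zero_mem _
  have h1 := comp_sub_comp_mem (τ := Unit) (G.act_constantCoeff a) (G.act_constantCoeff a)
    (hself _) hη
  have h2 := comp_sub_comp_mem (τ := Unit) (Iso.constantCoeff_eq η) (Iso.constantCoeff_eq θ)
    hη (hself (G.act a))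
  rw [h] at h1
  have := Ideal.sub_mem _ h2 h1
  convert this using 1
  ring

theorem isClosedEmbedding_restrictScalars (G : FormalModule A R) :
    IsClosedEmbedding (restrictScalars B G) where
  eq_induced := by
    change _ = TopologicalSpace.induced _ (⨅ m : ℕ, TopologicalSpace.induced _ ⊥)
    rw [induced_iInf]
    refine iInf_congr fun m => ?_
    rw [induced_compose]
    rfl
  injective := fun θ η h => Iso.ext (congrArg (fun x : Aut (G.restrictScalars B) => Iso.toSeries x) h)
  isClosed_range := isClosed_range_restrictScalars B G

theorem isClosedEmbedding_conj_comp_restrictScalars (G : FormalModule A R) {H : FormalModule B R}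
    (φ : Iso (G.restrictScalars B) H) :
    IsClosedEmbedding ((conj φ).toMonoidHom.comp (restrictScalars B G)) :=
  (conjHomeomorph φ).isClosedEmbedding.comp (isClosedEmbedding_restrictScalars B G)

end FormalModule.Aut

/-! ### The underlying formal `ℤ_p`-module, and the action of `π` -/

section Restrict

variable {p : ℕ} [Fact p.Prime] {A : Type*} [CommRing A] [IsDomain A] [IsDiscreteValuationRing A]
  [Finite (IsLocalRing.ResidueField A)] {κ : Type*} [CommRing κ] [Algebra A κ]

/-- The formal `ℤ_p`-module underlying an `A`-typical formal `A`-module is `p`-typical. -/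
theorem exists_restrictScalars_eq_typicalModule [Algebra ℤ_[p] A] [Algebra ℤ_[p] κ]
    [IsScalarTower ℤ_[p] A κ] (hA : Function.Injective (algebraMap ℤ_[p] A)) {r : ℕ}
    (hr : Nat.card (IsLocalRing.ResidueField A) = p ^ r) {π : A} (hπ : Irreducible π) (a : ℕ → κ) :
    ∃ c : ℕ → κ, (typicalModule π hπ a).restrictScalars ℤ_[p] =
      typicalModule (p : ℤ_[p]) PadicInt.irreducible_p c := by
  obtain ⟨f, hf, hlog⟩ := LiftRing.exists_log hπ fun i => LiftRing.lift A κ (a i)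
  have hι := LiftRing.toFractionRing_injective A κ
  have hιA := LiftRing.comp_injective A κ
  set ι := algebraMap (LiftRing A κ) (FractionRing (LiftRing A κ)) with hιdef
  have hιZ : Function.Injective (ι.comp (algebraMap ℤ_[p] (LiftRing A κ))) := by
    rw [IsScalarTower.algebraMap_eq ℤ_[p] A (LiftRing A κ), ← RingHom.comp_assoc,
      RingHom.coe_comp]
    exact hιA.comp hA
  have hlogZ := hlog.restrictScalars ℤ_[p]
  -- Powers of `q = p ^ r` are powers of `p`, so an `A`-typical logarithm is also `p`-typical.
  obtain ⟨c, hc⟩ := exists_isHazewinkelLog_of_typical p hιZ hlog.coeff_one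
    (fun j hj => hf.coeff_eq_zero j fun m => by
      rw [hr, ← pow_mul]
      exact hj _)
    (typicalModule π hπ fun i => LiftRing.lift A κ (a i)).zero_constantCoeff hlog.map_group
  have hlogc : IsLogarithm ι (typicalModule (p : ℤ_[p]) PadicInt.irreducible_p c) f :=
    IsHazewinkelLog.isLogarithm hιZ PadicInt.irreducible_p (by
      rw [PadicInt.card_residueField]
      exact hc)
  have heq := hlogZ.eq_of_eq hlogc hι
  refine ⟨fun i => (LiftRing.proj A κ).restrictScalars ℤ_[p] (c i), ?_⟩
  rw [← typicalModule_baseChange, ← heq, typicalModule_eq_baseChange_lift hπ a]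
  rfl

/-- Teichmüller elements act linearly on `A`-typical formal `A`-modules. -/
theorem typicalModule_act_of_pow_card_eq {π : A} (hπ : Irreducible π) (a : ℕ → κ) {ζ : A}
    (hζ : ζ ^ Nat.card (IsLocalRing.ResidueField A) = ζ) :
    (typicalModule π hπ a).act ζ = PowerSeries.C (algebraMap A κ ζ) * PowerSeries.X := by
  obtain ⟨f, hf, hlog⟩ := LiftRing.exists_log hπ fun i => LiftRing.lift A κ (a i)
  have hι := LiftRing.toFractionRing_injective A κ
  set ι := algebraMap (LiftRing A κ) (FractionRing (LiftRing A κ)) with hιdef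
  set M := typicalModule π hπ fun i => LiftRing.lift A κ (a i) with hM
  set q := Nat.card (IsLocalRing.ResidueField A) with hq
  -- Consequently `f(ζX) = ζ f(X)` for a series supported on powers of `q`, so `ζX` has the
  -- logarithm that characterises `[ζ]`.
  have hpow : ∀ m, ζ ^ q ^ m = ζ := fun m => by
    induction m with
    | zero => rw [pow_zero, pow_one]
    | succ m ih => rw [pow_succ, pow_mul, ih, hζ]
  have key : M.act ζ = PowerSeries.C (algebraMap A (LiftRing A κ) ζ) * PowerSeries.X := by
    refine hlog.eq_of_comp_eq hι (τ := Unit) (M.act_constantCoeff ζ)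
      ?_ ?_
    · change (PowerSeries.C (algebraMap A (LiftRing A κ) ζ) * PowerSeries.X).constantCoeff = 0
      rw [map_mul, PowerSeries.constantCoeff_X, mul_zero]
    refine (hlog.map_act ζ).trans ?_
    have e : MvPowerSeries.map ι (PowerSeries.C (algebraMap A (LiftRing A κ) ζ) * PowerSeries.X) =
        (PowerSeries.C (ι (algebraMap A (LiftRing A κ) ζ)) * PowerSeries.X ^ 1 :
          PowerSeries _) := by
      refine (map_mul (PowerSeries.map ι) _ _).trans ?_
      rw [PowerSeries.map_C, PowerSeries.map_X, pow_one]
    rw [e]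
    refine PowerSeries.ext fun n => ?_
    rw [PowerSeries.coeff_comp_C_mul_X_pow _ _ one_ne_zero, if_pos (one_dvd n), Nat.div_one,
      PowerSeries.coeff_C_mul]
    by_cases hn : ∃ m, n = q ^ m
    · obtain ⟨m, rfl⟩ := hn
      rw [← map_pow, ← map_pow, hpow, mul_comm]
    · push Not at hn
      rw [hf.coeff_eq_zero n hn, mul_zero, zero_mul]
  rw [typicalModule_eq_baseChange_lift hπ a]
  change PowerSeries.map _ (M.act ζ) = _
  rw [key, map_mul, PowerSeries.map_C, PowerSeries.map_X]
  congr 2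
  exact (LiftRing.proj A κ).commutes ζ

/-- With a single nonzero parameter, the leading-term congruence holds at every later index `i` with
vanishing second term, hence to all orders. -/
theorem typicalModule_act_uniformizer {π : A} (hπ : Irreducible π) (hκ : algebraMap A κ π = 0)
    (k : ℕ) (ω : κ) :
    (typicalModule π hπ fun i => if i = k then ω else 0).act π = PowerSeries.C ω *
      PowerSeries.X ^ Nat.card (IsLocalRing.ResidueField A) ^ (k + 1) := by
  refine sub_eq_zero.mp (eq_zero_of_forall_mem_high fun N => ?_)
  have h := act_uniformizer_leading hπ hκ (c := fun i => if i = k then ω else 0) (a := ω)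
    (h := k) (i := N + k + 1) (fun _ _ => rfl) (Or.inl (by omega))
  rw [if_neg (by omega), map_zero, zero_mul, add_zero] at h
  refine high_mono ?_ h
  have : N + k + 1 + 1 < Nat.card (IsLocalRing.ResidueField A) ^ (N + k + 1 + 1) :=
    Nat.lt_pow_self (by have := two_le_card_residueField (A := A); omega)
  omega

/-- Composing monomials `ω X ^ Q` multiplies the coefficient by successive `Q`-powers of `ω`. The
resulting geometric sum is the exponent `(q ^ (en) - 1) / (q ^ n - 1)` in the equation for `ω`. -/
theorem typicalModule_act_uniformizer_pow {π : A} (hπ : Irreducible π)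
    (hκ : algebraMap A κ π = 0) (k : ℕ) (ω : κ) (j : ℕ) :
    (typicalModule π hπ fun i => if i = k then ω else 0).act (π ^ j) = PowerSeries.C
      (ω ^ ∑ i ∈ Finset.range j, (Nat.card (IsLocalRing.ResidueField A) ^ (k + 1)) ^ i) *
      PowerSeries.X ^ (Nat.card (IsLocalRing.ResidueField A) ^ (k + 1)) ^ j := by
  have hq := two_le_card_residueField (A := A)
  set q := Nat.card (IsLocalRing.ResidueField A)
  induction j with
  | zero =>
    rw [pow_zero, Finset.sum_range_zero, pow_zero, map_one, one_mul, pow_zero, pow_one]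
    exact FormalModule.act_one _
  | succ j ih =>
    have hs : PowerSeries.HasSubst (PowerSeries.C
        (ω ^ ∑ i ∈ Finset.range j, (q ^ (k + 1)) ^ i) * PowerSeries.X ^ (q ^ (k + 1)) ^ j :
          PowerSeries κ) :=
      PowerSeries.HasSubst.of_constantCoeff_zero' (constantCoeff_C_mul_X_pow _
        (pow_pos (pow_pos (by omega) _) _).ne')
    rw [pow_succ', FormalModule.act_mul, ih, typicalModule_act_uniformizer hπ hκ,
      PowerSeries.subst_mul hs, PowerSeries.subst_pow hs, PowerSeries.subst_X hs,
      PowerSeries.subst_C]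
    change PowerSeries.C ω * _ = _
    rw [mul_pow, ← map_pow, ← pow_mul, ← pow_mul, ← mul_assoc, ← map_mul, ← pow_succ', geom_sum_succ,
      ← pow_succ, mul_comm (q ^ (k + 1)) (∑ i ∈ _, _)]

end Restrict

section Param

variable {p : ℕ} [Fact p.Prime] {κ : Type*} [Field κ] [Algebra ℤ_[p] κ]

/-- Once the earlier parameters are known to be standard, the next one appears as the coefficient of
`X ^ (p ^ (i+1))` in `[p]`, so knowledge of `[p]` up to degree `N` determines every parameter with
`p ^ (i+1) ≤ N`. -/
theorem typicalModule_param_of_act (hκ : algebraMap ℤ_[p] κ p = 0) {g N : ℕ} {c : ℕ → κ}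
    (h : (typicalModule (p : ℤ_[p]) PadicInt.irreducible_p c).act (p : ℤ_[p]) -
      PowerSeries.X ^ p ^ (g + 1) ∈ high Unit κ N) (i : ℕ) (hi : p ^ (i + 1) ≤ N) :
    c i = if i = g then 1 else 0 := by
  have hp : p.Prime := Fact.out
  induction i using Nat.strong_induction_on with
  | _ i ih =>
    set a : κ := if g < i then 1 else 0 with ha
    have hD := act_uniformizer_leading PadicInt.irreducible_p hκ (c := c) (a := a) (h := g)
      (i := i) (fun j hj => by
        rw [ih j hj ((Nat.pow_le_pow_right hp.pos (by omega)).trans hi), ha]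
        split_ifs <;> first | rfl | omega) (by
        rw [ha]
        by_cases h : g < i
        · exact Or.inl h
        · exact Or.inr (if_neg h))
    rw [PadicInt.card_residueField] at hD
    have h1 := Ideal.sub_mem _ (high_mono hi h) hD
    rw [sub_sub_sub_cancel_left] at h1
    have h2 := PowerSeries.mem_high.mp h1 _ le_rfl
    have hinj : p ^ (i + 1) = p ^ (g + 1) ↔ i = g := by
      rw [Nat.pow_right_inj hp.two_le]
      omega
    rw [map_sub, map_add, PowerSeries.coeff_C_mul, PowerSeries.coeff_C_mul,
      PowerSeries.coeff_X_pow, PowerSeries.coeff_X_pow, if_pos rfl] at h2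
    simp only [hinj] at h2
    by_cases hig : i = g
    · simp only [hig, ha, lt_irrefl, if_true, if_false] at h2 ⊢
      linear_combination h2
    · simp only [hig, if_false] at h2 ⊢
      linear_combination h2

end Param

theorem FormalModule.Iso.isStrict_symm {A R : Type*} [CommRing A] [CommRing R] [Algebra A R]
    {G H : FormalModule A R} {φ : Iso G H} (h : φ.IsStrict) : φ.symm.IsStrict := by
  have h1 := congrArg (fun ψ : Iso G G => ψ.toSeries.coeff 1) φ.trans_symm
  have h2 : (φ.trans φ.symm).toSeries.coeff 1 = φ.symm.toSeries.coeff 1 * φ.toSeries.coeff 1 :=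
    Iso.coeff_one_comp _ _ φ.constantCoeff_eq
  change (φ.trans φ.symm).toSeries.coeff 1 = (PowerSeries.X : PowerSeries R).coeff 1 at h1
  rw [h2, PowerSeries.coeff_one_X] at h1
  unfold Iso.IsStrict at h ⊢
  rwa [h, mul_one] at h1

/-! ### Ramification and residue degree -/

section PadicField

variable (p : ℕ) [Fact p.Prime] (K : Type*) [Field K] [Algebra ℚ_[p] K] [FiniteDimensional ℚ_[p] K]
  [Algebra ℤ_[p] K] [IsScalarTower ℤ_[p] ℚ_[p] K]

theorem residue_natCast_eq_zero :
    IsLocalRing.residue (integralClosure ℤ_[p] K) (p : integralClosure ℤ_[p] K) = 0 := by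
  have := faithfulSMul_integralClosure p K
  have : IsLocalHom (algebraMap ℤ_[p] (integralClosure ℤ_[p] K)) := inferInstance
  rw [IsLocalRing.residue_eq_zero_iff, IsLocalRing.mem_maximalIdeal, mem_nonunits_iff]
  intro h
  rw [← map_natCast (algebraMap ℤ_[p] (integralClosure ℤ_[p] K)), isUnit_map_iff] at h
  exact PadicInt.irreducible_p.not_isUnit h

theorem exists_card_residueField_eq_pow :
    ∃ r, Nat.card (IsLocalRing.ResidueField (integralClosure ℤ_[p] K)) = p ^ r := by
  have h0 : (p : IsLocalRing.ResidueField (integralClosure ℤ_[p] K)) = 0 := by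
    rw [← map_natCast (IsLocalRing.residue (integralClosure ℤ_[p] K)), residue_natCast_eq_zero]
  have : CharP (IsLocalRing.ResidueField (integralClosure ℤ_[p] K)) p :=
    ringChar.of_eq (CharP.ringChar_of_prime_eq_zero Fact.out h0)
  have := Fintype.ofFinite (IsLocalRing.ResidueField (integralClosure ℤ_[p] K))
  obtain ⟨n, -, hn⟩ := FiniteField.card (IsLocalRing.ResidueField (integralClosure ℤ_[p] K)) p
  exact ⟨n, by rw [Nat.card_eq_fintype_card, hn]⟩

end PadicField

set_option linter.deprecated false in
/-- `q ^ e = p ^ d`. -/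
theorem card_residueField_pow_eq (p : ℕ) [Fact p.Prime] (K : Type*) [Field K] [Algebra ℚ_[p] K]
    [FiniteDimensional ℚ_[p] K] [Algebra ℤ_[p] K] [IsScalarTower ℤ_[p] ℚ_[p] K] (A : Type*)
    [CommRing A] [IsDomain A] [IsDiscreteValuationRing A] [Algebra ℤ_[p] A] [Module.Finite ℤ_[p] A]
    [Algebra A K] [IsFractionRing A K] [IsScalarTower ℤ_[p] A K]
    {π : A} (hπ : Irreducible π) {e : ℕ} (u : Aˣ) (hu : π ^ e = u * (p : A)) :
    Nat.card (IsLocalRing.ResidueField A) ^ e = p ^ Module.finrank ℚ_[p] K := by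
  set P := IsLocalRing.maximalIdeal ℤ_[p] with hP
  -- The ring `A / pA` is counted twice: as a vector space of dimension `[K : ℚ_p]` over the field
  -- with `p` elements, and as `A` modulo the `e`-th power of its maximal ideal.
  have hmap : P.map (algebraMap ℤ_[p] A) = IsLocalRing.maximalIdeal A ^ e := by
    rw [hP, PadicInt.irreducible_p.maximalIdeal_eq, hπ.maximalIdeal_eq, Ideal.map_span,
      Set.image_singleton, Ideal.span_singleton_pow, hu, map_natCast,
      Ideal.span_singleton_mul_left_unit u.isUnit]
  have h1 := Ideal.finrank_quotient_map (R := ℤ_[p]) (S := A) (p := P) ℚ_[p] K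
  have h2 : Nat.card (A ⧸ P.map (algebraMap ℤ_[p] A)) =
      Nat.card (ℤ_[p] ⧸ P) ^ Module.finrank ℚ_[p] K := by
    rw [← h1]
    let _ := Ideal.Quotient.field P
    exact Module.natCard_eq_pow_finrank
  have hne : IsLocalRing.maximalIdeal A ≠ ⊥ := IsDiscreteValuationRing.not_a_field A
  have h4 := cardQuot_pow_of_prime (P := IsLocalRing.maximalIdeal A) hne (i := e)
  rw [Submodule.cardQuot_apply, Submodule.cardQuot_apply, ← hmap] at h4
  exact h4.symm.trans (h2.trans (congrArg (· ^ _) (PadicInt.card_residueField p)))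

/-- Up to degree `T` only the linear term of `[u⁻¹]` contributes, and it cancels `u`. This suffices
for the leading coefficient of `[p]`, with no assumption on the unit. -/
theorem FormalModule.act_subst_C_mul_X_pow_sub_mem {A κ : Type*} [CommRing A] [CommRing κ]
    [Algebra A κ] (G : FormalModule A κ) (u : Aˣ) {T : ℕ} (hT : T ≠ 0) :
    (G.act (u⁻¹ : Aˣ)).subst (PowerSeries.C (algebraMap A κ u) * PowerSeries.X ^ T) -
      PowerSeries.X ^ T ∈ high Unit κ T := by
  refine PowerSeries.mem_high.mpr fun n hn => ?_
  rw [map_sub, PowerSeries.coeff_comp_C_mul_X_pow _ _ hT, PowerSeries.coeff_X_pow]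
  by_cases hnT : n = T
  · subst hnT
    rw [if_pos dvd_rfl, if_pos rfl, Nat.div_self (by omega), pow_one, G.act_coeff_one, ← map_mul,
      Units.inv_mul, map_one, sub_self]
  · rw [if_neg hnT, sub_zero]
    split_ifs with hd
    · have hn0 : n = 0 := Nat.eq_zero_of_dvd_of_lt hd (by omega)
      rw [hn0, Nat.zero_div, PowerSeries.coeff_zero_eq_constantCoeff_apply]
      exact mul_eq_zero_of_left (G.act_constantCoeff (u⁻¹ : Aˣ)) _
    · rfl

/-! ### The action of `p` and the parameters of the underlying module -/

section Comparison

variable {p : ℕ} {A : Type*} [CommRing A] [IsDomain A] [IsDiscreteValuationRing A]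
  [Finite (IsLocalRing.ResidueField A)] {κ : Type*} [Field κ] [Algebra A κ]

/-- The action of `p = u⁻¹ π ^ e` on `_ω 𝔾^A_{1/(k+1)}`. -/
theorem typicalModule_act_natCast {π : A} (hπ : Irreducible π) (hκ : algebraMap A κ π = 0) {e : ℕ}
    {u : Aˣ} (hu : π ^ e = u * (p : A)) {k : ℕ} {ω : κ}
    (hω : ω ^ ∑ i ∈ Finset.range e, (Nat.card (IsLocalRing.ResidueField A) ^ (k + 1)) ^ i =
      algebraMap A κ u) :
    (typicalModule π hπ fun i => if i = k then ω else 0).act (p : A) =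
      ((typicalModule π hπ fun i => if i = k then ω else 0).act (u⁻¹ : Aˣ)).subst
        (PowerSeries.C (algebraMap A κ u) *
          PowerSeries.X ^ (Nat.card (IsLocalRing.ResidueField A) ^ (k + 1)) ^ e) := by
  have hp : (p : A) = (u⁻¹ : Aˣ) * π ^ e := by rw [hu, Units.inv_mul_cancel_left]
  rw [hp, FormalModule.act_mul, typicalModule_act_uniformizer_pow hπ hκ, hω]

/-- The condition on `u` makes `u⁻¹` a Teichmüller element, so `[u⁻¹]` is linear and the
cancellation is exact in all degrees. -/
theorem typicalModule_act_natCast_of_pow_eq_one {π : A} (hπ : Irreducible π)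
    (hκ : algebraMap A κ π = 0) {e : ℕ} {u : Aˣ} (hu : π ^ e = u * (p : A)) {k : ℕ} {ω : κ}
    (hω : ω ^ ∑ i ∈ Finset.range e, (Nat.card (IsLocalRing.ResidueField A) ^ (k + 1)) ^ i =
      algebraMap A κ u) (hu1 : u ^ (Nat.card (IsLocalRing.ResidueField A) - 1) = 1) :
    (typicalModule π hπ fun i => if i = k then ω else 0).act (p : A) =
      PowerSeries.X ^ (Nat.card (IsLocalRing.ResidueField A) ^ (k + 1)) ^ e := by
  have hq := two_le_card_residueField (A := A)
  have hζ : ((u⁻¹ : Aˣ) : A) ^ Nat.card (IsLocalRing.ResidueField A) = (u⁻¹ : Aˣ) := by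
    rw [← Units.val_pow_eq_pow_val, inv_pow, ← Nat.sub_add_cancel (by omega :
      1 ≤ Nat.card (IsLocalRing.ResidueField A)), pow_succ, hu1, one_mul]
  have hs : PowerSeries.HasSubst (PowerSeries.C (algebraMap A κ u) *
      PowerSeries.X ^ (Nat.card (IsLocalRing.ResidueField A) ^ (k + 1)) ^ e : PowerSeries κ) :=
    PowerSeries.HasSubst.of_constantCoeff_zero' (constantCoeff_C_mul_X_pow _
      (pow_pos (pow_pos (by omega) _) _).ne')
  rw [typicalModule_act_natCast hπ hκ hu hω, typicalModule_act_of_pow_card_eq hπ _ hζ,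
    PowerSeries.subst_mul hs, PowerSeries.subst_X hs, PowerSeries.subst_C]
  change PowerSeries.C _ * _ = _
  rw [← mul_assoc, ← map_mul, ← map_mul, Units.inv_mul, map_one, map_one, one_mul]

/-- The formal `ℤ_p`-module underlying `_ω 𝔾^A_{1/(k+1)}` is `p`-typical, and its first nonzero
parameter is `1`. -/
theorem exists_restrictScalars_eq_of_height [Fact p.Prime] [Algebra ℤ_[p] A] [Algebra ℤ_[p] κ]
    [IsScalarTower ℤ_[p] A κ] (hA : Function.Injective (algebraMap ℤ_[p] A)) {r : ℕ}
    (hr : Nat.card (IsLocalRing.ResidueField A) = p ^ r)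
    (hκp : algebraMap ℤ_[p] κ p = 0) {π : A} (hπ : Irreducible π) (hκ : algebraMap A κ π = 0)
    {e : ℕ} {u : Aˣ} (hu : π ^ e = u * (p : A)) {k g : ℕ} {ω : κ}
    (hω : ω ^ ∑ i ∈ Finset.range e, (Nat.card (IsLocalRing.ResidueField A) ^ (k + 1)) ^ i =
      algebraMap A κ u)
    (hg : (Nat.card (IsLocalRing.ResidueField A) ^ (k + 1)) ^ e = p ^ (g + 1)) :
    ∃ c : ℕ → κ, (typicalModule π hπ fun i => if i = k then ω else 0).restrictScalars ℤ_[p] =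
        typicalModule (p : ℤ_[p]) PadicInt.irreducible_p c ∧
      (∀ i ≤ g, c i = if i = g then 1 else 0) ∧
      (u ^ (Nat.card (IsLocalRing.ResidueField A) - 1) = 1 → c = fun i => if i = g then 1 else 0) := by
  have hp : p.Prime := Fact.out
  set G := typicalModule π hπ fun i => if i = k then ω else 0 with hG
  obtain ⟨c, hc⟩ := exists_restrictScalars_eq_typicalModule hA hr hπ fun i => if i = k then ω else 0
  have hact : (typicalModule (p : ℤ_[p]) PadicInt.irreducible_p c).act (p : ℤ_[p]) =
      G.act (p : A) := by
    rw [← hc]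
    change G.act (algebraMap ℤ_[p] A p) = _
    rw [map_natCast]
  -- In general `[p]` is known only up to degree `p ^ (g + 1)`, which determines the parameters of
  -- index at most `g`. In the Teichmüller case it is known exactly, which determines them all.
  refine ⟨c, hc, fun i hi => ?_, fun hu1 => funext fun i => ?_⟩
  · refine typicalModule_param_of_act (N := p ^ (g + 1)) hκp ?_ i
      (Nat.pow_le_pow_right hp.pos (by omega))
    rw [hact, typicalModule_act_natCast hπ hκ hu hω, hg]
    exact act_subst_C_mul_X_pow_sub_mem G u (pow_pos hp.pos _).ne'
  · refine typicalModule_param_of_act (N := p ^ (i + 1)) hκp ?_ i le_rfl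
    rw [hact, typicalModule_act_natCast_of_pow_eq_one hπ hκ hu hω hu1, hg, sub_self]
    exact Ideal.zero_mem _

end Comparison

/-! ### The theorem -/

theorem mainTheorem3 (p : ℕ) [Fact p.Prime] (K : Type*) [Field K] [Algebra ℚ_[p] K]
    [FiniteDimensional ℚ_[p] K] [Algebra ℤ_[p] K] [IsScalarTower ℤ_[p] ℚ_[p] K]
    (π : integralClosure ℤ_[p] K) (hπ : Irreducible π)
    (e : ℕ) (u : (integralClosure ℤ_[p] K)ˣ) (hu : π ^ e = u * (p : integralClosure ℤ_[p] K))
    (n : ℕ) (hn : 0 < n) (q : ℕ)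
    (hq : q = Nat.card (IsLocalRing.ResidueField (integralClosure ℤ_[p] K)))
    (ω : AlgebraicClosure (IsLocalRing.ResidueField (integralClosure ℤ_[p] K)))
    (hω : ω ^ ((q ^ (e * n) - 1) / (q ^ n - 1)) =
      algebraMap (IsLocalRing.ResidueField (integralClosure ℤ_[p] K)) _
        (IsLocalRing.residue (integralClosure ℤ_[p] K) u))
    (G : FormalModule (integralClosure ℤ_[p] K)
      (AlgebraicClosure (IsLocalRing.ResidueField (integralClosure ℤ_[p] K))))
    (hG : G = hazewinkelModule π hπ n ω)
    (H : FormalModule ℤ_[p]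
      (AlgebraicClosure (IsLocalRing.ResidueField (integralClosure ℤ_[p] K))))
    (hH : H = hazewinkelModule (p : ℤ_[p]) PadicInt.irreducible_p
      (Module.finrank ℚ_[p] K * n) 1) :
    (∃ φ : FormalModule.Iso (G.restrictScalars ℤ_[p]) H, φ.IsStrict) ∧
    (∀ φ : FormalModule.Iso (G.restrictScalars ℤ_[p]) H,
      Topology.IsClosedEmbedding ((FormalModule.Aut.conj φ).toMonoidHom.comp
        (FormalModule.Aut.restrictScalars ℤ_[p] G))) ∧
    (u ^ (q - 1) = 1 → G.restrictScalars ℤ_[p] = H) := by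
  have hp : p.Prime := Fact.out
  subst hG hH hq
  obtain ⟨k, rfl⟩ : ∃ k, n = k + 1 := ⟨n - 1, by omega⟩
  have hfs := faithfulSMul_integralClosure p K
  obtain ⟨r, hr⟩ := exists_card_residueField_eq_pow p K
  have hq2 := two_le_card_residueField (A := integralClosure ℤ_[p] K)
  -- Parameters are indexed from `0`, so `v_n` and `v_{dn}` have indices `k = n - 1` and `g = dn -
  -- 1`.
  obtain ⟨g, hg⟩ : ∃ g, Module.finrank ℚ_[p] K * (k + 1) = g + 1 :=
    ⟨_, (Nat.succ_pred_eq_of_pos (Nat.mul_pos Module.finrank_pos hn)).symm⟩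
  have hfrac : IsFractionRing (integralClosure ℤ_[p] K) K :=
    integralClosure.isFractionRing_of_finite_extension ℚ_[p] K
  have hcard := card_residueField_pow_eq p K (integralClosure ℤ_[p] K) hπ u hu
  have hT : (Nat.card (IsLocalRing.ResidueField (integralClosure ℤ_[p] K)) ^ (k + 1)) ^ e =
      p ^ (g + 1) := by
    rw [← pow_mul, mul_comm, pow_mul, hcard, ← pow_mul, hg]
  have hres : ∀ x : integralClosure ℤ_[p] K, algebraMap (integralClosure ℤ_[p] K)
      (AlgebraicClosure (IsLocalRing.ResidueField (integralClosure ℤ_[p] K))) x =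
      algebraMap (IsLocalRing.ResidueField (integralClosure ℤ_[p] K)) _
        (IsLocalRing.residue (integralClosure ℤ_[p] K) x) := fun x =>
    IsScalarTower.algebraMap_apply (integralClosure ℤ_[p] K)
      (IsLocalRing.ResidueField (integralClosure ℤ_[p] K)) _ x
  have hκ : algebraMap (integralClosure ℤ_[p] K)
      (AlgebraicClosure (IsLocalRing.ResidueField (integralClosure ℤ_[p] K))) π = 0 := by
    rw [hres, (residue_eq_zero_iff hπ π).mpr dvd_rfl, map_zero]
  have hκp : algebraMap ℤ_[p]
      (AlgebraicClosure (IsLocalRing.ResidueField (integralClosure ℤ_[p] K))) p = 0 := by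
    rw [map_natCast, ← map_natCast (algebraMap (integralClosure ℤ_[p] K) _), hres,
      residue_natCast_eq_zero, map_zero]
  have hω' : ω ^ ∑ i ∈ Finset.range e,
      (Nat.card (IsLocalRing.ResidueField (integralClosure ℤ_[p] K)) ^ (k + 1)) ^ i =
        algebraMap (integralClosure ℤ_[p] K) _ u := by
    rw [hres, ← hω, Nat.geomSum_eq (hq2.trans (Nat.le_self_pow (by omega) _)), ← pow_mul,
      mul_comm e]
  obtain ⟨c, hc, hcg, hcu⟩ := exists_restrictScalars_eq_of_height
    (FaithfulSMul.algebraMap_injective ℤ_[p] (integralClosure ℤ_[p] K)) hr hκp hπ hκ hu hω' hT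
  have hG : hazewinkelModule π hπ (k + 1) ω = typicalModule π hπ fun i => if i = k then ω else 0 := by
    rw [hazewinkelModule_eq_typicalModule]
    simp only [Nat.add_right_cancel_iff]
  have hH : hazewinkelModule (p : ℤ_[p]) PadicInt.irreducible_p
      (Module.finrank ℚ_[p] K * (k + 1))
      (1 : AlgebraicClosure (IsLocalRing.ResidueField (integralClosure ℤ_[p] K))) =
      typicalModule (p : ℤ_[p]) PadicInt.irreducible_p fun i => if i = g then 1 else 0 := by
    rw [hazewinkelModule_eq_typicalModule, hg]
    simp only [Nat.add_right_cancel_iff]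
  refine ⟨?_, fun φ => FormalModule.Aut.isClosedEmbedding_conj_comp_restrictScalars ℤ_[p] _ φ,
    fun hu1 => ?_⟩
  -- The limit of coordinate changes runs from `H` to the module underlying `G`, hence the inverse.
  · obtain ⟨φ, hφ⟩ := exists_strictIso_typicalModule hκp hcg
    rw [hG, hH, hc]
    exact ⟨φ.symm, FormalModule.Iso.isStrict_symm hφ⟩
  · rw [hG, hH, hc, hcu hu1]
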